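/- Conventions. "QPT" means non-uniform quantum polynomial time: a family, indexed by the security parameter $\lambda$, of quantum circuits of polynomial size (single-qubit unitaries and CNOT gates, with ancillas initialised to $|0\rangle$); a QPT adversary may also start with a quantum advice state $|\psi_\lambda\rangle$. A function $f:\mathbb N\to\mathbb R$ is negligible if for every constant $c$ one has $f(\lambda)<\lambda^{-c}$ for all large $\lambda$. Let $\Sigma=(\mathsf{KeyGen},\mathcal{E}nc,\mathcal{D}ec,\mathcal{D}el,\mathsf{Vrfy})$ be a tuple of QPT algorithms, a public key encryption scheme with certified everlasting deletion and plaintext space $\{0,1\}$: $\mathsf{KeyGen}(1^\lambda)$ outputs classical keys $(\mathsf{pk},\mathsf{sk})$; $\mathcal{E}nc(\mathsf{pk},m)$ outputs a classical verification key $\mathsf{vk}$ and a quantum ciphertext $\mathit{ct}$; $\mathcal{D}ec(\mathsf{sk},\mathit{ct})$ outputs a plaintext or $\bot$; $\mathcal{D}el(\mathit{ct})$ outputs a (possibly quantum) certificate; $\mathsf{Vrfy}(\mathsf{vk},\mathsf{cert})$ outputs $\top$ or $\bot$. $\Sigma$ is *certified everlasting IND-CPA secure* if for every QPT $\mathcal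 A_1$ and every unbounded $\mathcal A_2$ the function $|\Pr[\mathrm{Exp}(\lambda,0)=1]-\Pr[\mathrm{Exp}(\lambda,1)=1]|$ is negligible, where in $\mathrm{Exp}(\lambda,b)$: the challenger runs $(\mathsf{pk},\mathsf{sk})\leftarrow\mathsf{KeyGen}(1^\lambda)$ and sends $\mathsf{pk}$ to $\mathcal A_1$, who answers with plaintexts $m_0,m_1$; the challenger computes $(\mathsf{vk},\mathit{ct})\leftarrow\mathcal{E}nc(\mathsf{pk},m_b)$ and sends $\mathit{ct}$ to $\mathcal A_1$; $\mathcal A_1$ sends a certificate to the challenger and its internal state to $\mathcal A_2$; if $\mathsf{Vrfy}$ accepts the certificate under $\mathsf{vk}$, then $\mathcal A_2$ gets $\mathsf{sk}$ and its output bit $b'$ is the outcome of the experiment; otherwise $\mathcal A_2$ gets $\bot$ and the outcome is $\bot$. Let $n=n(\lambda)$ be polynomially bounded. From $\Sigma$ build the following receiver non-committing encryption scheme with plaintext space $\{0,1\}^n$. - $\mathsf{Setup}(1^\lambda)$: generate $(\mathsf{pk}_{i,\alpha},\mathsf{sk}_{i,\alpha})\leftarrow\Sigma.\mathsf{KeyGen}(1^\lambda)$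 for all $i\in[n]$, $\alpha\in\{0,1\}$; output $\mathsf{PK}=\{\mathsf{pk}_{i,\alpha}\}$ and $\mathsf{MSK}=\{\mathsf{sk}_{i,\alpha}\}$. - $\mathsf{KeyGen}(\mathsf{MSK})$: draw $x\leftarrow\{0,1\}^n$; output $(x,\{\mathsf{sk}_{i,x[i]}\}_{i})$. - $\mathcal{E}nc(\mathsf{PK},m)$: compute $(\mathsf{vk}_{i,\alpha},\mathit{ct}_{i,\alpha})\leftarrow\Sigma.\mathcal{E}nc(\mathsf{pk}_{i,\alpha},m[i])$ for all $i,\alpha$; output $(\{\mathsf{vk}_{i,\alpha}\},\{\mathit{ct}_{i,\alpha}\})$. - $\mathcal{D}ec((x,\{\mathsf{sk}_i\}),\{\mathit{ct}_{i,\alpha}\})$: decrypt $\mathit{ct}_{i,x[i]}$ with $\mathsf{sk}_i$ for all $i$; output the resulting string ($\bot$ if some decryption fails). - $\mathcal{F}ake(\mathsf{PK})$: draw $x^*\leftarrow\{0,1\}^n$; for all $i$ encrypt $0$ under $\mathsf{pk}_{i,x^*[i]}$ and $1$ under $\mathsf{pk}_{i,x^*[i]\oplus1}$; output all verification keys, all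 ciphertexts, and $\mathsf{aux}=x^*$. - $\mathsf{Reveal}(\mathsf{PK},\mathsf{MSK},x^*,m)$: output $(x^*\oplus m,\{\mathsf{sk}_{i,x^*[i]\oplus m[i]}\}_{i})$. - $\mathcal{D}el$ applies $\Sigma.\mathcal{D}el$ to every $\mathit{ct}_{i,\alpha}$; $\mathsf{Vrfy}$ accepts iff $\Sigma.\mathsf{Vrfy}(\mathsf{vk}_{i,\alpha},\mathsf{cert}_{i,\alpha})=\top$ for all $i,\alpha$. **Theorem.** If $\Sigma$ is certified everlasting IND-CPA secure, then the constructed scheme is *certified everlasting RNC secure*: for every QPT $\mathcal A_1$ and every unbounded $\mathcal A_2$ the function $|\Pr[\mathrm{Exp}'(\lambda,0)=1]-\Pr[\mathrm{Exp}'(\lambda,1)=1]|$ is negligible, where in $\mathrm{Exp}'(\lambda,b)$: the challenger runs $(\mathsf{PK},\mathsf{MSK})\leftarrow\mathsf{Setup}(1^\lambda)$ and sends $\mathsf{PK}$ to $\mathcal A_1$, who answers with $m\in\{0,1\}^n$; if $b=0$ the challenger computes $(\mathsf{vk},\mathit{ct})\leftarrow\mathcal{E}nc(\mathsf{PK},m)$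 and $\mathsf{sk}\leftarrow\mathsf{KeyGen}(\mathsf{MSK})$, and if $b=1$ it computes $(\mathsf{vk},\mathit{ct},\mathsf{aux})\leftarrow\mathcal{F}ake(\mathsf{PK})$ and $\mathsf{sk}\leftarrow\mathsf{Reveal}(\mathsf{PK},\mathsf{MSK},\mathsf{aux},m)$; it sends $(\mathit{ct},\mathsf{sk})$ to $\mathcal A_1$; $\mathcal A_1$ sends a certificate to the challenger and its internal state to $\mathcal A_2$; if $\mathsf{Vrfy}$ accepts the certificate under $\mathsf{vk}$, then $\mathcal A_2$ gets $\mathsf{MSK}$ and its output bit $b'$ is the outcome of the experiment; otherwise $\mathcal A_2$ gets $\bot$ and the outcome is $\bot$. -/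

import Mathlib

open scoped Matrix BigOperators

noncomputable section

/-! ## Registers

A quantum register is given by a finite set `I` of qubits; its computational basis is `I → Bool`,
and its (mixed) states are matrices indexed by `I → Bool`. The register without qubits is `Empty`;
its only normalised state is the matrix `1`. -/

/-- Bit strings of length `n`. -/
abbrev Bits (n : ℕ) : Type := Fin n → Bool

/-- Operators from the register `I` to the register `O`. -/
abbrev QOp (O I : Type) : Type := Matrix (O → Bool) (I → Bool) ℂ

/-- The Kronecker product of two operators, on the joint registers. -/
def kron2 {O₁ I₁ O₂ I₂ : Type} (A : QOp O₁ I₁) (B : QOp O₂ I₂) : QOp (O₁ ⊕ O₂) (I₁ ⊕ I₂) :=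
  Matrix.of fun u v =>
    A (fun i => u (Sum.inl i)) (fun i => v (Sum.inl i)) *
      B (fun i => u (Sum.inr i)) (fun i => v (Sum.inr i))

/-- The Kronecker product of a finite family of operators; qubit `i` of the `j`-th factor is
the qubit `(j, i)` of the joint register. -/
def kronPi {J O I : Type} [Fintype J] (A : J → QOp O I) : QOp (J × O) (J × I) :=
  Matrix.of fun u v => ∏ j, A j (fun i => u (j, i)) (fun i => v (j, i))

/-- The pure state `|ψ⟩⟨ψ|`. -/
def pureState {I : Type} (ψ : (I → Bool) → ℂ) : QOp I I :=
  Matrix.of fun u v => ψ u * star (ψ v)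

/-- The computational basis state `|s⟩⟨s|`. -/
def basisState {I : Type} [Fintype I] (s : I → Bool) : QOp I I :=
  Matrix.of fun u v => if u = s ∧ v = s then 1 else 0

theorem kron2_complete {O₁ I₁ O₂ I₂ : Type} [Fintype O₁] [DecidableEq O₁] [Fintype I₁]
    [DecidableEq I₁] [Fintype O₂] [DecidableEq O₂] [Fintype I₂] [DecidableEq I₂]
    (A : QOp O₁ I₁) (B : QOp O₂ I₂) :
    (kron2 A B)ᴴ * kron2 A B = kron2 (Aᴴ * A) (Bᴴ * B) := by
  ext u v
  simp only [Matrix.mul_apply, Matrix.conjTranspose_apply, kron2, Matrix.of_apply, star_mul']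
  rw [Finset.sum_mul_sum, ← Finset.sum_product', Finset.univ_product_univ]
  refine Fintype.sum_equiv (Equiv.sumArrowEquivProdArrow O₁ O₂ Bool) _ _ fun w => ?_
  simp only [Equiv.sumArrowEquivProdArrow, Equiv.coe_fn_mk, Function.comp_def]
  ring

theorem kron2_one {I₁ I₂ : Type} [Fintype I₁] [DecidableEq I₁] [Fintype I₂] [DecidableEq I₂] :
    kron2 (1 : QOp I₁ I₁) (1 : QOp I₂ I₂) = 1 := by
  ext u v
  simp only [kron2, Matrix.of_apply, Matrix.one_apply]
  by_cases h : u = v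
  · subst h; simp
  · rw [if_neg h]
    by_cases h₁ : (fun i => u (Sum.inl i)) = fun i => v (Sum.inl i)
    · by_cases h₂ : (fun i => u (Sum.inr i)) = fun i => v (Sum.inr i)
      · exact absurd (funext fun w => by
          cases w with
          | inl i => exact congrFun h₁ i
          | inr i => exact congrFun h₂ i) h
      · simp [h₂]
    · simp [h₁]

theorem kronPi_complete {J O I : Type} [Fintype J] [DecidableEq J] [Fintype O] [DecidableEq O]
    [Fintype I] [DecidableEq I] (A : J → QOp O I) :
    (kronPi A)ᴴ * kronPi A = kronPi fun j => (A j)ᴴ * A j := by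
  ext u v
  simp only [Matrix.mul_apply, Matrix.conjTranspose_apply, kronPi, Matrix.of_apply, star_prod]
  rw [Finset.prod_univ_sum]
  refine Finset.sum_equiv (Equiv.curry J O Bool) (by simp) fun w _ => ?_
  rw [← Finset.prod_mul_distrib]
  rfl

theorem kronPi_one {J I : Type} [Fintype J] [DecidableEq J] [Fintype I] [DecidableEq I] :
    kronPi (fun _ : J => (1 : QOp I I)) = 1 := by
  ext u v
  simp only [kronPi, Matrix.of_apply, Matrix.one_apply]
  by_cases h : u = v
  · subst h; simp
  · rw [if_neg h]
    have : ∃ j, (fun i => u (j, i)) ≠ fun i => v (j, i) := by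
      by_contra hc
      push Not at hc
      exact h (funext fun w => congrFun (hc w.1) w.2)
    obtain ⟨j, hj⟩ := this
    exact Finset.prod_eq_zero (Finset.mem_univ j) (if_neg hj)

theorem kronPi_sum {J O I : Type} [Fintype J] [DecidableEq J] {κ : J → Type}
    [∀ j, Fintype (κ j)] (A : ∀ j, κ j → QOp O I) :
    (∑ c : ∀ j, κ j, kronPi fun j => A j (c j)) = kronPi fun j => ∑ c, A j c := by
  ext u v
  simp only [kronPi, Matrix.of_apply, Matrix.sum_apply]
  rw [Finset.prod_univ_sum, Fintype.piFinset_univ]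

theorem kron2_sum_right {O₁ I₁ O₂ I₂ κ : Type} [Fintype κ] (A : QOp O₁ I₁)
    (B : κ → QOp O₂ I₂) : (∑ c, kron2 A (B c)) = kron2 A (∑ c, B c) := by
  ext u v
  simp only [kron2, Matrix.of_apply, Matrix.sum_apply, Finset.mul_sum]

theorem kron2_sum_left {O₁ I₁ O₂ I₂ κ : Type} [Fintype κ] (A : κ → QOp O₁ I₁)
    (B : QOp O₂ I₂) : (∑ c, kron2 (A c) B) = kron2 (∑ c, A c) B := by
  ext u v
  simp only [kron2, Matrix.of_apply, Matrix.sum_apply, Finset.sum_mul]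

/-! ## Quantum algorithms with classical and quantum inputs and outputs -/

/-- What a quantum algorithm does: on a classical input `x : X` and a quantum input register `I`
it yields a classical output in `Y` and a quantum output register `O`. It is a quantum
instrument in Kraus form: branch `c` applies `op x c` and reports the classical output `out x c`.
Without quantum registers (`I = O = Empty`) this is a randomised map from `X` to `Y`. -/
structure QAlg (X Y I O : Type) [Fintype I] [DecidableEq I] [Fintype O] [DecidableEq O] where
  κ : X → Type
  [fintypeκ : ∀ x, Fintype (κ x)]
  op : ∀ x, κ x → QOp O I
  out : ∀ x, κ x → Y
  complete : ∀ x, ∑ c, (op x c)ᴴ * op x c = 1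

attribute [instance] QAlg.fintypeκ

namespace QAlg

variable {X Y I O : Type} [Fintype I] [DecidableEq I] [Fintype O] [DecidableEq O]

open Classical in
/-- The unnormalised state of the output register on the event that the classical output is `y`,
for the classical input `x` and the state `ρ` of the input register. -/
def apply (A : QAlg X Y I O) (x : X) (y : Y) (ρ : QOp I I) : QOp O O :=
  ∑ c, if A.out x c = y then A.op x c * ρ * (A.op x c)ᴴ else 0

/-- The probability of the classical output `y`. -/
def prob (A : QAlg X Y I O) (x : X) (y : Y) (ρ : QOp I I) : ℝ :=
  (A.apply x y ρ).trace.re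

/-- Compute `f x`, without any quantum register. -/
def ret (f : X → Y) : QAlg X Y Empty Empty where
  κ _ := Unit
  op _ _ := 1
  out x _ := f x
  complete _ := by simp

/-- On input `x'` run `A` on `f x'`; when `A` outputs `y`, output `g x' y`. -/
def wrap {X' Y' : Type} (A : QAlg X Y I O) (f : X' → X) (g : X' → Y → Y') : QAlg X' Y' I O where
  κ x := A.κ (f x)
  op x c := A.op (f x) c
  out x c := g x (A.out (f x) c)
  complete x := A.complete (f x)

/-- On input `x` draw `s` uniformly at random from `S` and run `A` on `(x, s)`. -/
def sampled {S : Type} [Fintype S] [Nonempty S] (A : QAlg (X × S) Y I O) : QAlg X Y I O where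
  κ x := Σ s : S, A.κ (x, s)
  op x c := ((Real.sqrt (Fintype.card S))⁻¹ : ℂ) • A.op (x, c.1) c.2
  out x c := A.out (x, c.1) c.2
  complete x := by
    have hS : (Fintype.card S : ℂ) ≠ 0 := by exact_mod_cast Fintype.card_ne_zero
    have hsq : ((Real.sqrt (Fintype.card S) : ℂ))⁻¹ * ((Real.sqrt (Fintype.card S) : ℂ))⁻¹ =
        (Fintype.card S : ℂ)⁻¹ := by
      rw [← mul_inv, ← Complex.ofReal_mul, Real.mul_self_sqrt (Nat.cast_nonneg _)]
      simp
    rw [Fintype.sum_sigma]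
    have h : ∀ s : S, ∑ c : A.κ (x, s),
        (((Real.sqrt (Fintype.card S))⁻¹ : ℂ) • A.op (x, s) c)ᴴ *
          (((Real.sqrt (Fintype.card S))⁻¹ : ℂ) • A.op (x, s) c) =
        (Fintype.card S : ℂ)⁻¹ • (1 : QOp I I) := by
      intro s
      rw [← A.complete (x, s), Finset.smul_sum]
      refine Finset.sum_congr rfl fun c _ => ?_
      rw [Matrix.conjTranspose_smul, Matrix.smul_mul, Matrix.mul_smul, smul_smul]
      congr 1
      rw [← hsq]
      simp
    simp only [h, Finset.sum_const, Finset.card_univ]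
    rw [← Nat.cast_smul_eq_nsmul ℂ, smul_smul, mul_inv_cancel₀ hS, one_smul]

/-- Run independent copies of `A`, one for each `j : J`, on separate inputs and registers. -/
def parallel (J : Type) [Fintype J] [DecidableEq J] (A : QAlg X Y I O) :
    QAlg (J → X) (J → Y) (J × I) (J × O) where
  κ x := ∀ j, A.κ (x j)
  op x c := kronPi fun j => A.op (x j) (c j)
  out x c j := A.out (x j) (c j)
  complete x := by
    simp only [kronPi_complete]
    rw [kronPi_sum (fun j (c : A.κ (x j)) => (A.op (x j) c)ᴴ * A.op (x j) c)]
    simp only [A.complete, kronPi_one]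

/-- Rename the qubits of the input and output registers. -/
def reindex {I' O' : Type} [Fintype I'] [DecidableEq I'] [Fintype O'] [DecidableEq O']
    (eI : I ≃ I') (eO : O ≃ O') (A : QAlg X Y I O) : QAlg X Y I' O' where
  κ := A.κ
  op x c := (A.op x c).submatrix (fun u => u ∘ eO) (fun v => v ∘ eI)
  out := A.out
  complete x := by
    have h : ∀ c, ((A.op x c).submatrix (fun u : O' → Bool => u ∘ eO)
          (fun v : I' → Bool => v ∘ eI))ᴴ *
        (A.op x c).submatrix (fun u : O' → Bool => u ∘ eO) (fun v : I' → Bool => v ∘ eI) =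
        ((A.op x c)ᴴ * A.op x c).submatrix (fun v : I' → Bool => v ∘ eI)
          (fun v : I' → Bool => v ∘ eI) := by
      intro c
      rw [Matrix.conjTranspose_submatrix]
      exact Matrix.submatrix_mul_equiv _ _ _ (Equiv.arrowCongr eO.symm (Equiv.refl Bool)) _
    simp only [h]
    ext u v
    have := congrFun (congrFun (A.complete x) (u ∘ eI)) (v ∘ eI)
    simp only [Matrix.sum_apply, Matrix.submatrix_apply, Matrix.one_apply] at this ⊢
    rw [this]
    congr 1
    simp only [eq_iff_iff]
    exact ⟨fun h => eI.surjective.injective_comp_right h, fun h => by rw [h]⟩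

/-- On input `some x` run the measurement `A` on `x`. On input `none` discard the register
(measure it and forget the result) and output `none`. -/
def orDiscard (A : QAlg X Y I Empty) : QAlg (Option X) (Option Y) I Empty where
  κ x := match x with
    | some x => A.κ x
    | none => I → Bool
  fintypeκ x := match x with
    | some x => inferInstanceAs (Fintype (A.κ x))
    | none => inferInstanceAs (Fintype (I → Bool))
  op x := match x with
    | some x => fun c => A.op x c
    | none => fun s => Matrix.of fun _ v => if v = s then 1 else 0
  out x := match x with
    | some x => fun c => some (A.out x c)
    | none => fun _ => none
  complete x := match x with
    | some x => A.complete x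
    | none => by
      ext u v
      rw [Matrix.sum_apply]
      simp only [Matrix.mul_apply, Matrix.conjTranspose_apply, Matrix.of_apply]
      simp [Matrix.one_apply]

/-- The end of a certified deletion experiment. The register `D` holds the certificate and the
register `S` the internal state of the first adversary. The challenger verifies the certificate
with the key `vk`. If the result is `⊤` (`true`), the second adversary `G` is run on `sk` and
`S`, and its bit is the outcome of the experiment; if the result is `⊥` (`false`), `G` is run on
`⊥` (`none`) and `S`, and the outcome is `⊥` (`none`). -/
def certify {VK SK D S : Type} [Fintype D] [DecidableEq D] [Fintype S] [DecidableEq S]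
    (V : QAlg VK Bool D Empty) (G : QAlg (Option SK) Bool S Empty) :
    QAlg (VK × SK) (Option Bool) (D ⊕ S) (Empty ⊕ Empty) where
  κ x := Σ c : V.κ x.1, G.κ (if V.out x.1 c then some x.2 else none)
  op x c := kron2 (V.op x.1 c.1) (G.op _ c.2)
  out x c := if V.out x.1 c.1 then some (G.out _ c.2) else none
  complete x := by
    simp only [kron2_complete]
    rw [Fintype.sum_sigma]
    simp only [kron2_sum_right, G.complete, kron2_sum_left, V.complete, kron2_one]

end QAlg

/-! ## Quantum circuits and quantum polynomial time -/

/-- Elementary gates: an arbitrary unitary on one qubit, or a controlled NOT. -/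
inductive Gate (W : Type) : Type
  | single (U : Matrix.unitaryGroup Bool ℂ) (w : W) : Gate W
  | cnot (control target : W) (h : control ≠ target) : Gate W

open Classical in
/-- The unitary of a gate on the register `W`. -/
def Gate.toOp {W : Type} : Gate W → QOp W W
  | .single U w => Matrix.of fun u v =>
      if ∀ w', w' ≠ w → u w' = v w' then (U : Matrix Bool Bool ℂ) (u w) (v w) else 0
  | .cnot a t _ => Matrix.of fun u v =>
      if u = Function.update v t (xor (v t) (v a)) then 1 else 0

/-- A quantum circuit on a finite set `W` of wires. The input register `I` is put on the wires
`inp`, all other wires start in `|0⟩`; then the gates are applied (the head of the list first);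
then the wires `out` are the output register `O`, and all other wires are traced out. -/
structure Circuit (I O : Type) where
  W : Type
  [fintypeW : Fintype W]
  [decEqW : DecidableEq W]
  inp : I ↪ W
  out : O ↪ W
  gates : List (Gate W)

attribute [instance] Circuit.fintypeW Circuit.decEqW

namespace Circuit

variable {I O : Type}

/-- The number of wires plus the number of gates. -/
def size (C : Circuit I O) : ℕ := Fintype.card C.W + C.gates.length

/-- The product of all gates. -/
def unitary (C : Circuit I O) : QOp C.W C.W :=
  C.gates.foldl (fun U g => g.toOp * U) 1

open Classical in
/-- The isometry that puts the input on the input wires and `|0⟩` on all others. -/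
def init (C : Circuit I O) : QOp C.W I :=
  Matrix.of fun w v => if (∀ i, w (C.inp i) = v i) ∧ ∀ x, x ∉ Set.range C.inp → w x = false
    then 1 else 0

open Classical in
/-- The quantum channel that the circuit computes. -/
def run [Fintype I] [DecidableEq I] (C : Circuit I O) (ρ : QOp I I) : QOp O O :=
  let σ := C.unitary * C.init * ρ * C.initᴴ * C.unitaryᴴ
  Matrix.of fun o o' => ∑ w, ∑ w',
    if (∀ i, w (C.out i) = o i) ∧ (∀ i, w' (C.out i) = o' i) ∧
      ∀ x, x ∉ Set.range C.out → w x = w' x then σ w w' else 0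

end Circuit

/-- An encoding of classical data as bit strings, with positions in the finite set `Lbl`. -/
class BitEnc (X : Type) where
  Lbl : Type
  [fintypeLbl : Fintype Lbl]
  [decEqLbl : DecidableEq Lbl]
  enc : X → Lbl → Bool
  enc_injective : Function.Injective enc

attribute [reducible] BitEnc.fintypeLbl BitEnc.decEqLbl
attribute [instance] BitEnc.fintypeLbl BitEnc.decEqLbl

instance : BitEnc Unit where
  Lbl := Empty
  enc _ := Empty.elim
  enc_injective _ _ _ := rfl

instance : BitEnc Bool where
  Lbl := Unit
  enc b _ := b
  enc_injective _ _ h := congrFun h ()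

instance {X Y : Type} [BitEnc X] [BitEnc Y] : BitEnc (X × Y) where
  Lbl := BitEnc.Lbl X ⊕ BitEnc.Lbl Y
  enc p := Sum.elim (BitEnc.enc p.1) (BitEnc.enc p.2)
  enc_injective _ _ h := Prod.ext
    (BitEnc.enc_injective (funext fun i => congrFun h (Sum.inl i)))
    (BitEnc.enc_injective (funext fun i => congrFun h (Sum.inr i)))

instance {J X : Type} [Fintype J] [DecidableEq J] [BitEnc X] : BitEnc (J → X) where
  Lbl := J × BitEnc.Lbl X
  enc f p := BitEnc.enc (f p.1) p.2
  enc_injective _ _ h := funext fun j =>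
    BitEnc.enc_injective (funext fun i => congrFun h (j, i))

instance {X : Type} [BitEnc X] : BitEnc (Option X) where
  Lbl := Option (BitEnc.Lbl X)
  enc x := match x with
    | none => fun _ => false
    | some x => fun i => match i with
      | none => true
      | some i => BitEnc.enc x i
  enc_injective x y h := by
    cases x with
    | none => cases y with
      | none => rfl
      | some y => exact absurd (congrFun h none) (by simp)
    | some x => cases y with
      | none => exact absurd (congrFun h none) (by simp)
      | some y => exact congrArg some (BitEnc.enc_injective (funext fun i => congrFun h (some i)))

/-- The circuit `C` computes the algorithm `A`: its input is the classical input of `A`, encoded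
in bits as a computational basis state, next to the quantum input of `A`; measuring the classical
part of its output in the computational basis gives the encoded classical output of `A`, next to
the quantum output of `A`. -/
def Circuit.Computes {X Y I O : Type} [BitEnc X] [BitEnc Y] [Fintype I] [DecidableEq I]
    [Fintype O] [DecidableEq O]
    (C : Circuit (BitEnc.Lbl X ⊕ I) (BitEnc.Lbl Y ⊕ O)) (A : QAlg X Y I O) : Prop :=
  ∀ (x : X) (y : Y) (ρ : QOp I I), A.apply x y ρ = Matrix.of fun o o' =>
    C.run (kron2 (basisState (BitEnc.enc x)) ρ)
      (Sum.elim (BitEnc.enc y) o) (Sum.elim (BitEnc.enc y) o')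

/-- Quantum polynomial time: a family of algorithms, indexed by the security parameter, that is
computed by quantum circuits of polynomial size. -/
def IsQPT {X Y I O : ℕ → Type} [∀ k, BitEnc (X k)] [∀ k, BitEnc (Y k)]
    [∀ k, Fintype (I k)] [∀ k, DecidableEq (I k)] [∀ k, Fintype (O k)] [∀ k, DecidableEq (O k)]
    (A : ∀ k, QAlg (X k) (Y k) (I k) (O k)) : Prop :=
  ∃ p : Polynomial ℕ, ∀ k, ∃ C : Circuit (BitEnc.Lbl (X k) ⊕ I k) (BitEnc.Lbl (Y k) ⊕ O k),
    C.size ≤ p.eval k ∧ C.Computes (A k)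

/-- Negligible functions of the security parameter. -/
def Negligible (f : ℕ → ℝ) : Prop :=
  ∀ c : ℕ, ∃ k₀ : ℕ, ∀ k > k₀, f k < ((k : ℝ) ^ c)⁻¹

/-! ## Public key encryption with certified everlasting deletion -/

/-- Public key encryption with certified everlasting deletion (syntax), with plaintext space
`{0,1}^n`. Certificates are registers of qubits and verification is a measurement; classical
certificates are the case in which verification first measures in the computational basis. -/
structure PKE (n : ℕ → ℕ) where
  /-- number of qubits of ciphertexts -/
  ctLen : ℕ → ℕ
  /-- length of public keys -/
  pkLen : ℕ → ℕ
  /-- length of secret keys -/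
  skLen : ℕ → ℕ
  /-- length of verification keys -/
  vkLen : ℕ → ℕ
  /-- number of qubits of certificates -/
  certLen : ℕ → ℕ
  keyGen : ∀ k, QAlg Unit (Bits (pkLen k) × Bits (skLen k)) Empty Empty
  enc : ∀ k, QAlg (Bits (pkLen k) × Bits (n k)) (Bits (vkLen k)) Empty (Fin (ctLen k))
  dec : ∀ k, QAlg (Bits (skLen k)) (Option (Bits (n k))) (Fin (ctLen k)) Empty
  del : ∀ k, QAlg Unit Unit (Fin (ctLen k)) (Fin (certLen k))
  vrfy : ∀ k, QAlg (Bits (vkLen k)) Bool (Fin (certLen k)) Empty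

namespace PKE

variable {n : ℕ → ℕ}

/-- All algorithms of the scheme run in quantum polynomial time. -/
def IsQPT (P : PKE n) : Prop :=
  _root_.IsQPT P.keyGen ∧ _root_.IsQPT P.enc ∧ _root_.IsQPT P.dec ∧ _root_.IsQPT P.del ∧
    _root_.IsQPT P.vrfy

/-- An adversary `(𝒜₁, 𝒜₂)` in the certified everlasting IND-CPA experiment. The first one,
`𝒜₁`, starts with an advice state and acts in two stages: it gets the public key and submits two
plaintexts, keeping the register `St`; then it gets the ciphertext and outputs a certificate and
an internal state `St'`. The second one, `𝒜₂` (`guess`), gets that state together with the secret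
key or `⊥`, and outputs a bit. -/
structure Adversary (P : PKE n) where
  Advice : ℕ → Type
  St : ℕ → Type
  St' : ℕ → Type
  [fintypeAdvice : ∀ k, Fintype (Advice k)]
  [decEqAdvice : ∀ k, DecidableEq (Advice k)]
  [fintypeSt : ∀ k, Fintype (St k)]
  [decEqSt : ∀ k, DecidableEq (St k)]
  [fintypeSt' : ∀ k, Fintype (St' k)]
  [decEqSt' : ∀ k, DecidableEq (St' k)]
  advice : ∀ k, (Advice k → Bool) → ℂ
  advice_norm : ∀ k, ∑ v, ‖advice k v‖ ^ 2 = 1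
  choose : ∀ k, QAlg (Bits (P.pkLen k)) (Bits (n k) × Bits (n k)) (Advice k) (St k)
  delete : ∀ k, QAlg Unit Unit (St k ⊕ Fin (P.ctLen k)) (Fin (P.certLen k) ⊕ St' k)
  guess : ∀ k, QAlg (Option (Bits (P.skLen k))) Bool (St' k) Empty

attribute [instance] Adversary.fintypeAdvice Adversary.decEqAdvice Adversary.fintypeSt
  Adversary.decEqSt Adversary.fintypeSt' Adversary.decEqSt'

/-- `𝒜₁` is a (non-uniform) QPT algorithm; there is no bound on `𝒜₂`. -/
def Adversary.IsQPT {P : PKE n} (A : P.Adversary) : Prop :=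
  _root_.IsQPT A.choose ∧ _root_.IsQPT A.delete

/-- The probability of the outcome `o` (`none` stands for `⊥`) in the certified everlasting
IND-CPA experiment with challenge bit `b`. The sum is over all classical values that occur. -/
def certEverExp (P : PKE n) (A : P.Adversary) (k : ℕ) (b : Bool) (o : Option Bool) : ℝ :=
  ∑ pk, ∑ sk, ∑ m₀, ∑ m₁, ∑ vk,
    (P.keyGen k).prob () (pk, sk) 1 *
      ((P.vrfy k).certify (A.guess k)).prob (vk, sk) o
        ((A.delete k).apply () ()
          (kron2 ((A.choose k).apply pk (m₀, m₁) (pureState (A.advice k)))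
            ((P.enc k).apply (pk, if b then m₁ else m₀) vk 1)))

/-- Certified everlasting IND-CPA security. -/
def CertEverINDCPA (P : PKE n) : Prop :=
  ∀ A : P.Adversary, A.IsQPT →
    Negligible fun k =>
      |P.certEverExp A k false (some true) - P.certEverExp A k true (some true)|

end PKE

/-! ## Receiver non-committing encryption with certified everlasting deletion -/

/-- Receiver non-committing encryption with certified everlasting deletion (syntax), with
plaintext space `{0,1}^n`. -/
structure RNCE (n : ℕ → ℕ) where
  PK : ℕ → Type
  MSK : ℕ → Type
  SK : ℕ → Type
  VK : ℕ → Type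
  AUX : ℕ → Type
  /-- qubits of ciphertexts -/
  CT : ℕ → Type
  /-- qubits of certificates -/
  Cert : ℕ → Type
  [fintypePK : ∀ k, Fintype (PK k)]
  [fintypeMSK : ∀ k, Fintype (MSK k)]
  [fintypeSK : ∀ k, Fintype (SK k)]
  [fintypeVK : ∀ k, Fintype (VK k)]
  [fintypeAUX : ∀ k, Fintype (AUX k)]
  [bitEncPK : ∀ k, BitEnc (PK k)]
  [bitEncMSK : ∀ k, BitEnc (MSK k)]
  [bitEncSK : ∀ k, BitEnc (SK k)]
  [bitEncVK : ∀ k, BitEnc (VK k)]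
  [bitEncAUX : ∀ k, BitEnc (AUX k)]
  [fintypeCT : ∀ k, Fintype (CT k)]
  [decEqCT : ∀ k, DecidableEq (CT k)]
  [fintypeCert : ∀ k, Fintype (Cert k)]
  [decEqCert : ∀ k, DecidableEq (Cert k)]
  setup : ∀ k, QAlg Unit (PK k × MSK k) Empty Empty
  keyGen : ∀ k, QAlg (MSK k) (SK k) Empty Empty
  enc : ∀ k, QAlg (PK k × Bits (n k)) (VK k) Empty (CT k)
  dec : ∀ k, QAlg (SK k) (Option (Bits (n k))) (CT k) Empty
  fake : ∀ k, QAlg (PK k) (VK k × AUX k) Empty (CT k)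
  reveal : ∀ k, QAlg (PK k × MSK k × AUX k × Bits (n k)) (SK k) Empty Empty
  del : ∀ k, QAlg Unit Unit (CT k) (Cert k)
  vrfy : ∀ k, QAlg (VK k) Bool (Cert k) Empty

attribute [instance] RNCE.fintypePK RNCE.fintypeMSK RNCE.fintypeSK RNCE.fintypeVK
  RNCE.fintypeAUX RNCE.bitEncPK RNCE.bitEncMSK RNCE.bitEncSK RNCE.bitEncVK RNCE.bitEncAUX
  RNCE.fintypeCT RNCE.decEqCT RNCE.fintypeCert RNCE.decEqCert

namespace RNCE

variable {n : ℕ → ℕ}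

/-- An adversary `(𝒜₁, 𝒜₂)` in the certified everlasting RNC experiment. The first one, `𝒜₁`,
starts with an advice state and acts in two stages: it gets the public key and submits a
plaintext, keeping the register `St`; then it gets the ciphertext and a secret key, and outputs a
certificate and an internal state `St'`. The second one, `𝒜₂` (`guess`), gets that state together
with the master secret key or `⊥`, and outputs a bit. -/
structure Adversary (R : RNCE n) where
  Advice : ℕ → Type
  St : ℕ → Type
  St' : ℕ → Type
  [fintypeAdvice : ∀ k, Fintype (Advice k)]
  [decEqAdvice : ∀ k, DecidableEq (Advice k)]
  [fintypeSt : ∀ k, Fintype (St k)]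
  [decEqSt : ∀ k, DecidableEq (St k)]
  [fintypeSt' : ∀ k, Fintype (St' k)]
  [decEqSt' : ∀ k, DecidableEq (St' k)]
  advice : ∀ k, (Advice k → Bool) → ℂ
  advice_norm : ∀ k, ∑ v, ‖advice k v‖ ^ 2 = 1
  choose : ∀ k, QAlg (R.PK k) (Bits (n k)) (Advice k) (St k)
  delete : ∀ k, QAlg (R.SK k) Unit (St k ⊕ R.CT k) (R.Cert k ⊕ St' k)
  guess : ∀ k, QAlg (Option (R.MSK k)) Bool (St' k) Empty

attribute [instance] Adversary.fintypeAdvice Adversary.decEqAdvice Adversary.fintypeSt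
  Adversary.decEqSt Adversary.fintypeSt' Adversary.decEqSt'

/-- `𝒜₁` is a (non-uniform) QPT algorithm; there is no bound on `𝒜₂`. -/
def Adversary.IsQPT {R : RNCE n} (A : R.Adversary) : Prop :=
  _root_.IsQPT A.choose ∧ _root_.IsQPT A.delete

/-- The challenger's answer to the plaintext `m`: the unnormalised ciphertext state on the event
that the verification key is `vk` and the secret key sent along is `sk`. For `b = 0` these are
honest, for `b = 1` they come from the fake encryption and the reveal algorithm. -/
def challenge (R : RNCE n) (k : ℕ) (b : Bool) (pk : R.PK k) (msk : R.MSK k) (m : Bits (n k))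
    (vk : R.VK k) (sk : R.SK k) : QOp (R.CT k) (R.CT k) :=
  match b with
  | false => ((R.keyGen k).prob msk sk 1 : ℂ) • (R.enc k).apply (pk, m) vk 1
  | true => ∑ aux, ((R.reveal k).prob (pk, msk, aux, m) sk 1 : ℂ) • (R.fake k).apply pk (vk, aux) 1

/-- The probability of the outcome `o` (`none` stands for `⊥`) in the certified everlasting RNC
experiment with challenge bit `b`. The sum is over all classical values that occur. -/
def certEverExp (R : RNCE n) (A : R.Adversary) (k : ℕ) (b : Bool) (o : Option Bool) : ℝ :=
  ∑ pk, ∑ msk, ∑ m, ∑ vk, ∑ sk,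
    (R.setup k).prob () (pk, msk) 1 *
      ((R.vrfy k).certify (A.guess k)).prob (vk, msk) o
        ((A.delete k).apply sk ()
          (kron2 ((A.choose k).apply pk m (pureState (A.advice k)))
            (R.challenge k b pk msk m vk sk)))

/-- Certified everlasting RNC security. -/
def CertEverRNC (R : RNCE n) : Prop :=
  ∀ A : R.Adversary, A.IsQPT →
    Negligible fun k =>
      |R.certEverExp A k false (some true) - R.certEverExp A k true (some true)|

end RNCE

/-! ## The construction -/

namespace PKE

/-- The receiver non-committing encryption scheme for plaintexts of `n` bits that is built from
`2 n` instances of a scheme for single bits; the instances are indexed by `(i, α)`. -/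
def toRNCE (P : PKE fun _ => 1) (n : ℕ → ℕ) : RNCE n where
  PK k := Fin (n k) × Bool → Bits (P.pkLen k)
  MSK k := Fin (n k) × Bool → Bits (P.skLen k)
  SK k := Bits (n k) × (Fin (n k) → Bits (P.skLen k))
  VK k := Fin (n k) × Bool → Bits (P.vkLen k)
  AUX k := Bits (n k)
  CT k := (Fin (n k) × Bool) × Fin (P.ctLen k)
  Cert k := (Fin (n k) × Bool) × Fin (P.certLen k)
  -- generate all key pairs
  setup k := (((P.keyGen k).parallel (Fin (n k) × Bool)).reindex
      (Equiv.equivOfIsEmpty _ _) (Equiv.equivOfIsEmpty _ _)).wrap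
    (fun _ _ => ()) (fun _ y => (fun j => (y j).1, fun j => (y j).2))
  -- draw `x` and output `x` with the secret keys `(i, x[i])`
  keyGen k := QAlg.sampled (S := Bits (n k)) (QAlg.ret fun p => (p.2, fun i => p.1 (i, p.2 i)))
  -- encrypt `m[i]` under both keys `(i, 0)` and `(i, 1)`
  enc k := (((P.enc k).parallel (Fin (n k) × Bool)).reindex
      (Equiv.equivOfIsEmpty _ _) (Equiv.refl _)).wrap
    (fun p j => (p.1 j, fun _ => p.2 j.1)) (fun _ vk => vk)
  -- decrypt the ciphertexts `(i, x[i])`, and discard the others; a failure gives `⊥`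
  dec k := (((P.dec k).orDiscard.parallel (Fin (n k) × Bool)).reindex
      (Equiv.refl _) (Equiv.equivOfIsEmpty _ _)).wrap
    (fun sk j => if j.2 = sk.1 j.1 then some (sk.2 j.1) else none)
    (fun sk y =>
      if h : ∀ i, ((y (i, sk.1 i)).join).isSome then some fun i => ((y (i, sk.1 i)).join).get (h i) 0
      else none)
  -- draw `x*`, encrypt `0` under the keys `(i, x*[i])` and `1` under the keys `(i, x*[i] ⊕ 1)`
  fake k := QAlg.sampled (S := Bits (n k))
    ((((P.enc k).parallel (Fin (n k) × Bool)).reindex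
        (Equiv.equivOfIsEmpty _ _) (Equiv.refl _)).wrap
      (fun p j => (p.1 j, fun _ => xor j.2 (p.2 j.1))) (fun p vk => (vk, p.2)))
  -- output `x* ⊕ m` with the secret keys `(i, x*[i] ⊕ m[i])`
  reveal _ := QAlg.ret fun p =>
    (fun i => xor (p.2.2.1 i) (p.2.2.2 i), fun i => p.2.1 (i, xor (p.2.2.1 i) (p.2.2.2 i)))
  del k := ((P.del k).parallel (Fin (n k) × Bool)).wrap (fun _ _ => ()) (fun _ _ => ())
  -- accept if all certificates are accepted
  vrfy k := (((P.vrfy k).parallel (Fin (n k) × Bool)).reindex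
      (Equiv.refl _) (Equiv.equivOfIsEmpty _ _)).wrap
    (fun vk => vk) (fun _ y => decide (∀ j, y j = true))

end PKE

end

/-! Fix the string `x` that goes into the secret key. In the fake experiment substitute `x = x* ⊕
m`. Since `m` is submitted before `x*` is drawn, `x` is again uniform, and now slot `(i, x[i])`
holds an encryption of `m[i]` while slot `(i, ¬x[i])` holds one of `¬m[i]`. In the real experiment
both hold `m[i]`. So for each `x` the two experiments differ only in the `n` slots `(i, ¬x[i])`,
whose secret keys the first adversary never sees (`sum_slotChallenge`). The hybrids `hybridMask x j`
flip these slots one at a time, and neighbouring hybrids differ in a single slot `s₀`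
(`hybridMask_insertAt`).

An IND-CPA adversary puts its challenge into `s₀` and submits the plaintexts `m[j]` and `¬m[j]`. It
hands the certificate of `s₀` to its challenger. Its second part is unbounded, so it may check all
other certificates itself, complete the master secret key with the key it receives, and answer `0`
if one of the other certificates fails. The event "everything is accepted and the output is `1`" is
then the same in both games, so the probabilities agree exactly (`prob_reduction`,
`exists_localAdversary`).

The first part of the reduction generates no keys or ciphertexts; it exploits non-uniformity. The
key pairs of the other slots are independent of the adversary and can be fixed. The plaintext bit of
a slot is unknown until `m` is chosen, so encryptions of both candidates are drawn beforehand; the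
one not used sums out (`sum_pi_select`). Each branch of an encryption is a pure state with a known
verification key (`QAlg.exists_ensemble`). Hence a hybrid is a convex combination of experiments in
which everything outside `s₀` is fixed (`hybridProb_insertAt`). Fixed keys are hardwired, and the
pure states are the advice. It remains to run the given circuits, to copy out one bit of `m`, and to
select ciphertexts by controlled swaps. Because polynomial time means polynomially many one-qubit
and CNOT gates, this is carried out on circuits (`Circuit.exists_hardwired_circuit`,
`Circuit.exists_select_circuit`).

The reduction depends on `x`, on `j` and on all fixed choices, while the hypothesis speaks of one
adversary at a time. Picking for each security parameter a violating adversary, if there is one,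
gives a single non-uniform family; so the bound holds uniformly over all adversaries of a given
polynomial size (`PKE.CertEverINDCPA.uniform`), and the `n` steps may be added up. -/

noncomputable section

/-! ## Operators given by functions on basis states -/

open Classical in
/-- The operator that maps the basis state `v` to the basis state `f v`. -/
def funOp {O I : Type} (f : (I → Bool) → (O → Bool)) : QOp O I :=
  Matrix.of fun u v => if u = f v then 1 else 0

section funOp

variable {O I K : Type}

theorem funOp_apply (f : (I → Bool) → (O → Bool)) (u : O → Bool) (v : I → Bool)
    [Decidable (u = f v)] : funOp f u v = if u = f v then 1 else 0 := by
  rw [funOp, Matrix.of_apply]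
  congr

theorem mul_funOp [Fintype K] [DecidableEq K] (M : QOp O K) (f : (I → Bool) → (K → Bool)) :
    M * funOp f = Matrix.of fun u v => M u (f v) := by
  classical
  ext u v
  simp [Matrix.mul_apply, funOp_apply]

theorem funOp_mul [Fintype K] [DecidableEq K] (f : (K → Bool) → (O → Bool))
    (g : (I → Bool) → (K → Bool)) : funOp f * funOp g = funOp (f ∘ g) := by
  classical
  rw [mul_funOp]
  ext u v
  simp [funOp_apply]

theorem funOp_id [DecidableEq (I → Bool)] : funOp (id : (I → Bool) → (I → Bool)) = 1 := by
  ext u v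
  simp [funOp_apply, Matrix.one_apply]

theorem funOp_isometry [Fintype O] [DecidableEq O] [DecidableEq (I → Bool)]
    {f : (I → Bool) → (O → Bool)}
    (hf : Function.Injective f) : (funOp f)ᴴ * funOp f = 1 := by
  classical
  ext u v
  simp [mul_funOp, funOp_apply, Matrix.one_apply, Matrix.conjTranspose_apply, hf.eq_iff,
    eq_comm]

end funOp

/-! ## Unitaries of lists of gates -/

section gates

variable {W : Type}

theorem single_toOp_apply (U : Matrix.unitaryGroup Bool ℂ) (w : W) (u v : W → Bool)
    [Decidable (∀ w', w' ≠ w → u w' = v w')] :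
    (Gate.single U w).toOp u v =
      if ∀ w', w' ≠ w → u w' = v w' then (U : Matrix Bool Bool ℂ) (u w) (v w) else 0 := by
  simp only [Gate.toOp, Matrix.of_apply]
  congr

variable [DecidableEq W]

theorem cnot_toOp (a t : W) (h : a ≠ t) :
    (Gate.cnot a t h).toOp = funOp fun v => Function.update v t (xor (v t) (v a)) := by
  ext u v
  simp only [Gate.toOp, funOp, Matrix.of_apply]
  congr
  exact Subsingleton.elim _ _

theorem cnot_involutive (a t : W) (h : a ≠ t) :
    Function.Involutive fun v : W → Bool => Function.update v t (xor (v t) (v a)) := by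
  intro v
  ext x
  by_cases hx : x = t
  · subst hx; simp [h]
  · simp [hx]

variable [Fintype W]

/-- The product of the gates of a list, the head of the list acting first. -/
def gatesOp (l : List (Gate W)) : QOp W W :=
  l.foldl (fun U g => g.toOp * U) 1

theorem gatesOp_nil : gatesOp ([] : List (Gate W)) = 1 := rfl

theorem foldl_toOp (l : List (Gate W)) (U : QOp W W) :
    l.foldl (fun U g => g.toOp * U) U = gatesOp l * U := by
  induction l using List.reverseRecOn with
  | nil => simp [gatesOp]
  | append_singleton l g ih => simp [gatesOp, List.foldl_append, ih, Matrix.mul_assoc]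

theorem gatesOp_append (l l' : List (Gate W)) : gatesOp (l ++ l') = gatesOp l' * gatesOp l := by
  rw [← foldl_toOp l' (gatesOp l)]
  simp [gatesOp, List.foldl_append]

theorem gatesOp_singleton (g : Gate W) : gatesOp [g] = g.toOp := by
  simp [gatesOp]

theorem gatesOp_cons (g : Gate W) (l : List (Gate W)) : gatesOp (g :: l) = gatesOp l * g.toOp := by
  rw [← gatesOp_singleton g, ← gatesOp_append, List.singleton_append]

theorem sum_agree_off {M : Type} [AddCommMonoid M] (w : W) (v : W → Bool) (F : (W → Bool) → M) :
    (∑ u : W → Bool, if ∀ w', w' ≠ w → u w' = v w' then F u else 0) =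
      ∑ b : Bool, F (Function.update v w b) := by
  classical
  rw [← Finset.sum_filter]
  refine Finset.sum_bij' (fun u _ => u w) (fun b _ => Function.update v w b) (by simp)
    (fun b _ => ?_) (fun u hu => ?_) (by simp) (fun u hu => ?_)
  · simp only [Finset.mem_filter, Finset.mem_univ, true_and]
    intro w' hw'
    simp [hw']
  all_goals
    have : Function.update v w (u w) = u := by
      ext x
      by_cases hx : x = w
      · subst hx; simp
      · simp only [Finset.mem_filter, Finset.mem_univ, true_and] at hu
        simp [hx, hu x hx]
    simp [this]

theorem Gate.toOp_isometry (g : Gate W) : (g.toOp)ᴴ * g.toOp = 1 := by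
  classical
  cases g with
  | cnot a t h =>
    rw [cnot_toOp]
    exact funOp_isometry (cnot_involutive a t h).injective
  | single U w =>
    ext v v'
    have hU : (U : Matrix Bool Bool ℂ)ᴴ * (U : Matrix Bool Bool ℂ) = 1 :=
      Matrix.UnitaryGroup.star_mul_self U
    have hU' := congrFun (congrFun hU (v w)) (v' w)
    rw [Matrix.mul_apply] at hU' ⊢
    simp only [Matrix.conjTranspose_apply, single_toOp_apply, apply_ite star, star_zero, ite_mul,
      zero_mul] at hU' ⊢
    -- Only basis states that agree with `v` off the wire `w` contribute, so the entry reduces to an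
    -- entry of `Uᴴ * U`.
    rw [sum_agree_off w v]
    simp only [Function.update_self]
    by_cases hv : ∀ w', w' ≠ w → v w' = v' w'
    · have h1 : ∀ b, ∀ w', w' ≠ w → Function.update v w b w' = v' w' := by
        intro b w' hw'
        simp [hw', hv w' hw']
      simp only [if_pos (h1 _)]
      rw [hU', Matrix.one_apply, Matrix.one_apply]
      congr 1
      refine propext ⟨fun h => ?_, fun h => by rw [h]⟩
      ext x
      by_cases hx : x = w
      · rw [hx, h]
      · exact hv x hx
    · have h1 : ∀ b, ¬ ∀ w', w' ≠ w → Function.update v w b w' = v' w' := by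
        intro b hb
        refine hv fun w' hw' => ?_
        have := hb w' hw'
        simpa [hw'] using this
      simp only [if_neg (h1 _)]
      rw [Matrix.one_apply, if_neg]
      · simp
      · rintro rfl
        exact hv fun _ _ => rfl

theorem gatesOp_isometry (l : List (Gate W)) : (gatesOp l)ᴴ * gatesOp l = 1 := by
  induction l with
  | nil => simp [gatesOp_nil]
  | cons g l ih =>
    rw [gatesOp_cons, Matrix.conjTranspose_mul, Matrix.mul_assoc, ← Matrix.mul_assoc _ (gatesOp l),
      ih, Matrix.one_mul, g.toOp_isometry]

end gates

/-! ## The action of a circuit in terms of amplitudes -/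

namespace Circuit

variable {I O : Type}

open Classical in
/-- The initial content of the wires for the input basis state `v`. -/
def pad (C : Circuit I O) (v : I → Bool) : C.W → Bool := fun x =>
  if h : ∃ i, C.inp i = x then v h.choose else false

theorem pad_inp (C : Circuit I O) (v : I → Bool) (i : I) : C.pad v (C.inp i) = v i := by
  have h : ∃ i', C.inp i' = C.inp i := ⟨i, rfl⟩
  rw [pad, dif_pos h, C.inp.injective h.choose_spec]

theorem pad_of_notMem (C : Circuit I O) (v : I → Bool) {x : C.W} (hx : x ∉ Set.range C.inp) :
    C.pad v x = false := by
  rw [pad, dif_neg]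
  exact hx

theorem pad_injective (C : Circuit I O) : Function.Injective C.pad := fun v v' h =>
  funext fun i => by rw [← C.pad_inp v, ← C.pad_inp v', h]

theorem eq_pad_iff (C : Circuit I O) (w : C.W → Bool) (v : I → Bool) :
    w = C.pad v ↔ (∀ i, w (C.inp i) = v i) ∧ ∀ x, x ∉ Set.range C.inp → w x = false := by
  constructor
  · rintro rfl
    exact ⟨C.pad_inp v, fun x hx => C.pad_of_notMem v hx⟩
  · rintro ⟨h₁, h₂⟩
    ext x
    by_cases hx : x ∈ Set.range C.inp
    · obtain ⟨i, rfl⟩ := hx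
      rw [h₁, pad_inp]
    · rw [h₂ x hx, pad_of_notMem C v hx]

theorem init_eq (C : Circuit I O) : C.init = funOp C.pad := by
  ext w v
  simp only [init, funOp, Matrix.of_apply]
  by_cases h : w = C.pad v
  · rw [if_pos h, if_pos ((eq_pad_iff C w v).1 h)]
  · rw [if_neg h, if_neg (fun h' => h ((eq_pad_iff C w v).2 h'))]

/-- The amplitude of the wire content `w` before tracing out, on the input basis state `v`. -/
def amp (C : Circuit I O) (w : C.W → Bool) (v : I → Bool) : ℂ := gatesOp C.gates w (C.pad v)

theorem unitary_mul_init (C : Circuit I O) : C.unitary * C.init = Matrix.of C.amp := by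
  rw [init_eq, mul_funOp]
  rfl

theorem amp_isometry [DecidableEq (I → Bool)] (C : Circuit I O) (v v' : I → Bool) :
    ∑ w, star (C.amp w v) * C.amp w v' = if v = v' then 1 else 0 := by
  have h : (C.unitary * C.init)ᴴ * (C.unitary * C.init) = 1 := by
    rw [Matrix.conjTranspose_mul, Matrix.mul_assoc, ← Matrix.mul_assoc _ C.unitary]
    rw [show C.unitaryᴴ * C.unitary = 1 from gatesOp_isometry C.gates, Matrix.one_mul, init_eq]
    exact funOp_isometry C.pad_injective
  rw [unitary_mul_init] at h
  have := congrFun (congrFun h v) v'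
  simpa [Matrix.mul_apply, Matrix.one_apply] using this

/-- The wire contents `w` and `w'` restrict to `o` and `o'` on the output wires, and they
agree on the wires that are traced out. -/
def Agree (C : Circuit I O) (w w' : C.W → Bool) (o o' : O → Bool) : Prop :=
  (∀ i, w (C.out i) = o i) ∧ (∀ i, w' (C.out i) = o' i) ∧
    ∀ x, x ∉ Set.range C.out → w x = w' x

open Classical in
/-- The matrix entry `(o, o')` of the image of `|v⟩⟨v'|` under the circuit. -/
def kernel (C : Circuit I O) (v v' : I → Bool) (o o' : O → Bool) : ℂ :=
  ∑ w, ∑ w', if C.Agree w w' o o' then C.amp w v * star (C.amp w' v') else 0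

/-- By linearity a channel is determined by the images of the matrix units `|v⟩⟨v'|`. All circuit
constructions below are compared through these kernels, so that density matrices enter only at the
end. -/
theorem run_apply [Fintype I] [DecidableEq I] (C : Circuit I O) (ρ : QOp I I) (o o' : O → Bool) :
    C.run ρ o o' = ∑ v, ∑ v', ρ v v' * C.kernel v v' o o' := by
  classical
  have h : C.unitary * C.init * ρ * C.initᴴ * C.unitaryᴴ =
      Matrix.of fun w w' => ∑ v, ∑ v', ρ v v' * (C.amp w v * star (C.amp w' v')) := by
    rw [Matrix.mul_assoc _ C.initᴴ, ← Matrix.conjTranspose_mul, unitary_mul_init]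
    ext w w'
    simp only [Matrix.mul_apply, Matrix.of_apply, Matrix.conjTranspose_apply, Finset.sum_mul]
    rw [Finset.sum_comm]
    refine Finset.sum_congr rfl fun v _ => Finset.sum_congr rfl fun v' _ => ?_
    ring
  simp only [run, h, Matrix.of_apply]
  simp only [kernel, Finset.mul_sum]
  have h2 : ∀ v, (∑ v', ∑ w, ∑ w', ρ v v' *
      (if C.Agree w w' o o' then C.amp w v * star (C.amp w' v') else 0)) =
      ∑ w, ∑ w', ∑ v', ρ v v' *
        (if C.Agree w w' o o' then C.amp w v * star (C.amp w' v') else 0) := by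
    intro v
    rw [Finset.sum_comm]
    refine Finset.sum_congr rfl fun w _ => ?_
    rw [Finset.sum_comm]
  refine Eq.trans ?_ (Finset.sum_congr rfl fun v _ => h2 v).symm
  conv_rhs => rw [Finset.sum_comm]
  refine Finset.sum_congr rfl fun w _ => ?_
  conv_rhs => rw [Finset.sum_comm]
  refine Finset.sum_congr rfl fun w' _ => ?_
  by_cases hA : C.Agree w w' o o'
  · refine (if_pos hA).trans ?_
    simp [hA]
  · refine (if_neg hA).trans ?_
    simp [hA]

/-- The wires of the output register and the wires that are traced out. -/
def outEquiv (C : Circuit I O) : O ⊕ ↥(Set.range C.out)ᶜ ≃ C.W := by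
  classical
  exact (Equiv.sumCongr (Equiv.ofInjective C.out C.out.injective) (Equiv.refl _)).trans
    (Equiv.Set.sumCompl _)

theorem outEquiv_inl (C : Circuit I O) (i : O) : C.outEquiv (Sum.inl i) = C.out i := by
  simp [outEquiv]

theorem outEquiv_inr (C : Circuit I O) (x : ↥(Set.range C.out)ᶜ) :
    C.outEquiv (Sum.inr x) = x := by
  simp [outEquiv]

/-- The wire content with output `o` and traced out part `t`. -/
def merge (C : Circuit I O) (o : O → Bool) (t : ↥(Set.range C.out)ᶜ → Bool) : C.W → Bool :=
  Sum.elim o t ∘ C.outEquiv.symm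

/-- Wire contents as pairs of an output and a traced out part. -/
def mergeEquiv (C : Circuit I O) : (O → Bool) × (↥(Set.range C.out)ᶜ → Bool) ≃ (C.W → Bool) :=
  (Equiv.sumArrowEquivProdArrow _ _ _).symm.trans (Equiv.arrowCongr C.outEquiv (Equiv.refl _))

theorem agree_merge (C : Circuit I O) (o₁ o₁' o o' : O → Bool)
    (t t' : ↥(Set.range C.out)ᶜ → Bool) :
    C.Agree (C.merge o₁ t) (C.merge o₁' t') o o' ↔ o₁ = o ∧ o₁' = o' ∧ t = t' := by
  have h1 : ∀ o t i, C.merge o t (C.out i) = o i := by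
    intro o t i
    simp [merge, ← outEquiv_inl]
  have h2 : ∀ o t, ∀ x : ↥(Set.range C.out)ᶜ, C.merge o t x = t x := by
    intro o t x
    simp [merge, ← outEquiv_inr]
  simp only [Agree, h1, funext_iff]
  refine and_congr_right fun _ => and_congr_right fun _ => ⟨fun h x => ?_, fun h x hx => ?_⟩
  · rw [← h2 o₁ t x, ← h2 o₁' t' x]
    exact h x x.2
  · have e1 := h2 o₁ t ⟨x, hx⟩
    have e2 := h2 o₁' t' ⟨x, hx⟩
    simp only at e1 e2
    rw [e1, e2]
    exact h ⟨x, hx⟩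

instance fintypeTraced (C : Circuit I O) : Fintype ↥(Set.range C.out)ᶜ := Fintype.ofFinite _

instance fintypeTracedBits (C : Circuit I O) : Fintype (↥(Set.range C.out)ᶜ → Bool) :=
  Fintype.ofFinite _

theorem sum_merge [Fintype O] [DecidableEq O] {M : Type} [AddCommMonoid M] (C : Circuit I O)
    (F : (C.W → Bool) → M) : ∑ w, F w = ∑ o, ∑ t, F (C.merge o t) := by
  rw [← Fintype.sum_prod_type', ← C.mergeEquiv.sum_comp]
  rfl

/-- This is the Kraus form of the partial trace: the content `t` of the traced out wires serves as
the Kraus index. -/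
theorem kernel_eq [Fintype O] [DecidableEq O] (C : Circuit I O) (v v' : I → Bool)
    (o o' : O → Bool) :
    C.kernel v v' o o' = ∑ t, C.amp (C.merge o t) v * star (C.amp (C.merge o' t) v') := by
  classical
  rw [kernel, sum_merge C]
  simp only [sum_merge C (M := ℂ), agree_merge]
  rw [Finset.sum_eq_single o _ (by simp)]
  · refine Finset.sum_congr rfl fun t _ => ?_
    rw [Finset.sum_eq_single o' _ (by simp), Finset.sum_eq_single t _ (by simp)]
    · simp
    · intro t' _ ht'
      rw [if_neg]
      rintro ⟨-, -, h⟩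
      exact ht' h.symm
    · intro o₁ _ ho₁
      refine Finset.sum_eq_zero fun t' _ => ?_
      rw [if_neg]
      rintro ⟨-, h, -⟩
      exact ho₁ h
  · intro o₁ _ ho₁
    refine Finset.sum_eq_zero fun t' _ => Finset.sum_eq_zero fun _ _ =>
      Finset.sum_eq_zero fun _ _ => ?_
    rw [if_neg]
    rintro ⟨h, -⟩
    exact ho₁ h

/-- The algorithm that a circuit computes, when all bit strings encode classical outputs. -/
def toQAlg {X Y I O : Type} [BitEnc X] [BitEnc Y] [Fintype Y] [Fintype I] [DecidableEq I]
    [Fintype O] [DecidableEq O] (C : Circuit (BitEnc.Lbl X ⊕ I) (BitEnc.Lbl Y ⊕ O))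
    (hY : Function.Surjective (BitEnc.enc : Y → _)) : QAlg X Y I O where
  κ _ := Y × (↥(Set.range C.out)ᶜ → Bool)
  op x c := Matrix.of fun o v =>
    C.amp (C.merge (Sum.elim (BitEnc.enc c.1) o) c.2) (Sum.elim (BitEnc.enc x) v)
  out _ c := c.1
  complete x := by
    ext v v'
    have h := C.amp_isometry (Sum.elim (BitEnc.enc x) v) (Sum.elim (BitEnc.enc x) v')
    -- Wire contents split into classical output, quantum output and traced out part. Surjectivity
    -- of the encoding turns the sum over the first component into a sum over `Y`, so that no
    -- probability is lost.
    rw [sum_merge C, ← (Equiv.sumArrowEquivProdArrow _ _ _).symm.sum_comp,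
      Fintype.sum_prod_type,
      ← (Equiv.ofBijective (BitEnc.enc : Y → _) ⟨BitEnc.enc_injective, hY⟩).sum_comp] at h
    simp only [Matrix.sum_apply, Matrix.mul_apply, Matrix.conjTranspose_apply, Matrix.of_apply]
    rw [Fintype.sum_prod_type]
    refine Eq.trans ?_ (h.trans ?_)
    · exact Finset.sum_congr rfl fun y _ => Finset.sum_comm
    · rw [Matrix.one_apply]
      congr 1
      refine propext ⟨fun h => ?_, fun h => by rw [h]⟩
      ext i
      exact congrFun h (Sum.inr i)

theorem basisState_apply {I : Type} [Fintype I] [DecidableEq (I → Bool)] (s u v : I → Bool) :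
    basisState s u v = if u = s ∧ v = s then 1 else 0 := by
  rw [basisState, Matrix.of_apply]
  congr

theorem run_basis {L I : Type} [Fintype L] [DecidableEq L] [Fintype I] [DecidableEq I]
    (C : Circuit (L ⊕ I) O) (s : L → Bool) (ρ : QOp I I) (o o' : O → Bool) :
    C.run (kron2 (basisState s) ρ) o o' =
      ∑ v, ∑ v', ρ v v' * C.kernel (Sum.elim s v) (Sum.elim s v') o o' := by
  classical
  rw [run_apply, ← (Equiv.sumArrowEquivProdArrow _ _ _).symm.sum_comp, Fintype.sum_prod_type]
  rw [Finset.sum_eq_single s _ (by simp)]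
  · refine Finset.sum_congr rfl fun v _ => ?_
    rw [← (Equiv.sumArrowEquivProdArrow _ _ _).symm.sum_comp, Fintype.sum_prod_type,
      Finset.sum_eq_single s _ (by simp)]
    · simp [kron2, basisState_apply, Equiv.sumArrowEquivProdArrow]
    · intro s' _ hs'
      refine Finset.sum_eq_zero fun v' _ => ?_
      simp [kron2, basisState_apply, hs']
  · intro s' _ hs'
    refine Finset.sum_eq_zero fun v' _ => Finset.sum_eq_zero fun _ _ => ?_
    simp [kron2, basisState_apply, hs']

open Classical in
theorem toQAlg_apply {X Y I O : Type} [BitEnc X] [BitEnc Y] [Fintype Y] [Fintype I]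
    [DecidableEq I] [Fintype O] [DecidableEq O]
    (C : Circuit (BitEnc.Lbl X ⊕ I) (BitEnc.Lbl Y ⊕ O))
    (hY : Function.Surjective (BitEnc.enc : Y → _)) (x : X) (y : Y) (ρ : QOp I I)
    (o o' : O → Bool) :
    (C.toQAlg hY).apply x y ρ o o' = C.run (kron2 (basisState (BitEnc.enc x)) ρ)
      (Sum.elim (BitEnc.enc y) o) (Sum.elim (BitEnc.enc y) o') := by
  let a (y' : Y) (t : ↥(Set.range C.out)ᶜ → Bool) : QOp O I := Matrix.of fun o v =>
    C.amp (C.merge (Sum.elim (BitEnc.enc y') o) t) (Sum.elim (BitEnc.enc x) v)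
  have h : (C.toQAlg hY).apply x y ρ =
      ∑ c : Y × (↥(Set.range C.out)ᶜ → Bool),
        if c.1 = y then a c.1 c.2 * ρ * (a c.1 c.2)ᴴ else 0 := rfl
  rw [h, run_basis, Fintype.sum_prod_type, Finset.sum_eq_single y _ (by simp)]
  · simp only [if_true, Matrix.sum_apply, kernel_eq, Matrix.mul_apply, Matrix.of_apply, a,
      Matrix.conjTranspose_apply, Finset.mul_sum, Finset.sum_mul]
    have e : ∀ v : I → Bool, ∑ v' : I → Bool, ∑ t, ρ v v' *
        (C.amp (C.merge (Sum.elim (BitEnc.enc y) o) t) (Sum.elim (BitEnc.enc x) v) *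
          star (C.amp (C.merge (Sum.elim (BitEnc.enc y) o') t) (Sum.elim (BitEnc.enc x) v'))) =
        ∑ t, ∑ v' : I → Bool, ρ v v' *
        (C.amp (C.merge (Sum.elim (BitEnc.enc y) o) t) (Sum.elim (BitEnc.enc x) v) *
          star (C.amp (C.merge (Sum.elim (BitEnc.enc y) o') t) (Sum.elim (BitEnc.enc x) v'))) :=
      fun v => Finset.sum_comm
    refine Eq.trans ?_ (Finset.sum_congr rfl fun v _ => e v).symm
    conv_rhs => rw [Finset.sum_comm]
    refine Finset.sum_congr rfl fun t _ => ?_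
    rw [Finset.sum_comm]
    refine Finset.sum_congr rfl fun v _ => Finset.sum_congr rfl fun v' _ => ?_
    ring
  · intro y' _ hy'
    refine Finset.sum_eq_zero fun t _ => ?_
    rw [if_neg hy']

/-- An adversary that is defined as the algorithm of a circuit is thereby known to be computed by
it. The reduction is therefore built as a circuit first, and only its action has to be identified.
-/
theorem computes_toQAlg {X Y I O : Type} [BitEnc X] [BitEnc Y] [Fintype Y] [Fintype I]
    [DecidableEq I] [Fintype O] [DecidableEq O]
    (C : Circuit (BitEnc.Lbl X ⊕ I) (BitEnc.Lbl Y ⊕ O))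
    (hY : Function.Surjective (BitEnc.enc : Y → _)) : C.Computes (C.toQAlg hY) := by
  intro x y ρ
  ext o o'
  rw [Matrix.of_apply, toQAlg_apply]

end Circuit

/-! ## Reversible classical circuits -/

/-- The NOT matrix. -/
def notMatrix : Matrix.unitaryGroup Bool ℂ :=
  ⟨Matrix.of fun a b => if a = !b then 1 else 0, by
    rw [Matrix.mem_unitaryGroup_iff]
    ext a b
    cases a <;> cases b <;> simp [Matrix.mul_apply, Matrix.star_apply]⟩

/-- The Hadamard matrix. -/
def hadamardMatrix : Matrix.unitaryGroup Bool ℂ :=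
  ⟨Matrix.of fun a b => ((Real.sqrt 2)⁻¹ : ℝ) * if a && b then -1 else 1, by
    have h : (((Real.sqrt 2)⁻¹ : ℝ) : ℂ) * (((Real.sqrt 2)⁻¹ : ℝ) : ℂ) = 1 / 2 := by
      rw [← Complex.ofReal_mul, ← mul_inv, Real.mul_self_sqrt (by norm_num)]
      norm_num
    rw [Matrix.mem_unitaryGroup_iff]
    ext a b
    cases a <;> cases b <;>
      simp only [Matrix.mul_apply, Matrix.star_apply, Fintype.sum_bool, Matrix.of_apply,
        Bool.and_true, Bool.and_false, if_true, Bool.false_eq_true, if_false, star_mul', mul_one,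
        RCLike.star_def, Complex.conj_ofReal, map_neg, map_one, Matrix.one_apply, mul_neg, neg_mul,
        h, reduceCtorEq] <;> norm_num⟩

/-- The matrix that multiplies the basis state `true` with `z`. -/
def phaseMatrix (z : ℂ) (hz : z * star z = 1) : Matrix.unitaryGroup Bool ℂ :=
  ⟨Matrix.diagonal fun b => if b then z else 1, by
    rw [Matrix.mem_unitaryGroup_iff, Matrix.star_eq_conjTranspose, Matrix.diagonal_conjTranspose,
      Matrix.diagonal_mul_diagonal, ← Matrix.diagonal_one]
    congr 1
    ext b
    cases b <;> simp
    simpa using hz⟩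

section gates

variable {W : Type} [Fintype W] [DecidableEq W]

theorem gatesOp_not (w : W) :
    gatesOp [Gate.single notMatrix w] = funOp fun v => Function.update v w (!v w) := by
  classical
  rw [gatesOp_singleton]
  ext u v
  rw [single_toOp_apply, funOp_apply]
  simp only [notMatrix, Matrix.of_apply]
  rw [← ite_and]
  refine if_congr ⟨fun h => ?_, ?_⟩ rfl rfl
  · ext x
    by_cases hx : x = w
    · subst hx; simp [h.2]
    · simp [hx, h.1 x hx]
  · rintro rfl
    refine ⟨fun x hx => by simp [hx], by simp⟩

theorem gatesOp_cnot (a t : W) (h : a ≠ t) :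
    gatesOp [Gate.cnot a t h] = funOp fun v => Function.update v t (xor (v t) (v a)) := by
  rw [gatesOp_singleton, cnot_toOp]

/-! ### Diagonal gates, and the Toffoli and controlled swap gates obtained from them. -/

theorem gatesOp_phase (z : ℂ) (hz : z * star z = 1) (w : W) :
    gatesOp [Gate.single (phaseMatrix z hz) w] = Matrix.diagonal fun v => if v w then z else 1 := by
  rw [gatesOp_singleton]
  ext u v
  rw [single_toOp_apply, Matrix.diagonal_apply]
  simp only [phaseMatrix, Matrix.diagonal_apply]
  rw [← ite_and]
  refine if_congr ⟨fun h => ?_, ?_⟩ rfl rfl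
  · ext x
    by_cases hx : x = w
    · subst hx; simp [h.2]
    · simp [h.1 x hx]
  · rintro rfl
    simp

theorem gatesOp_append_diagonal {l l' : List (Gate W)} {d d' : (W → Bool) → ℂ}
    (h : gatesOp l = Matrix.diagonal d) (h' : gatesOp l' = Matrix.diagonal d') :
    gatesOp (l ++ l') = Matrix.diagonal fun v => d v * d' v := by
  rw [gatesOp_append, h, h', Matrix.diagonal_mul_diagonal]
  congr 1
  ext v
  ring

/-- The first CNOT writes the parity of the two wires on `t`, the diagonal operator reads it there,
and the second CNOT restores `t`. -/
theorem gatesOp_cnot_conj {l : List (Gate W)} {d : (W → Bool) → ℂ} (a t : W) (hat : a ≠ t)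
    (h : gatesOp l = Matrix.diagonal d) :
    gatesOp (Gate.cnot a t hat :: (l ++ [Gate.cnot a t hat])) =
      Matrix.diagonal fun v => d (Function.update v t (xor (v t) (v a))) := by
  classical
  have hi := cnot_involutive a t hat
  rw [gatesOp_cons, gatesOp_append, gatesOp_cnot, cnot_toOp, h, mul_funOp]
  ext u v
  rw [Matrix.of_apply, Matrix.mul_diagonal, Matrix.diagonal_apply, funOp_apply]
  rw [ite_mul, one_mul, zero_mul]
  by_cases huv : u = v
  · rw [huv, if_pos rfl, if_pos (hi v).symm]
  · rw [if_neg huv, if_neg]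
    exact fun h' => huv (h'.trans (hi v))

/-- The eighth root of unity of the `T` gate. -/
def zeta : ℂ := Complex.exp (((Real.pi / 4 : ℝ) : ℂ) * Complex.I)

theorem zeta_pow_four : zeta ^ 4 = -1 := by
  rw [zeta, ← Complex.exp_nat_mul, ← Complex.exp_pi_mul_I]
  congr 1
  push_cast
  ring

theorem zeta_mul_star : zeta * star zeta = 1 := by
  rw [RCLike.star_def, Complex.mul_conj, Complex.normSq_eq_norm_sq, zeta,
    Complex.norm_exp_ofReal_mul_I]
  simp

theorem zeta_pow_mul_star (m : ℕ) : zeta ^ m * star (zeta ^ m) = 1 := by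
  rw [star_pow, ← mul_pow, zeta_mul_star, one_pow]

/-- The gate that multiplies with a power of `zeta` if the wire `w` holds `true`. -/
def phaseGate (m : ℕ) (w : W) : Gate W := Gate.single (phaseMatrix (zeta ^ m) (zeta_pow_mul_star m)) w

/-- The doubly controlled phase flip. -/
def cczGates (c a b : W) (hca : c ≠ a) (hcb : c ≠ b) (hab : a ≠ b) : List (Gate W) :=
  [phaseGate 1 c] ++ [phaseGate 1 a] ++ [phaseGate 1 b] ++
    (Gate.cnot c a hca :: ([phaseGate 7 a] ++ [Gate.cnot c a hca])) ++
    (Gate.cnot c b hcb :: ([phaseGate 7 b] ++ [Gate.cnot c b hcb])) ++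
    (Gate.cnot a b hab :: ([phaseGate 7 b] ++ [Gate.cnot a b hab])) ++
    (Gate.cnot c b hcb :: ((Gate.cnot a b hab :: ([phaseGate 1 b] ++ [Gate.cnot a b hab])) ++
      [Gate.cnot c b hcb]))

/-- For bits one has `4cab = c + a + b - (c ⊕ a) - (c ⊕ b) - (a ⊕ b) + (c ⊕ a ⊕ b)`. As `zeta ^ 4 =
-1`, phases `zeta` and `zeta⁻¹ = zeta ^ 7` on these parities multiply to `(-1) ^ (cab)`. -/
theorem gatesOp_ccz (c a b : W) (hca : c ≠ a) (hcb : c ≠ b) (hab : a ≠ b) :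
    gatesOp (cczGates c a b hca hcb hab) =
      Matrix.diagonal fun v => if v c && v a && v b then -1 else 1 := by
  have hp : ∀ (m : ℕ) (w : W), gatesOp [phaseGate m w] =
      Matrix.diagonal fun v => if v w then zeta ^ m else 1 := fun m w => gatesOp_phase _ _ w
  rw [cczGates, gatesOp_append_diagonal (gatesOp_append_diagonal (gatesOp_append_diagonal
    (gatesOp_append_diagonal (gatesOp_append_diagonal (gatesOp_append_diagonal (hp 1 c) (hp 1 a))
      (hp 1 b)) (gatesOp_cnot_conj c a hca (hp 7 a))) (gatesOp_cnot_conj c b hcb (hp 7 b)))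
      (gatesOp_cnot_conj a b hab (hp 7 b)))
      (gatesOp_cnot_conj c b hcb (gatesOp_cnot_conj a b hab (hp 1 b)))]
  congr 1
  ext v
  have h4 := zeta_pow_four
  simp only [Function.update_self, ne_eq, hab, not_false_eq_true, Function.update_of_ne, pow_one]
  cases v c <;> cases v a <;> cases v b <;> simp
  -- With one or two bits set the phases multiply to `zeta ^ 16`, and `zeta ^ 16 - 1` is this factor
  -- times `zeta ^ 4 + 1`. With all three bits set the product is `zeta ^ 4`.
  · linear_combination (zeta ^ 12 - zeta ^ 8 + zeta ^ 4 - 1) * h4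
  · linear_combination (zeta ^ 12 - zeta ^ 8 + zeta ^ 4 - 1) * h4
  · linear_combination (zeta ^ 12 - zeta ^ 8 + zeta ^ 4 - 1) * h4
  · linear_combination (zeta ^ 12 - zeta ^ 8 + zeta ^ 4 - 1) * h4
  · linear_combination (zeta ^ 12 - zeta ^ 8 + zeta ^ 4 - 1) * h4
  · linear_combination (zeta ^ 12 - zeta ^ 8 + zeta ^ 4 - 1) * h4
  · linear_combination h4

/-- The Toffoli gate. -/
def ccnotGates (c a b : W) (hca : c ≠ a) (hcb : c ≠ b) (hab : a ≠ b) : List (Gate W) :=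
  Gate.single hadamardMatrix b ::
    (cczGates c a b hca hcb hab ++ [Gate.single hadamardMatrix b])

/-- Conjugation by a Hadamard gate turns a phase flip of the wire `b` into a bit flip, and both
controls are untouched. -/
theorem gatesOp_ccnot (c a b : W) (hca : c ≠ a) (hcb : c ≠ b) (hab : a ≠ b) :
    gatesOp (ccnotGates c a b hca hcb hab) =
      funOp fun v => Function.update v b (xor (v b) (v c && v a)) := by
  classical
  rw [ccnotGates, gatesOp_cons, gatesOp_append, gatesOp_ccz, gatesOp_singleton]
  ext u v
  rw [Matrix.mul_apply, funOp_apply]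
  simp only [single_toOp_apply, Matrix.mul_diagonal, mul_ite, mul_zero]
  rw [sum_agree_off b v]
  by_cases hv : ∀ x, x ≠ b → u x = v x
  · have h1 : ∀ z, ∀ x, x ≠ b → u x = Function.update v b z x := by
      intro z x hx
      simp [hx, hv x hx]
    have h2 : u = Function.update v b (xor (v b) (v c && v a)) ↔ u b = xor (v b) (v c && v a) := by
      refine ⟨fun h => by rw [h]; simp, fun h => ?_⟩
      ext x
      by_cases hx : x = b
      · subst hx; simp [h]
      · simp [hx, hv x hx]
    have h : (((Real.sqrt 2)⁻¹ : ℝ) : ℂ) * (((Real.sqrt 2)⁻¹ : ℝ) : ℂ) = 1 / 2 := by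
      rw [← Complex.ofReal_mul, ← mul_inv, Real.mul_self_sqrt (by norm_num)]
      norm_num
    simp only [if_pos (h1 _), h2, hadamardMatrix, Matrix.of_apply, Function.update_self, ne_eq, hab,
      hcb, not_false_eq_true, Function.update_of_ne, Fintype.sum_bool]
    generalize (((Real.sqrt 2)⁻¹ : ℝ) : ℂ) = r at h ⊢
    cases u b <;> cases v b <;> cases v c <;> cases v a <;> simp <;>
      linear_combination 2 * h
  · have h1 : ∀ z, ¬ ∀ x, x ≠ b → u x = Function.update v b z x := by
      intro z hz
      refine hv fun x hx => ?_
      have := hz x hx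
      simpa [hx] using this
    have h2 : u ≠ Function.update v b (xor (v b) (v c && v a)) := by
      rintro rfl
      exact hv fun x hx => by simp [hx]
    simp only [if_neg (h1 _), if_neg h2]
    simp

/-- The controlled swap gate. -/
def cswapGates (c a b : W) (hca : c ≠ a) (hcb : c ≠ b) (hab : a ≠ b) : List (Gate W) :=
  Gate.cnot b a hab.symm :: (ccnotGates c a b hca hcb hab ++ [Gate.cnot b a hab.symm])

/-- If `c` holds `false`, the two outer CNOT gates cancel; if `c` holds `true`, three alternating
CNOT gates make a swap. -/
theorem gatesOp_cswap (c a b : W) (hca : c ≠ a) (hcb : c ≠ b) (hab : a ≠ b) :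
    gatesOp (cswapGates c a b hca hcb hab) =
      funOp fun v => if v c then v ∘ Equiv.swap a b else v := by
  rw [cswapGates, gatesOp_cons, gatesOp_append, gatesOp_ccnot, gatesOp_cnot, cnot_toOp, funOp_mul,
    funOp_mul]
  congr 1
  ext v x
  simp only [Function.comp_apply]
  by_cases hxa : x = a
  · subst hxa
    simp only [Function.update_self, ne_eq, hab, hab.symm, hca, not_false_eq_true,
      Function.update_of_ne]
    cases v c <;> cases h1 : v x <;> cases h2 : v b <;> simp [h1, h2]
  · by_cases hxb : x = b
    · subst hxb
      simp only [Function.update_self, ne_eq, hab, hab.symm, hca, not_false_eq_true,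
        Function.update_of_ne]
      cases v c <;> cases h1 : v x <;> cases h2 : v a <;> simp [h1, h2]
    · simp only [ne_eq, hxa, hxb, not_false_eq_true, Function.update_of_ne]
      split_ifs
      · simp [Equiv.swap_apply_of_ne_of_ne hxa hxb]
      · rfl

/-! ### Layers of gates on disjoint wires. -/

/-- Gates that act on disjoint sets `T i` of wires can be combined: on `T i` the result is that of
the `i`-th operation. -/
theorem exists_gates_family {J : Type} [DecidableEq J] (K : ℕ) (L : J → List (Gate W))
    (F : J → (W → Bool) → (W → Bool)) (T : J → Set W) (hlen : ∀ i, (L i).length ≤ K)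
    (hL : ∀ i, gatesOp (L i) = funOp (F i)) (hoff : ∀ i v, ∀ w ∉ T i, F i v w = v w)
    (hloc : ∀ i i', i ≠ i' → ∀ v v', (∀ w ∉ T i', v w = v' w) → ∀ w ∈ T i, F i v w = F i v' w)
    (hdisj : ∀ i i', i ≠ i' → ∀ w ∈ T i, w ∉ T i') (s : Finset J) :
    ∃ (l : List (Gate W)) (f : (W → Bool) → (W → Bool)), l.length ≤ K * s.card ∧
      gatesOp l = funOp f ∧ (∀ v, ∀ i ∈ s, ∀ w ∈ T i, f v w = F i v w) ∧
      ∀ v w, (∀ i ∈ s, w ∉ T i) → f v w = v w := by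
  induction s using Finset.induction_on with
  | empty =>
    refine ⟨[], id, by simp, ?_, by simp, by simp⟩
    rw [gatesOp_nil, funOp_id]
  | insert a s ha ih =>
    obtain ⟨l, f, hl, hf, hfs, hfo⟩ := ih
    refine ⟨L a ++ l, f ∘ F a, ?_, ?_, ?_, ?_⟩
    · rw [List.length_append, Finset.card_insert_of_notMem ha]
      have := hlen a
      nlinarith
    · rw [gatesOp_append, hf, hL, funOp_mul]
    · intro v i hi w hw
      rw [Function.comp_apply]
      rcases Finset.mem_insert.1 hi with rfl | hi
      · exact hfo _ _ fun i' hi' => hdisj i i' (fun h => ha (h ▸ hi')) w hw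
      · rw [hfs _ i hi w hw]
        have hia : i ≠ a := fun h => ha (h ▸ hi)
        -- `F a` has acted before, but only on `T a`, and what `F i` does on `T i` does not depend
        -- on these wires. Controls may be shared as long as they are not targets.
        exact hloc i a hia _ _ (hoff a v) w hw
    · intro v w hw
      rw [Function.comp_apply, hfo _ _ fun i hi => hw i (Finset.mem_insert_of_mem hi),
        hoff a v w (hw a (Finset.mem_insert_self a s))]

/-- Negations on the wires of a set. -/
theorem exists_not_gates (m : W → Bool) :
    ∃ l : List (Gate W), l.length ≤ Fintype.card W ∧ gatesOp l = funOp fun v w => xor (v w) (m w) := by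
  obtain ⟨l, f, hl, hf, hfs, hfo⟩ := exists_gates_family (W := W) 1
    (fun w => [Gate.single notMatrix w]) (fun w v => Function.update v w (!v w)) (fun w => {w})
    (fun _ => le_rfl) (fun w => gatesOp_not w) (fun i v w hw => by
      rw [Function.update_of_ne]
      simpa using hw)
    (fun i i' hi v v' h w hw => by
      rw [Set.mem_singleton_iff.1 hw, Function.update_self, Function.update_self, h i]
      simpa using hi)
    (fun i i' hi w hw => by
      rw [Set.mem_singleton_iff.1 hw]
      simpa using hi) (Finset.univ.filter fun w => m w = true)
  refine ⟨l, hl.trans ?_, hf.trans ?_⟩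
  · rw [one_mul]
    exact Finset.card_le_univ _
  · congr 1
    ext v w
    by_cases hw : m w = true
    · rw [hfs v w (by simpa using hw) w rfl, Function.update_self, hw, Bool.xor_true]
    · rw [hfo v w]
      · rw [Bool.not_eq_true] at hw
        simp [hw]
      · rintro i hi rfl
        simp at hi
        exact hw hi

/-- Copies of the wires `c i` are added to the wires `t i`. -/
theorem exists_copy_gates {J : Type} [Fintype J] [DecidableEq J] (c t : J → W)
    (ht : Function.Injective t) (hct : ∀ i i', c i ≠ t i') :
    ∃ (l : List (Gate W)) (f : (W → Bool) → (W → Bool)), l.length ≤ Fintype.card J ∧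
      gatesOp l = funOp f ∧ (∀ v i, f v (t i) = xor (v (t i)) (v (c i))) ∧
      ∀ v w, (∀ i, w ≠ t i) → f v w = v w := by
  obtain ⟨l, f, hl, hf, hfs, hfo⟩ := exists_gates_family (W := W) 1
    (fun i => [Gate.cnot (c i) (t i) (hct i i)])
    (fun i v => Function.update v (t i) (xor (v (t i)) (v (c i)))) (fun i => {t i})
    (fun _ => le_rfl) (fun i => gatesOp_cnot _ _ _) (fun i v w hw => by
      rw [Function.update_of_ne]
      simpa using hw)
    (fun i i' hi v v' h w hw => by
      rw [Set.mem_singleton_iff.1 hw, Function.update_self, Function.update_self, h (t i), h (c i)]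
      · simpa using hct i i'
      · simpa using ht.ne hi)
    (fun i i' hi w hw => by
      rw [Set.mem_singleton_iff.1 hw]
      simpa using ht.ne hi) Finset.univ
  refine ⟨l, f, by simpa using hl, hf, fun v i => ?_, fun v w hw => ?_⟩
  · rw [hfs v i (Finset.mem_univ i) _ rfl, Function.update_self]
  · exact hfo v w fun i _ => by simpa using hw i

/-- Controlled by the wires `c i`, the wires `a i` and `b i` are swapped. -/
theorem exists_cswap_gates {J : Type} [Fintype J] [DecidableEq J] (c a b : J → W)
    (ha : Function.Injective a) (hb : Function.Injective b) (hca : ∀ i i', c i ≠ a i')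
    (hcb : ∀ i i', c i ≠ b i') (hab : ∀ i i', a i ≠ b i') :
    ∃ (l : List (Gate W)) (f : (W → Bool) → (W → Bool)), l.length ≤ 21 * Fintype.card J ∧
      gatesOp l = funOp f ∧
      (∀ v i, f v (a i) = if v (c i) then v (b i) else v (a i)) ∧
      (∀ v i, f v (b i) = if v (c i) then v (a i) else v (b i)) ∧
      ∀ v w, (∀ i, w ≠ a i) → (∀ i, w ≠ b i) → f v w = v w := by
  have key : ∀ i (v : W → Bool), (if v (c i) then v ∘ Equiv.swap (a i) (b i) else v) (a i) =
        (if v (c i) then v (b i) else v (a i)) ∧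
      (if v (c i) then v ∘ Equiv.swap (a i) (b i) else v) (b i) =
        (if v (c i) then v (a i) else v (b i)) := by
    intro i v
    constructor <;> split_ifs <;> simp
  -- A controlled swap has 21 gates: 17 for the doubly controlled phase, two Hadamard gates and two
  -- outer CNOT gates.
  obtain ⟨l, f, hl, hf, hfs, hfo⟩ := exists_gates_family (W := W) 21
    (fun i => cswapGates (c i) (a i) (b i) (hca i i) (hcb i i) (hab i i))
    (fun i v => if v (c i) then v ∘ Equiv.swap (a i) (b i) else v) (fun i => {a i, b i})
    (fun _ => le_rfl) (fun i => gatesOp_cswap _ _ _ _ _ _)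
    (fun i v w hw => by
      simp only [Set.mem_insert_iff, Set.mem_singleton_iff, not_or] at hw
      split_ifs
      · simp [Equiv.swap_apply_of_ne_of_ne hw.1 hw.2]
      · rfl)
    (fun i i' hi v v' h w hw => by
      simp only [Set.mem_insert_iff, Set.mem_singleton_iff, not_or, and_imp] at h
      have h1 := h (a i) (ha.ne hi) (hab i i')
      have h2 := h (b i) (hab i' i).symm (hb.ne hi)
      have h3 := h (c i) (hca i i') (hcb i i')
      rcases hw with rfl | hw
      · rw [(key i v).1, (key i v').1, h1, h2, h3]
      · rw [Set.mem_singleton_iff.1 hw, (key i v).2, (key i v').2, h1, h2, h3])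
    (fun i i' hi w hw => by
      rcases hw with rfl | hw
      · simpa using ⟨ha.ne hi, hab i i'⟩
      · rw [Set.mem_singleton_iff.1 hw]
        simpa using ⟨(hab i' i).symm, hb.ne hi⟩) Finset.univ
  refine ⟨l, f, by simpa using hl, hf, fun v i => ?_, fun v i => ?_, fun v w hwa hwb => ?_⟩
  · rw [hfs v i (Finset.mem_univ i) _ (Set.mem_insert _ _), (key i v).1]
  · rw [hfs v i (Finset.mem_univ i) _ (Set.mem_insert_of_mem _ rfl), (key i v).2]
  · exact hfo v w fun i _ => by simpa using ⟨hwa i, hwb i⟩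

end gates

/-! ## Circuits with classical pre- and postprocessing -/

theorem kron2_mul {O₁ K₁ I₁ O₂ K₂ I₂ : Type} [Fintype K₁] [DecidableEq K₁] [Fintype K₂]
    [DecidableEq K₂] (A : QOp O₁ K₁) (B : QOp O₂ K₂) (A' : QOp K₁ I₁) (B' : QOp K₂ I₂) :
    kron2 A B * kron2 A' B' = kron2 (A * A') (B * B') := by
  ext u v
  simp only [Matrix.mul_apply, kron2, Matrix.of_apply]
  rw [Finset.sum_mul_sum, ← Finset.sum_product', Finset.univ_product_univ]
  refine Fintype.sum_equiv (Equiv.sumArrowEquivProdArrow K₁ K₂ Bool) _ _ fun w => ?_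
  simp only [Equiv.sumArrowEquivProdArrow, Equiv.coe_fn_mk, Function.comp_def]
  ring

/-- A gate on the first summand of the wires. -/
def Gate.inl {W : Type} (E : Type) : Gate W → Gate (W ⊕ E)
  | .single U w => .single U (Sum.inl w)
  | .cnot a t h => .cnot (Sum.inl a) (Sum.inl t) (by simpa using h)

theorem Gate.inl_toOp {W E : Type} [Fintype W] [DecidableEq W] [Fintype E] [DecidableEq E]
    (g : Gate W) : (g.inl E).toOp = kron2 g.toOp (1 : QOp E E) := by
  classical
  ext u v
  simp only [kron2, Matrix.of_apply, Matrix.one_apply]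
  cases g with
  | single U w =>
    rw [inl, single_toOp_apply, single_toOp_apply, mul_ite, mul_one, mul_zero, ← ite_and]
    refine if_congr ⟨fun h => ⟨?_, fun w' hw' => ?_⟩, ?_⟩ rfl rfl
    · ext e
      exact h _ (by simp)
    · exact h _ (by simpa using hw')
    · rintro ⟨h, h'⟩ (w' | e) hw'
      · exact h' _ (by simpa using hw')
      · exact congrFun h e
  | cnot a t h =>
    rw [inl, cnot_toOp, cnot_toOp, funOp_apply, funOp_apply, mul_ite, mul_one, mul_zero, ← ite_and]
    refine if_congr ⟨fun h' => ⟨?_, ?_⟩, ?_⟩ rfl rfl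
    · ext e
      simp [h']
    · ext w
      simp only [h']
      by_cases hw : w = t
      · subst hw; simp
      · simp [hw]
    · rintro ⟨h₁, h₂⟩
      ext (w | e)
      · rw [congrFun h₂ w]
        by_cases hw : w = t
        · subst hw; simp
        · simp [hw]
      · simpa using congrFun h₁ e

theorem gatesOp_map_inl {W E : Type} [Fintype W] [DecidableEq W] [Fintype E] [DecidableEq E]
    (l : List (Gate W)) : gatesOp (l.map (Gate.inl E)) = kron2 (gatesOp l) (1 : QOp E E) := by
  induction l with
  | nil => rw [List.map_nil, gatesOp_nil, gatesOp_nil, kron2_one]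
  | cons g l ih =>
    rw [List.map_cons, gatesOp_cons, gatesOp_cons, ih, Gate.inl_toOp, kron2_mul, Matrix.one_mul]

/-! ### A circuit between two layers of gates that map basis states to basis states. -/

namespace Circuit

section sandwich

variable {I O I' O' : Type} (C : Circuit I O) (E : Type) [Fintype E] [DecidableEq E]
  (inp : I' ↪ C.W ⊕ E) (out : O' ↪ C.W ⊕ E) (pre post : List (Gate (C.W ⊕ E)))

/-- The circuit `C` with additional wires, preceded by the gates `pre` and followed by the gates
`post`. -/
def sandwich : Circuit I' O' where
  W := C.W ⊕ E
  inp := inp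
  out := out
  gates := pre ++ C.gates.map (Gate.inl E) ++ post

theorem sandwich_size :
    (C.sandwich E inp out pre post).size =
      C.size + Fintype.card E + pre.length + post.length := by
  have h : Fintype.card (C.W ⊕ E) = Fintype.card C.W + Fintype.card E := Fintype.card_sum
  simp only [size, sandwich, List.length_append, List.length_map]
  refine Eq.trans (congrArg (· + (pre.length + C.gates.length + post.length)) h) ?_
  ring

open Classical in
-- The layer `pre` sends the padded basis state to a padded input of `C` next to a fixed content `e`
-- of the extra wires. Superpositions arise only inside `C`, and `post` merely relabels basis
-- states.
theorem sandwich_amp {f g : (C.W ⊕ E → Bool) → (C.W ⊕ E → Bool)}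
    (hpre : gatesOp pre = funOp f) (hpost : gatesOp post = funOp g) {v : I' → Bool} {u : I → Bool}
    {e : E → Bool}
    (hv : f ((C.sandwich E inp out pre post).pad v) = Sum.elim (C.pad u) e)
    (w : C.W ⊕ E → Bool) :
    (C.sandwich E inp out pre post).amp w v =
      ∑ a, if w = g (Sum.elim a e) then C.amp a u else 0 := by
  have h : ∀ w x, gatesOp (pre ++ C.gates.map (Gate.inl E) ++ post) w x =
      (funOp g * kron2 (gatesOp C.gates) (1 : QOp E E)) w (f x) := by
    intro w x
    rw [gatesOp_append, gatesOp_append, hpre, hpost, gatesOp_map_inl, ← Matrix.mul_assoc, mul_funOp,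
      Matrix.of_apply]
  have h' : (C.sandwich E inp out pre post).amp w v =
      gatesOp (pre ++ C.gates.map (Gate.inl E) ++ post) w
        ((C.sandwich E inp out pre post).pad v) := rfl
  refine (h'.trans (h _ _)).trans ?_
  rw [hv, Matrix.mul_apply, ← (Equiv.sumArrowEquivProdArrow C.W E Bool).symm.sum_comp, Fintype.sum_prod_type]
  refine Finset.sum_congr rfl fun a _ => ?_
  rw [Finset.sum_eq_single e]
  · have : (Equiv.sumArrowEquivProdArrow C.W E Bool).symm (a, e) = Sum.elim a e := by
      ext x; cases x <;> rfl
    rw [this, funOp_apply, ite_mul, one_mul, zero_mul]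
    simp only [kron2, Matrix.of_apply, Sum.elim_inl, Sum.elim_inr, Matrix.one_apply, if_true,
      mul_one]
    rfl
  · intro e' _ he'
    have : (Equiv.sumArrowEquivProdArrow C.W E Bool).symm (a, e') = Sum.elim a e' := by
      ext x; cases x <;> rfl
    rw [this]
    simp [kron2, Matrix.one_apply, he']
  · simp

open Classical in
-- After substituting the amplitudes, only the pairs of wire contents that come from contents `a`,
-- `a'` of `C` survive. The condition `hQ` says that tracing out the larger circuit is tracing out
-- `C`, up to a condition `Q` on the labels that is independent of `a` and `a'`. Each application
-- thus reduces to bookkeeping of wires.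
theorem sandwich_kernel {f g : (C.W ⊕ E → Bool) → (C.W ⊕ E → Bool)}
    (hpre : gatesOp pre = funOp f) (hpost : gatesOp post = funOp g) {v v' : I' → Bool}
    {u u' : I → Bool} {e e' : E → Bool}
    (hv : f ((C.sandwich E inp out pre post).pad v) = Sum.elim (C.pad u) e)
    (hv' : f ((C.sandwich E inp out pre post).pad v') = Sum.elim (C.pad u') e')
    {o o' : O' → Bool} {p p' : O → Bool} {Q : Prop}
    (hQ : ∀ a a', (C.sandwich E inp out pre post).Agree (g (Sum.elim a e)) (g (Sum.elim a' e')) o o'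
      ↔ Q ∧ C.Agree a a' p p') :
    (C.sandwich E inp out pre post).kernel v v' o o' =
      if Q then C.kernel u u' p p' else 0 := by
  have key : (C.sandwich E inp out pre post).kernel v v' o o' =
      ∑ a, ∑ a', if (C.sandwich E inp out pre post).Agree (g (Sum.elim a e)) (g (Sum.elim a' e')) o o'
        then C.amp a u * star (C.amp a' u') else 0 := by
    have h1 : ∀ w w' : C.W ⊕ E → Bool,
        (if (C.sandwich E inp out pre post).Agree w w' o o' then
          (C.sandwich E inp out pre post).amp w v * star ((C.sandwich E inp out pre post).amp w' v')
          else 0) = ∑ a, ∑ a', if w = g (Sum.elim a e) ∧ w' = g (Sum.elim a' e') then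
            (if (C.sandwich E inp out pre post).Agree (g (Sum.elim a e)) (g (Sum.elim a' e')) o o'
        then C.amp a u * star (C.amp a' u') else 0) else 0 := by
      intro w w'
      rw [sandwich_amp C E inp out pre post hpre hpost hv,
        sandwich_amp C E inp out pre post hpre hpost hv', star_sum, Finset.sum_mul_sum]
      by_cases hA : (C.sandwich E inp out pre post).Agree w w' o o'
      · rw [if_pos hA]
        refine Finset.sum_congr rfl fun a _ => Finset.sum_congr rfl fun a' _ => ?_
        by_cases h₁ : w = g (Sum.elim a e)
        · by_cases h₂ : w' = g (Sum.elim a' e')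
          · rw [if_pos h₁, if_pos h₂, if_pos ⟨h₁, h₂⟩, ← h₁, ← h₂, if_pos hA]
          · simp [h₂]
        · simp [h₁]
      · rw [if_neg hA]
        symm
        refine Finset.sum_eq_zero fun a _ => Finset.sum_eq_zero fun a' _ => ?_
        split_ifs with h₁ h₂
        · rw [← h₁.1, ← h₁.2] at h₂
          exact absurd h₂ hA
        · rfl
        · rfl
    have h2 : (C.sandwich E inp out pre post).kernel v v' o o' =
        ∑ w : C.W ⊕ E → Bool, ∑ w' : C.W ⊕ E → Bool,
          ∑ a, ∑ a', if w = g (Sum.elim a e) ∧ w' = g (Sum.elim a' e') then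
            (if (C.sandwich E inp out pre post).Agree (g (Sum.elim a e)) (g (Sum.elim a' e')) o o'
        then C.amp a u * star (C.amp a' u') else 0) else 0 :=
      Finset.sum_congr rfl fun w _ => Finset.sum_congr rfl fun w' _ => h1 w w'
    rw [h2]
    simp only [ite_and]
    have h3 : ∀ w : C.W ⊕ E → Bool, (∑ w' : C.W ⊕ E → Bool,
          ∑ a : C.W → Bool, ∑ a' : C.W → Bool,
          if w = g (Sum.elim a e) then if w' = g (Sum.elim a' e') then
            (if (C.sandwich E inp out pre post).Agree (g (Sum.elim a e)) (g (Sum.elim a' e')) o o'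
        then C.amp a u * star (C.amp a' u') else 0) else 0 else 0) =
        ∑ a : C.W → Bool, ∑ a' : C.W → Bool, if w = g (Sum.elim a e) then
          (if (C.sandwich E inp out pre post).Agree (g (Sum.elim a e)) (g (Sum.elim a' e')) o o'
        then C.amp a u * star (C.amp a' u') else 0) else 0 := by
      intro w
      rw [Finset.sum_comm]
      refine Finset.sum_congr rfl fun a _ => ?_
      rw [Finset.sum_comm]
      refine Finset.sum_congr rfl fun a' _ => ?_
      split_ifs <;> simp
    simp only [h3]
    rw [Finset.sum_comm]
    refine Finset.sum_congr rfl fun a _ => ?_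
    rw [Finset.sum_comm]
    refine Finset.sum_congr rfl fun a' _ => ?_
    simp
  rw [key]
  simp only [hQ, ite_and]
  by_cases h : Q
  · simp [h, kernel]
  · simp [h]

end sandwich

end Circuit

/-! ### The two circuit constructions of the reduction. -/

namespace Circuit

/-- Hardwire a part of the classical input of a circuit, pass on an additional register `X`, measure
the classical part of the output, and report its bit `j` and the negation of this bit. -/
theorem exists_hardwired_circuit {L L₀ A M S X : Type} [Fintype X] [DecidableEq X] [Fintype M]
    [DecidableEq M] (C : Circuit (L ⊕ A) (M ⊕ S)) (ι : L₀ ↪ L) (h : L → Bool) (j : M) :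
    ∃ C' : Circuit (L₀ ⊕ (A ⊕ X)) (((Fin 1 × Unit) ⊕ (Fin 1 × Unit)) ⊕ ((M ⊕ S) ⊕ X)),
      C'.size ≤ 2 * C.size + 2 * Fintype.card X + 3 * Fintype.card M + 3 ∧
      ∀ (G : L → Bool) (p : L₀ → Bool), (∀ l, G (ι l) = p l) → (∀ l ∉ Set.range ι, G l = h l) →
        ∀ (a a' : A → Bool) (ξ ξ' : X → Bool) (b₀ b₁ : Fin 1 × Unit → Bool) (y y' : M ⊕ S → Bool)
          (z z' : X → Bool) (Q : Prop) [Decidable Q],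
          (Q ↔ ξ = z ∧ ξ' = z' ∧ (∀ i, y (Sum.inl i) = y' (Sum.inl i)) ∧
            (b₀ = fun _ => y (Sum.inl j)) ∧ b₁ = fun _ => !y (Sum.inl j)) →
          C'.kernel (Sum.elim p (Sum.elim a ξ)) (Sum.elim p (Sum.elim a' ξ'))
            (Sum.elim (Sum.elim b₀ b₁) (Sum.elim y z))
            (Sum.elim (Sum.elim b₀ b₁) (Sum.elim y' z')) =
          if Q then C.kernel (Sum.elim G a) (Sum.elim G a') y y' else 0 := by
  classical
  -- The extra wires are those of the register `X`, an ancilla `some i` for a copy of each classical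
  -- output bit `i`, and an ancilla `none` for the negated copy of bit `j`.
  let inp : L₀ ⊕ (A ⊕ X) ↪ C.W ⊕ (X ⊕ Option M) :=
    ⟨fun i => match i with
      | Sum.inl l => Sum.inl (C.inp (Sum.inl (ι l)))
      | Sum.inr (Sum.inl a) => Sum.inl (C.inp (Sum.inr a))
      | Sum.inr (Sum.inr x) => Sum.inr (Sum.inl x), by
      rintro (l | a | x) (l' | a' | x') h <;> simp_all⟩
  -- The ancillas `some j` and `none` are the reported bits. The copies `some i` with `i ≠ j` are
  -- traced out, and this is what measures those bits of the output.
  let out : ((Fin 1 × Unit) ⊕ (Fin 1 × Unit)) ⊕ ((M ⊕ S) ⊕ X) ↪ C.W ⊕ (X ⊕ Option M) :=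
    ⟨fun i => match i with
      | Sum.inl (Sum.inl _) => Sum.inr (Sum.inr (some j))
      | Sum.inl (Sum.inr _) => Sum.inr (Sum.inr none)
      | Sum.inr (Sum.inl y) => Sum.inl (C.out y)
      | Sum.inr (Sum.inr x) => Sum.inr (Sum.inl x), by
      rintro ((i | i) | y | x) ((i' | i') | y' | x') h <;> simp_all
      all_goals exact Subsingleton.elim _ _⟩
  have i1 : ∀ l, inp (Sum.inl l) = Sum.inl (C.inp (Sum.inl (ι l))) := fun _ => rfl
  have i2 : ∀ a, inp (Sum.inr (Sum.inl a)) = Sum.inl (C.inp (Sum.inr a)) := fun _ => rfl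
  have i3 : ∀ x, inp (Sum.inr (Sum.inr x)) = Sum.inr (Sum.inl x) := fun _ => rfl
  have o1 : ∀ i, out (Sum.inl (Sum.inl i)) = Sum.inr (Sum.inr (some j)) := fun _ => rfl
  have o2 : ∀ i, out (Sum.inl (Sum.inr i)) = Sum.inr (Sum.inr none) := fun _ => rfl
  have o3 : ∀ y, out (Sum.inr (Sum.inl y)) = Sum.inl (C.out y) := fun _ => rfl
  have o4 : ∀ x, out (Sum.inr (Sum.inr x)) = Sum.inr (Sum.inl x) := fun _ => rfl
  -- Negations write the hardwired bits on the input wires outside the range of `ι`. They also set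
  -- `none` to `true`, so that adding bit `j` there produces its negation.
  let mask : C.W ⊕ (X ⊕ Option M) → Bool := fun w => match w with
    | Sum.inl w => decide (∃ l, l ∉ Set.range ι ∧ C.inp (Sum.inl l) = w ∧ h l = true)
    | Sum.inr (Sum.inl _) => false
    | Sum.inr (Sum.inr o) => o.isNone
  obtain ⟨pre, hprel, hpre⟩ := exists_not_gates mask
  let c : Option M → C.W ⊕ (X ⊕ Option M) := fun o => Sum.inl (C.out (Sum.inl (o.getD j)))
  let t : Option M → C.W ⊕ (X ⊕ Option M) := fun o => Sum.inr (Sum.inr o)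
  obtain ⟨post, g, hpostl, hpost, hgt, hgo⟩ := exists_copy_gates c t
    (fun o o' h => by simpa [t] using h) (fun o o' => by simp [c, t])
  refine ⟨C.sandwich (X ⊕ Option M) inp out pre post, ?_, ?_⟩
  · rw [sandwich_size]
    have e1 : Fintype.card (C.W ⊕ (X ⊕ Option M)) = Fintype.card C.W + (Fintype.card X + (Fintype.card M + 1)) := by
      simp
    have e2 : Fintype.card (X ⊕ Option M) = Fintype.card X + (Fintype.card M + 1) := by simp
    have e3 : Fintype.card (Option M) = Fintype.card M + 1 := by simp
    have e4 : Fintype.card C.W ≤ C.size := by simp [size]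
    omega
  intro G p hGι hG a a' ξ ξ' b₀ b₁ y y' z z' Q _ hQ
  have hpad : ∀ (a : A → Bool) (ξ : X → Bool),
      (fun (v : C.W ⊕ (X ⊕ Option M) → Bool) w => xor (v w) (mask w))
        ((C.sandwich (X ⊕ Option M) inp out pre post).pad (Sum.elim p (Sum.elim a ξ))) =
      Sum.elim (C.pad (Sum.elim G a)) (Sum.elim ξ Option.isNone) := by
    intro a ξ
    have hp : ∀ i, (C.sandwich (X ⊕ Option M) inp out pre post).pad (Sum.elim p (Sum.elim a ξ)) (inp i) =
      Sum.elim p (Sum.elim a ξ) i := fun i => pad_inp (C.sandwich (X ⊕ Option M) inp out pre post) _ i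
    have hn : ∀ x, x ∉ Set.range inp →
        (C.sandwich (X ⊕ Option M) inp out pre post).pad (Sum.elim p (Sum.elim a ξ)) x = false :=
      fun x hx => pad_of_notMem (C.sandwich (X ⊕ Option M) inp out pre post) _ hx
    generalize (C.sandwich (X ⊕ Option M) inp out pre post).pad (Sum.elim p (Sum.elim a ξ)) = v at hp hn
    ext (w | x | o)
    · by_cases hw : w ∈ Set.range C.inp
      · obtain ⟨(l | i), rfl⟩ := hw
        · rw [Sum.elim_inl, pad_inp, Sum.elim_inl]
          by_cases hl : l ∈ Set.range ι
          · obtain ⟨l, rfl⟩ := hl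
            have : mask (Sum.inl (C.inp (Sum.inl (ι l)))) = false := by simp [mask]
            have h2 := hp (Sum.inl l)
            simp only [Sum.elim_inl] at h2
            simp only [this, Bool.xor_false, hGι]
            exact h2
          · have : mask (Sum.inl (C.inp (Sum.inl l))) = h l := by
              simp only [mask]
              rw [Bool.eq_iff_iff, decide_eq_true_iff]
              refine ⟨?_, fun h' => ⟨l, hl, rfl, h'⟩⟩
              rintro ⟨l', -, h1, h2⟩
              rw [EmbeddingLike.apply_eq_iff_eq, Sum.inl.injEq] at h1
              rwa [h1] at h2
            simp only [this, hG l hl]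
            rw [hn, Bool.false_xor]
            rintro ⟨(l' | a' | x'), hl'⟩ <;> simp [i1, i2, i3] at hl'
            exact hl ⟨l', hl'⟩
        · have : mask (Sum.inl (C.inp (Sum.inr i))) = false := by simp [mask]
          have h2 := hp (Sum.inr (Sum.inl i))
          simp only [Sum.elim_inl, Sum.elim_inr] at h2
          simp only [this, Bool.xor_false, Sum.elim_inl, pad_inp, Sum.elim_inr]
          exact h2
      · have : mask (Sum.inl w) = false := by
          simp only [mask, decide_eq_false_iff_not]
          rintro ⟨l, -, rfl, -⟩
          exact hw ⟨_, rfl⟩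
        rw [Sum.elim_inl, pad_of_notMem C _ hw]
        simp only [this, Bool.xor_false]
        apply hn
        rintro ⟨(l' | a' | x'), hl'⟩ <;> simp [i1, i2, i3] at hl'
        · exact hw ⟨_, hl'⟩
        · exact hw ⟨_, hl'⟩
    · have h2 := hp (Sum.inr (Sum.inr x))
      simp only [Sum.elim_inr] at h2
      simp only [mask, Bool.xor_false, Sum.elim_inr, Sum.elim_inl]
      exact h2
    · simp only [mask, Sum.elim_inr]
      rw [hn, Bool.false_xor]
      rintro ⟨(l' | a' | x'), hl'⟩ <;> simp [i1, i2, i3] at hl'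
  have hg : ∀ (a : C.W → Bool) (ξ : X → Bool),
      (∀ w, g (Sum.elim a (Sum.elim ξ Option.isNone)) (Sum.inl w) = a w) ∧
      (∀ x, g (Sum.elim a (Sum.elim ξ Option.isNone)) (Sum.inr (Sum.inl x)) = ξ x) ∧
      (∀ i, g (Sum.elim a (Sum.elim ξ Option.isNone)) (Sum.inr (Sum.inr (some i))) =
        a (C.out (Sum.inl i))) ∧
      g (Sum.elim a (Sum.elim ξ Option.isNone)) (Sum.inr (Sum.inr none)) =
        !a (C.out (Sum.inl j)) := by
    intro a ξ
    refine ⟨fun w => ?_, fun x => ?_, fun i => ?_, ?_⟩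
    · rw [hgo _ _ (by simp [t])]
      rfl
    · rw [hgo _ _ (by simp [t])]
      rfl
    · have := hgt (Sum.elim a (Sum.elim ξ Option.isNone)) (some i)
      simpa [t, c] using this
    · have := hgt (Sum.elim a (Sum.elim ξ Option.isNone)) none
      simpa [t, c] using this
  refine (sandwich_kernel C (X ⊕ Option M) inp out pre post hpre hpost (hpad a ξ) (hpad a' ξ')
    (p := y) (p' := y') (Q := Q) ?_).trans (by congr)
  intro s s'
  obtain ⟨g1, g2, g3, g4⟩ := hg s ξ
  obtain ⟨g1', g2', g3', g4'⟩ := hg s' ξ'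
  generalize g (Sum.elim s (Sum.elim ξ Option.isNone)) = w at g1 g2 g3 g4
  generalize g (Sum.elim s' (Sum.elim ξ' Option.isNone)) = w' at g1' g2' g3' g4'
  rw [hQ]
  constructor
  · rintro ⟨h1, h2, h3⟩
    have k1 : ∀ i, s (C.out i) = y i := fun i => (g1 _).symm.trans (h1 (Sum.inr (Sum.inl i)))
    have k1' : ∀ i, s' (C.out i) = y' i := fun i => (g1' _).symm.trans (h2 (Sum.inr (Sum.inl i)))
    have k2 : ∀ i, s (C.out (Sum.inl i)) = s' (C.out (Sum.inl i)) := by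
      intro i
      rw [← g3, ← g3']
      -- The copy of bit `j` is an output wire, and agreement follows because `b₀` is the same on
      -- both sides of the kernel. The other copies are traced out and agree for that reason.
      by_cases hij : i = j
      · rw [hij]
        exact (h1 (Sum.inl (Sum.inl (0, ())))).trans (h2 (Sum.inl (Sum.inl (0, ())))).symm
      · apply h3
        rintro ⟨((i | i) | i | x), hx⟩ <;> change out _ = _ at hx <;>
          simp [o1, o2, o3, o4] at hx
        exact hij hx.symm
    refine ⟨⟨?_, ?_, fun i => ?_, ?_, ?_⟩, k1, k1', fun x hx => ?_⟩
    · ext x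
      exact (g2 x).symm.trans (h1 (Sum.inr (Sum.inr x)))
    · ext x
      exact (g2' x).symm.trans (h2 (Sum.inr (Sum.inr x)))
    · rw [← k1, ← k1', k2]
    · ext i
      rw [← k1, ← g3]
      exact (h1 (Sum.inl (Sum.inl i))).symm
    · ext i
      rw [← k1, ← g4]
      exact (h1 (Sum.inl (Sum.inr i))).symm
    · rw [← g1, ← g1']
      apply h3
      rintro ⟨((i | i) | i | x), hx'⟩ <;> change out _ = _ at hx' <;>
        simp [o1, o2, o3, o4] at hx'
      exact hx ⟨_, hx'⟩
  · rintro ⟨⟨rfl, rfl, h3, rfl, rfl⟩, k1, k2, k3⟩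
    have k4 : ∀ i, s (C.out (Sum.inl i)) = s' (C.out (Sum.inl i)) := by
      intro i
      rw [k1, k2, h3]
    refine ⟨?_, ?_, ?_⟩
    · rintro ((i | i) | i | x)
      · exact (g3 j).trans (k1 _)
      · exact g4.trans (congrArg _ (k1 _))
      · exact (g1 _).trans (k1 i)
      · exact g2 x
    · rintro ((i | i) | i | x)
      · exact (g3' j).trans ((k2 _).trans (h3 j).symm)
      · exact g4'.trans (congrArg _ ((k2 _).trans (h3 j).symm))
      · exact (g1' _).trans (k2 i)
      · exact g2' x
    · rintro (x | x | (_ | i)) hx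
      · rw [g1, g1']
        by_cases hx' : x ∈ Set.range C.out
        · obtain ⟨i, rfl⟩ := hx'
          exact absurd ⟨Sum.inr (Sum.inl i), rfl⟩ hx
        · exact k3 x hx'
      · exact absurd ⟨Sum.inr (Sum.inr x), rfl⟩ hx
      · exact absurd ⟨Sum.inl (Sum.inr (0, ())), rfl⟩ hx
      · rw [g3, g3', k4]

end Circuit

namespace Circuit

/-- Hardwire the classical input of a circuit; for all `s ≠ s₀` select the `s`-th part of the quantum
input from two registers according to the bit `c s` of a string `M`. -/
theorem exists_select_circuit {L S T D M A B : Type} [Fintype S] [DecidableEq S] [Fintype T]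
    [DecidableEq T] [Fintype M] [DecidableEq M]
    (C : Circuit (L ⊕ (A ⊕ (S × T))) (Empty ⊕ ((S × D) ⊕ B))) (h : L → Bool) (s₀ : S) (c : S → M) :
    ∃ C' : Circuit (Empty ⊕ (((M ⊕ A) ⊕ ({s // s ≠ s₀} × Bool × T)) ⊕ T))
        (Empty ⊕ (D ⊕ (M ⊕ (({s // s ≠ s₀} × D) ⊕ B)))),
      C'.size ≤ 2 * C.size + 2 * Fintype.card M + 23 * (Fintype.card S * Fintype.card T) ∧
      ∀ (e e' : Empty → Bool) (μ μ' ν ν' : M → Bool) (a a' : A → Bool)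
        (ξ ξ' : {s // s ≠ s₀} × Bool × T → Bool) (χ χ' : T → Bool) (d d' : D → Bool)
        (δ δ' : {s // s ≠ s₀} × D → Bool) (b b' : B → Bool)
        (q q' : S × T → Bool) (r r' : S × D → Bool) (Q : Prop) [Decidable Q],
        (∀ t, q (s₀, t) = χ t) → (∀ t, q' (s₀, t) = χ' t) →
        (∀ (s : {s // s ≠ s₀}) t, q (s, t) = ξ (s, μ (c s), t)) →
        (∀ (s : {s // s ≠ s₀}) t, q' (s, t) = ξ' (s, μ' (c s), t)) →
        (∀ t, r (s₀, t) = d t) → (∀ t, r' (s₀, t) = d' t) →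
        (∀ (s : {s // s ≠ s₀}) t, r (s, t) = δ (s, t)) →
        (∀ (s : {s // s ≠ s₀}) t, r' (s, t) = δ' (s, t)) →
        (Q ↔ μ = ν ∧ μ' = ν' ∧
          ∀ (s : {s // s ≠ s₀}) t, ξ (s, !μ (c s), t) = ξ' (s, !μ' (c s), t)) →
        C'.kernel (Sum.elim e (Sum.elim (Sum.elim (Sum.elim μ a) ξ) χ))
            (Sum.elim e (Sum.elim (Sum.elim (Sum.elim μ' a') ξ') χ'))
            (Sum.elim e' (Sum.elim d (Sum.elim ν (Sum.elim δ b))))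
            (Sum.elim e' (Sum.elim d' (Sum.elim ν' (Sum.elim δ' b')))) =
          if Q then C.kernel (Sum.elim h (Sum.elim a q)) (Sum.elim h (Sum.elim a' q'))
            (Sum.elim e' (Sum.elim r b)) (Sum.elim e' (Sum.elim r' b')) else 0 := by
  classical
  -- For each `s ≠ s₀` the candidate `false` is placed directly on the input wires of `C` and the
  -- candidate `true` on ancillas. The swap controlled by the bit `c s` brings the selected one to
  -- `C` and leaves the other on the ancillas, where it is traced out.
  let inp : Empty ⊕ (((M ⊕ A) ⊕ ({s // s ≠ s₀} × Bool × T)) ⊕ T) ↪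
      C.W ⊕ (M ⊕ {s // s ≠ s₀} × T) :=
    ⟨fun i => match i with
      | Sum.inr (Sum.inl (Sum.inl (Sum.inl m))) => Sum.inr (Sum.inl m)
      | Sum.inr (Sum.inl (Sum.inl (Sum.inr a))) => Sum.inl (C.inp (Sum.inr (Sum.inl a)))
      | Sum.inr (Sum.inl (Sum.inr (s, false, t))) => Sum.inl (C.inp (Sum.inr (Sum.inr (s, t))))
      | Sum.inr (Sum.inl (Sum.inr (s, true, t))) => Sum.inr (Sum.inr (s, t))
      | Sum.inr (Sum.inr t) => Sum.inl (C.inp (Sum.inr (Sum.inr (s₀, t)))), by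
      rintro (⟨⟨⟩⟩ | ((m | a) | ⟨⟨s, hs⟩, (_ | _), t⟩) | t)
        (⟨⟨⟩⟩ | ((m' | a') | ⟨⟨s', hs'⟩, (_ | _), t'⟩) | t') h <;> simp_all
      exact absurd h.1.symm hs'⟩
  have i1 : ∀ m, inp (Sum.inr (Sum.inl (Sum.inl (Sum.inl m)))) = Sum.inr (Sum.inl m) :=
    fun _ => rfl
  have i2 : ∀ a, inp (Sum.inr (Sum.inl (Sum.inl (Sum.inr a)))) =
    Sum.inl (C.inp (Sum.inr (Sum.inl a))) := fun _ => rfl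
  have i3 : ∀ s t, inp (Sum.inr (Sum.inl (Sum.inr (s, false, t)))) =
    Sum.inl (C.inp (Sum.inr (Sum.inr (s.1, t)))) := fun _ _ => rfl
  have i4 : ∀ s t, inp (Sum.inr (Sum.inl (Sum.inr (s, true, t)))) = Sum.inr (Sum.inr (s, t)) :=
    fun _ _ => rfl
  have i5 : ∀ t, inp (Sum.inr (Sum.inr t)) = Sum.inl (C.inp (Sum.inr (Sum.inr (s₀, t)))) :=
    fun _ => rfl
  let out : Empty ⊕ (D ⊕ (M ⊕ (({s // s ≠ s₀} × D) ⊕ B))) ↪ C.W ⊕ (M ⊕ {s // s ≠ s₀} × T) :=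
    ⟨fun i => match i with
      | Sum.inr (Sum.inl d) => Sum.inl (C.out (Sum.inr (Sum.inl (s₀, d))))
      | Sum.inr (Sum.inr (Sum.inl m)) => Sum.inr (Sum.inl m)
      | Sum.inr (Sum.inr (Sum.inr (Sum.inl (s, d)))) => Sum.inl (C.out (Sum.inr (Sum.inl (s, d))))
      | Sum.inr (Sum.inr (Sum.inr (Sum.inr b))) => Sum.inl (C.out (Sum.inr (Sum.inr b))), by
      rintro (⟨⟨⟩⟩ | d | m | ⟨⟨s, hs⟩, d⟩ | b) (⟨⟨⟩⟩ | d' | m' | ⟨⟨s', hs'⟩, d'⟩ | b') h <;>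
        simp_all
      exact absurd h.1.symm hs'⟩
  have o1 : ∀ d, out (Sum.inr (Sum.inl d)) = Sum.inl (C.out (Sum.inr (Sum.inl (s₀, d)))) :=
    fun _ => rfl
  have o2 : ∀ m, out (Sum.inr (Sum.inr (Sum.inl m))) = Sum.inr (Sum.inl m) := fun _ => rfl
  have o3 : ∀ s d, out (Sum.inr (Sum.inr (Sum.inr (Sum.inl (s, d))))) =
    Sum.inl (C.out (Sum.inr (Sum.inl (s.1, d)))) := fun _ _ => rfl
  have o4 : ∀ b, out (Sum.inr (Sum.inr (Sum.inr (Sum.inr b)))) =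
    Sum.inl (C.out (Sum.inr (Sum.inr b))) := fun _ => rfl
  let mask : C.W ⊕ (M ⊕ {s // s ≠ s₀} × T) → Bool := fun w => match w with
    | Sum.inl w => decide (∃ l, C.inp (Sum.inl l) = w ∧ h l = true)
    | Sum.inr _ => false
  have m1 : ∀ l, mask (Sum.inl (C.inp (Sum.inl l))) = h l := by
    intro l
    simp [mask]
  have m2 : ∀ i, mask (Sum.inl (C.inp (Sum.inr i))) = false := by
    intro i
    simp [mask]
  have m3 : ∀ w, w ∉ Set.range C.inp → mask (Sum.inl w) = false := by
    intro w hw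
    simp only [mask, decide_eq_false_iff_not]
    rintro ⟨l, rfl, -⟩
    exact hw ⟨_, rfl⟩
  have m4 : ∀ w, mask (Sum.inr w) = false := fun _ => rfl
  obtain ⟨pre₁, hpre₁l, hpre₁⟩ := exists_not_gates mask
  obtain ⟨pre₂, f, hpre₂l, hpre₂, hfa, hfb, hfo⟩ :=
    exists_cswap_gates (W := C.W ⊕ (M ⊕ {s // s ≠ s₀} × T)) (J := {s // s ≠ s₀} × T)
    (fun p => Sum.inr (Sum.inl (c p.1.1)))
    (fun p => Sum.inl (C.inp (Sum.inr (Sum.inr (p.1.1, p.2))))) (fun p => Sum.inr (Sum.inr p))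
    (by
      rintro ⟨⟨s, hs⟩, t⟩ ⟨⟨s', hs'⟩, t'⟩ h
      simpa using h)
    (fun p p' h => by simpa using h) (by simp) (by simp) (by simp)
  have hpre : gatesOp (pre₁ ++ pre₂) = funOp (f ∘ fun v w => xor (v w) (mask w)) := by
    rw [gatesOp_append, hpre₁, hpre₂, funOp_mul]
  refine ⟨C.sandwich _ inp out (pre₁ ++ pre₂) [], ?_, ?_⟩
  -- Each qubit to be selected costs 21 gates for the swap, one ancilla, and at most one negation on
  -- that ancilla; hence the constant 23.
  · rw [sandwich_size]
    have e0 : Fintype.card {s // s ≠ s₀} ≤ Fintype.card S := Fintype.card_subtype_le _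
    have e1 : Fintype.card (C.W ⊕ (M ⊕ {s // s ≠ s₀} × T)) =
        Fintype.card C.W + (Fintype.card M + Fintype.card ({s // s ≠ s₀} × T)) := by
      rw [Fintype.card_sum, Fintype.card_sum]
    have e2 : Fintype.card (M ⊕ {s // s ≠ s₀} × T) =
        Fintype.card M + Fintype.card ({s // s ≠ s₀} × T) := Fintype.card_sum
    have e3 : Fintype.card ({s // s ≠ s₀} × T) ≤ Fintype.card S * Fintype.card T := by
      rw [Fintype.card_prod]
      exact Nat.mul_le_mul_right _ e0
    have e4 : Fintype.card C.W ≤ C.size := by simp [size]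
    rw [List.length_append, List.length_nil]
    omega
  intro e e' μ μ' ν ν' a a' ξ ξ' χ χ' d d' δ δ' b b' q q' r r' Q _ hq₁ hq₁' hq₂ hq₂' hr₁ hr₁' hr₂
    hr₂' hQ
  have hpad : ∀ (μ : M → Bool) (a : A → Bool) (ξ : {s // s ≠ s₀} × Bool × T → Bool) (χ : T → Bool)
      (q : S × T → Bool), (∀ t, q (s₀, t) = χ t) →
      (∀ (s : {s // s ≠ s₀}) t, q (s, t) = ξ (s, μ (c s), t)) →
      (f ∘ fun v w => xor (v w) (mask w)) ((C.sandwich _ inp out (pre₁ ++ pre₂) []).pad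
          (Sum.elim e (Sum.elim (Sum.elim (Sum.elim μ a) ξ) χ))) =
        Sum.elim (C.pad (Sum.elim h (Sum.elim a q)))
          (Sum.elim μ fun p => ξ (p.1, !μ (c p.1), p.2)) := by
    intro μ a ξ χ q hq₁ hq₂
    have hp : ∀ i, (C.sandwich _ inp out (pre₁ ++ pre₂) []).pad
      (Sum.elim e (Sum.elim (Sum.elim (Sum.elim μ a) ξ) χ)) (inp i) =
        Sum.elim e (Sum.elim (Sum.elim (Sum.elim μ a) ξ) χ) i := fun i => pad_inp _ _ i
    have hn : ∀ x, x ∉ Set.range inp → (C.sandwich _ inp out (pre₁ ++ pre₂) []).pad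
        (Sum.elim e (Sum.elim (Sum.elim (Sum.elim μ a) ξ) χ)) x = false :=
      fun x hx => pad_of_notMem (C.sandwich _ inp out (pre₁ ++ pre₂) []) _ hx
    generalize (C.sandwich _ inp out (pre₁ ++ pre₂) []).pad
      (Sum.elim e (Sum.elim (Sum.elim (Sum.elim μ a) ξ) χ)) = v at hp hn
    change C.W ⊕ (M ⊕ {s // s ≠ s₀} × T) → Bool at v
    have p1 : ∀ m, v (Sum.inr (Sum.inl m)) = μ m :=
      fun m => hp (Sum.inr (Sum.inl (Sum.inl (Sum.inl m))))
    have p2 : ∀ i, v (Sum.inl (C.inp (Sum.inr (Sum.inl i)))) = a i :=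
      fun i => hp (Sum.inr (Sum.inl (Sum.inl (Sum.inr i))))
    have p3 : ∀ s t, v (Sum.inl (C.inp (Sum.inr (Sum.inr (s.1, t))))) = ξ (s, false, t) :=
      fun s t => hp (Sum.inr (Sum.inl (Sum.inr (s, false, t))))
    have p4 : ∀ s t, v (Sum.inr (Sum.inr (s, t))) = ξ (s, true, t) :=
      fun s t => hp (Sum.inr (Sum.inl (Sum.inr (s, true, t))))
    have p5 : ∀ t, v (Sum.inl (C.inp (Sum.inr (Sum.inr (s₀, t))))) = χ t :=
      fun t => hp (Sum.inr (Sum.inr t))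
    change f (fun w => xor (v w) (mask w)) = _
    ext (w | m | ⟨s, t⟩)
    · by_cases hw : w ∈ Set.range C.inp
      · obtain ⟨(l | i | ⟨s, t⟩), rfl⟩ := hw
        · rw [hfo _ _ (by simp) (by simp), Sum.elim_inl, pad_inp, Sum.elim_inl, m1, hn,
            Bool.false_xor]
          rintro ⟨(⟨⟨⟩⟩ | ((m | a) | ⟨⟨s, hs⟩, (_ | _), t⟩) | t), hl⟩ <;>
            simp [i1, i2, i3, i4, i5] at hl
        · rw [hfo _ _ (by simp) (by simp), Sum.elim_inl, pad_inp, m2, p2]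
          simp
        · by_cases hs : s = s₀
          · subst hs
            rw [hfo _ _ (by
                rintro ⟨⟨s', hs'⟩, t'⟩ h
                simp at h
                exact hs' h.1.symm) (by simp), Sum.elim_inl, pad_inp, m2, p5]
            simp [hq₁]
          · have := hfa (fun w => xor (v w) (mask w)) (⟨s, hs⟩, t)
            simp only [m4, m2, Bool.xor_false, p1, p4, p3 ⟨s, hs⟩] at this
            rw [this, Sum.elim_inl, pad_inp, Sum.elim_inr, Sum.elim_inr, hq₂ ⟨s, hs⟩]
            cases μ (c s) <;> simp
      · rw [hfo _ _ (by
            rintro p h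
            rw [Sum.inl.injEq] at h
            exact hw ⟨_, h.symm⟩) (by simp), Sum.elim_inl, pad_of_notMem C _ hw, m3 w hw, hn]
        · rfl
        · rintro ⟨(⟨⟨⟩⟩ | ((m | a) | ⟨⟨s, hs⟩, (_ | _), t⟩) | t), hl⟩ <;>
            simp [i1, i2, i3, i4, i5] at hl
          all_goals exact hw ⟨_, hl⟩
    · rw [hfo _ _ (by simp) (by simp), m4 (Sum.inl m), p1]
      simp
    · have := hfb (fun w => xor (v w) (mask w)) (s, t)
      simp only [m4, m2, Bool.xor_false, p1, p4, p3] at this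
      rw [this, Sum.elim_inr, Sum.elim_inr]
      cases μ (c s) <;> simp
  refine (sandwich_kernel C _ inp out (pre₁ ++ pre₂) [] hpre (g := id)
    (by rw [gatesOp_nil, funOp_id]) (hpad μ a ξ χ q hq₁ hq₂) (hpad μ' a' ξ' χ' q' hq₁' hq₂')
    (p := Sum.elim e' (Sum.elim r b)) (p' := Sum.elim e' (Sum.elim r' b')) (Q := Q) ?_).trans
    (by congr)
  intro s s'
  rw [hQ, id, id]
  constructor
  · rintro ⟨h1, h2, h3⟩
    refine ⟨⟨?_, ?_, fun s t => ?_⟩, ?_, ?_, fun x hx => ?_⟩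
    · ext m
      exact h1 (Sum.inr (Sum.inr (Sum.inl m)))
    · ext m
      exact h2 (Sum.inr (Sum.inr (Sum.inl m)))
    · refine h3 (Sum.inr (Sum.inr (s, t))) ?_
      rintro ⟨(⟨⟨⟩⟩ | d | m | ⟨s, d⟩ | b), hl⟩ <;> change out _ = _ at hl <;>
        simp [o1, o2, o3, o4] at hl
    · rintro (⟨⟨⟩⟩ | ⟨s, d⟩ | b)
      · by_cases hs : s = s₀
        · subst hs
          exact (h1 (Sum.inr (Sum.inl d))).trans (hr₁ d).symm
        · exact (h1 (Sum.inr (Sum.inr (Sum.inr (Sum.inl (⟨s, hs⟩, d)))))).trans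
            (hr₂ ⟨s, hs⟩ d).symm
      · exact h1 (Sum.inr (Sum.inr (Sum.inr (Sum.inr b))))
    · rintro (⟨⟨⟩⟩ | ⟨s, d⟩ | b)
      · by_cases hs : s = s₀
        · subst hs
          exact (h2 (Sum.inr (Sum.inl d))).trans (hr₁' d).symm
        · exact (h2 (Sum.inr (Sum.inr (Sum.inr (Sum.inl (⟨s, hs⟩, d)))))).trans
            (hr₂' ⟨s, hs⟩ d).symm
      · exact h2 (Sum.inr (Sum.inr (Sum.inr (Sum.inr b))))
    · refine h3 (Sum.inl x) ?_
      rintro ⟨(⟨⟨⟩⟩ | d | m | ⟨s, d⟩ | b), hl⟩ <;> change out _ = _ at hl <;>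
        simp [o1, o2, o3, o4] at hl
      all_goals exact hx ⟨_, hl⟩
  · rintro ⟨⟨rfl, rfl, h3⟩, k1, k2, k3⟩
    refine ⟨?_, ?_, ?_⟩
    · rintro (⟨⟨⟩⟩ | d | m | ⟨s, d⟩ | b)
      · exact (k1 _).trans (hr₁ d)
      · rfl
      · exact (k1 _).trans (hr₂ s d)
      · exact k1 _
    · rintro (⟨⟨⟩⟩ | d | m | ⟨s, d⟩ | b)
      · exact (k2 _).trans (hr₁' d)
      · rfl
      · exact (k2 _).trans (hr₂' s d)
      · exact k2 _
    · rintro (x | m | ⟨s, t⟩) hx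
      · refine k3 x ?_
        rintro ⟨(⟨⟨⟩⟩ | ⟨s, d⟩ | b), rfl⟩
        · by_cases hs : s = s₀
          · subst hs
            exact hx ⟨Sum.inr (Sum.inl d), rfl⟩
          · exact hx ⟨Sum.inr (Sum.inr (Sum.inr (Sum.inl (⟨s, hs⟩, d)))), rfl⟩
        · exact hx ⟨Sum.inr (Sum.inr (Sum.inr (Sum.inr b))), rfl⟩
      · exact absurd ⟨Sum.inr (Sum.inr (Sum.inl m)), rfl⟩ hx
      · exact h3 s t

end Circuit

/-! ## Effects and linearity of quantum algorithms -/

theorem trace_kronPi {J I : Type} [Fintype J] [DecidableEq J] [Fintype I] [DecidableEq I]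
    (A : J → QOp I I) : (kronPi A).trace = ∏ j, (A j).trace := by
  simp only [Matrix.trace, Matrix.diag_apply, kronPi, Matrix.of_apply]
  rw [Finset.prod_univ_sum]
  exact Finset.sum_equiv (Equiv.curry J I Bool) (by simp) fun w _ => rfl

theorem kronPi_mul {J O K I : Type} [Fintype J] [DecidableEq J] [Fintype K] [DecidableEq K]
    (A : J → QOp O K) (B : J → QOp K I) :
    kronPi A * kronPi B = kronPi fun j => A j * B j := by
  ext u v
  simp only [Matrix.mul_apply, kronPi, Matrix.of_apply]
  rw [Finset.prod_univ_sum]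
  refine Finset.sum_equiv (Equiv.curry J K Bool) (by simp) fun w _ => ?_
  rw [← Finset.prod_mul_distrib]
  rfl

theorem kronPi_conjTranspose {J O I : Type} [Fintype J] (A : J → QOp O I) :
    (kronPi A)ᴴ = kronPi fun j => (A j)ᴴ := by
  ext u v
  simp only [Matrix.conjTranspose_apply, kronPi, Matrix.of_apply, star_prod]

namespace QAlg

section basic

variable {X Y I O : Type} [Fintype I] [DecidableEq I] [Fintype O] [DecidableEq O]
  (A : QAlg X Y I O)

open Classical in
/-- The measurement operator of the classical output `y`. -/
def effect (x : X) (y : Y) : QOp I I :=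
  ∑ c, if A.out x c = y then (A.op x c)ᴴ * A.op x c else 0

theorem apply_eq (x : X) (y : Y) (ρ : QOp I I) {_ : ∀ c, Decidable (A.out x c = y)} :
    A.apply x y ρ = ∑ c, if A.out x c = y then A.op x c * ρ * (A.op x c)ᴴ else 0 := by
  unfold apply
  congr!

theorem effect_eq (x : X) (y : Y) {_ : ∀ c, Decidable (A.out x c = y)} :
    A.effect x y = ∑ c, if A.out x c = y then (A.op x c)ᴴ * A.op x c else 0 := by
  unfold effect
  congr!

/-- This passes to the Heisenberg picture. The certificates may be entangled with each other and
with the adversary's state, so the states do not factorise; the measurement operators of independent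
verifications do. -/
theorem trace_apply (x : X) (y : Y) (ρ : QOp I I) :
    (A.apply x y ρ).trace = (A.effect x y * ρ).trace := by
  classical
  simp only [apply, effect, Matrix.trace_sum, Finset.sum_mul]
  refine Finset.sum_congr rfl fun c _ => ?_
  split_ifs
  · rw [Matrix.trace_mul_cycle, Matrix.mul_assoc]
  · simp

theorem prob_eq (x : X) (y : Y) (ρ : QOp I I) :
    A.prob x y ρ = (A.effect x y * ρ).trace.re := by
  rw [prob, trace_apply]

theorem apply_add (x : X) (y : Y) (ρ σ : QOp I I) :
    A.apply x y (ρ + σ) = A.apply x y ρ + A.apply x y σ := by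
  simp only [apply, ← Finset.sum_add_distrib]
  refine Finset.sum_congr rfl fun c _ => ?_
  split_ifs
  · rw [Matrix.mul_add, Matrix.add_mul]
  · simp

theorem apply_smul (x : X) (y : Y) (z : ℂ) (ρ : QOp I I) :
    A.apply x y (z • ρ) = z • A.apply x y ρ := by
  simp only [apply, Finset.smul_sum]
  refine Finset.sum_congr rfl fun c _ => ?_
  split_ifs
  · rw [Matrix.mul_smul, Matrix.smul_mul]
  · simp

/-- `apply` as a linear map. -/
def applyₗ (x : X) (y : Y) : QOp I I →ₗ[ℂ] QOp O O where
  toFun := A.apply x y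
  map_add' := A.apply_add x y
  map_smul' := A.apply_smul x y

/-- `prob` as a real linear map. -/
def probₗ (x : X) (y : Y) : QOp I I →ₗ[ℝ] ℝ where
  toFun := A.prob x y
  map_add' ρ σ := by simp [prob, apply_add]
  map_smul' r ρ := by
    have : (r • ρ : QOp I I) = (r : ℂ) • ρ := by
      ext u v
      simp
    rw [this, prob, apply_smul, Matrix.trace_smul]
    simp [prob]

theorem prob_nonneg (x : X) (y : Y) : 0 ≤ A.prob x y 1 := by
  classical
  rw [prob, apply, Matrix.trace_sum, Complex.re_sum]
  refine Finset.sum_nonneg fun c _ => ?_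
  split_ifs
  · rw [Matrix.mul_one, Matrix.trace, Complex.re_sum]
    refine Finset.sum_nonneg fun o _ => ?_
    rw [Matrix.diag_apply, Matrix.mul_apply, Complex.re_sum]
    refine Finset.sum_nonneg fun i _ => ?_
    rw [Matrix.conjTranspose_apply, RCLike.star_def, Complex.mul_conj, Complex.ofReal_re]
    exact Complex.normSq_nonneg _
  · simp

theorem sum_effect [Fintype Y] (x : X) : ∑ y, A.effect x y = 1 := by
  classical
  simp only [effect]
  rw [Finset.sum_comm, ← A.complete x]
  exact Finset.sum_congr rfl fun c _ => by simp

theorem apply_wrap {X' Y' : Type} (f : X' → X) (g : X' → Y → Y') (x : X') (y' : Y') (y : Y)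
    (h : ∀ z, g x z = y' ↔ z = y) (ρ : QOp I I) :
    (A.wrap f g).apply x y' ρ = A.apply (f x) y ρ := by
  classical
  simp only [apply, wrap]
  exact Finset.sum_congr rfl fun c _ => if_congr (h _) rfl rfl

theorem effect_wrap {X' Y' : Type} (f : X' → X) (g : X' → Y → Y') (x : X') (y' : Y') (y : Y)
    (h : ∀ z, g x z = y' ↔ z = y) :
    (A.wrap f g).effect x y' = A.effect (f x) y := by
  classical
  simp only [effect, wrap]
  exact Finset.sum_congr rfl fun c _ => if_congr (h _) rfl rfl

theorem wrap_apply_eq_zero {X' Y' : Type} (f : X' → X) (g : X' → Y → Y') (x : X') (y' : Y')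
    (h : ∀ z, g x z ≠ y') (ρ : QOp I I) : (A.wrap f g).apply x y' ρ = 0 := by
  classical
  simp only [apply, wrap]
  exact Finset.sum_eq_zero fun c _ => if_neg (h _)

theorem apply_sampled {S : Type} [Fintype S] [Nonempty S] (A : QAlg (X × S) Y I O) (x : X) (y : Y)
    (ρ : QOp I I) :
    A.sampled.apply x y ρ = (((Fintype.card S : ℝ)⁻¹ : ℝ) : ℂ) • ∑ s : S, A.apply (x, s) y ρ := by
  classical
  have hsq : ((Real.sqrt (Fintype.card S) : ℂ))⁻¹ * ((Real.sqrt (Fintype.card S) : ℂ))⁻¹ =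
      (((Fintype.card S : ℝ)⁻¹ : ℝ) : ℂ) := by
    rw [← mul_inv, ← Complex.ofReal_mul, Real.mul_self_sqrt (Nat.cast_nonneg _)]
    simp
  have h : A.sampled.apply x y ρ = ∑ c : Σ s : S, A.κ (x, s), if A.out (x, c.1) c.2 = y then
      (((Real.sqrt (Fintype.card S))⁻¹ : ℂ) • A.op (x, c.1) c.2) * ρ *
        (((Real.sqrt (Fintype.card S))⁻¹ : ℂ) • A.op (x, c.1) c.2)ᴴ else 0 :=
    A.sampled.apply_eq x y ρ
  rw [h, Fintype.sum_sigma, Finset.smul_sum]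
  simp only [apply]
  refine Finset.sum_congr rfl fun s _ => ?_
  rw [Finset.smul_sum]
  refine Finset.sum_congr rfl fun c _ => ?_
  split_ifs
  · rw [Matrix.conjTranspose_smul, Matrix.smul_mul, Matrix.smul_mul, Matrix.mul_smul, smul_smul,
      ← hsq]
    congr 2
    simp
  · simp

theorem apply_ret (f : X → Y) (x : X) (y : Y) [Decidable (f x = y)] :
    (ret f).apply x y 1 = if f x = y then 1 else 0 := by
  classical
  have : (ret f).apply x y 1 = ∑ _c : Unit, if f x = y then (1 : QOp Empty Empty) * 1 * 1ᴴ else 0 :=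
    (ret f).apply_eq x y 1
  rw [this]
  simp

theorem apply_parallel (J : Type) [Fintype J] [DecidableEq J] (x : J → X) (y : J → Y)
    (ρ : J → QOp I I) :
    (A.parallel J).apply x y (kronPi ρ) = kronPi fun j => A.apply (x j) (y j) (ρ j) := by
  classical
  have h : (A.parallel J).apply x y (kronPi ρ) = ∑ c : ∀ j, A.κ (x j),
      if (fun j => A.out (x j) (c j)) = y then
        kronPi (fun j => A.op (x j) (c j)) * kronPi ρ * (kronPi fun j => A.op (x j) (c j))ᴴ else 0 :=
    (A.parallel J).apply_eq _ _ _
  rw [h]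
  simp only [apply]
  rw [← kronPi_sum (fun j (c : A.κ (x j)) =>
    if A.out (x j) c = y j then A.op (x j) c * ρ j * (A.op (x j) c)ᴴ else 0)]
  refine Finset.sum_congr rfl fun c _ => ?_
  rw [kronPi_conjTranspose, kronPi_mul, kronPi_mul]
  ext u v
  by_cases hc : (fun j => A.out (x j) (c j)) = y
  · rw [if_pos hc]
    have : ∀ j, A.out (x j) (c j) = y j := congrFun hc
    simp only [this, if_true]
  · rw [if_neg hc]
    have : ∃ j, A.out (x j) (c j) ≠ y j := by
      by_contra h
      push Not at h
      exact hc (funext h)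
    obtain ⟨j, hj⟩ := this
    simp only [kronPi, Matrix.of_apply, Matrix.zero_apply]
    symm
    apply Finset.prod_eq_zero (Finset.mem_univ j)
    rw [if_neg hj]
    rfl

theorem effect_parallel (J : Type) [Fintype J] [DecidableEq J] (x : J → X) (y : J → Y) :
    (A.parallel J).effect x y = kronPi fun j => A.effect (x j) (y j) := by
  classical
  have h : (A.parallel J).effect x y = ∑ c : ∀ j, A.κ (x j),
      if (fun j => A.out (x j) (c j)) = y then
        (kronPi fun j => A.op (x j) (c j))ᴴ * kronPi (fun j => A.op (x j) (c j)) else 0 :=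
    (A.parallel J).effect_eq _ _
  rw [h]
  simp only [effect]
  rw [← kronPi_sum (fun j (c : A.κ (x j)) =>
    if A.out (x j) c = y j then (A.op (x j) c)ᴴ * A.op (x j) c else 0)]
  refine Finset.sum_congr rfl fun c _ => ?_
  rw [kronPi_conjTranspose, kronPi_mul]
  ext u v
  by_cases hc : (fun j => A.out (x j) (c j)) = y
  · rw [if_pos hc]
    have : ∀ j, A.out (x j) (c j) = y j := congrFun hc
    simp only [this, if_true]
  · rw [if_neg hc]
    have : ∃ j, A.out (x j) (c j) ≠ y j := by
      by_contra h
      push Not at h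
      exact hc (funext h)
    obtain ⟨j, hj⟩ := this
    simp only [kronPi, Matrix.of_apply, Matrix.zero_apply]
    symm
    apply Finset.prod_eq_zero (Finset.mem_univ j)
    rw [if_neg hj]
    rfl

theorem submatrix_mul_bits {O K K' I : Type} {O' I' : Type} [Fintype K] [DecidableEq K]
    [Fintype K'] [DecidableEq K'] (e : K ≃ K') (M : QOp O K) (N : QOp K I)
    (f : (O' → Bool) → (O → Bool)) (g : (I' → Bool) → (I → Bool)) :
    M.submatrix f (fun v : K' → Bool => v ∘ e) * N.submatrix (fun v : K' → Bool => v ∘ e) g =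
      (M * N).submatrix f g :=
  Matrix.submatrix_mul_equiv _ _ _ (Equiv.arrowCongr e.symm (Equiv.refl Bool)) _

theorem apply_reindex {I' O' : Type} [Fintype I'] [DecidableEq I'] [Fintype O'] [DecidableEq O']
    (eI : I ≃ I') (eO : O ≃ O') (x : X) (y : Y) (ρ : QOp I' I') :
    (A.reindex eI eO).apply x y ρ = (A.apply x y (ρ.submatrix (fun v => v ∘ eI.symm)
      (fun v => v ∘ eI.symm))).submatrix (fun v => v ∘ eO) (fun v => v ∘ eO) := by
  classical
  have h : (A.reindex eI eO).apply x y ρ = ∑ c : A.κ x, if A.out x c = y then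
      (A.op x c).submatrix (fun u => u ∘ eO) (fun v => v ∘ eI) * ρ *
        ((A.op x c).submatrix (fun u => u ∘ eO) (fun v => v ∘ eI))ᴴ else 0 :=
    (A.reindex eI eO).apply_eq _ _ _
  have hρ : ρ = (ρ.submatrix (fun v : I → Bool => v ∘ eI.symm) (fun v : I → Bool => v ∘ eI.symm)).submatrix
      (fun v : I' → Bool => v ∘ eI) (fun v : I' → Bool => v ∘ eI) := by
    ext u v
    simp [Function.comp_assoc]
  rw [h, apply]
  ext u v
  simp only [Matrix.submatrix_apply, Matrix.sum_apply]
  refine Finset.sum_congr rfl fun c _ => ?_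
  split_ifs
  · conv_lhs => rw [hρ]
    rw [Matrix.conjTranspose_submatrix, submatrix_mul_bits, submatrix_mul_bits]
    rfl
  · rfl

theorem effect_reindex {I' O' : Type} [Fintype I'] [DecidableEq I'] [Fintype O'] [DecidableEq O']
    (eI : I ≃ I') (eO : O ≃ O') (x : X) (y : Y) :
    (A.reindex eI eO).effect x y =
      (A.effect x y).submatrix (fun v => v ∘ eI) (fun v => v ∘ eI) := by
  classical
  have h : (A.reindex eI eO).effect x y = ∑ c : A.κ x, if A.out x c = y then
      ((A.op x c).submatrix (fun u => u ∘ eO) (fun v => v ∘ eI))ᴴ *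
        (A.op x c).submatrix (fun u => u ∘ eO) (fun v => v ∘ eI) else 0 :=
    (A.reindex eI eO).effect_eq _ _
  rw [h, effect]
  ext u v
  simp only [Matrix.submatrix_apply, Matrix.sum_apply]
  refine Finset.sum_congr rfl fun c _ => ?_
  split_ifs
  · rw [Matrix.conjTranspose_submatrix, submatrix_mul_bits]
    rfl
  · rfl

end basic

/-- Success requires acceptance, and then the second adversary measures a register that the verifier
does not touch. The tensor product form allows factors to be moved from the verifier to the second
adversary. -/
theorem effect_certify {VK SK D S : Type} [Fintype D] [DecidableEq D] [Fintype S] [DecidableEq S]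
    (V : QAlg VK Bool D Empty) (G : QAlg (Option SK) Bool S Empty) (vk : VK) (sk : SK) (b : Bool) :
    (V.certify G).effect (vk, sk) (some b) = kron2 (V.effect vk true) (G.effect (some sk) b) := by
  classical
  have h : (V.certify G).effect (vk, sk) (some b) =
      ∑ c : Σ c : V.κ vk, G.κ (if V.out vk c then some sk else none),
        if (if V.out vk c.1 then some (G.out _ c.2) else none) = some b then
          (kron2 (V.op vk c.1) (G.op _ c.2))ᴴ * kron2 (V.op vk c.1) (G.op _ c.2) else 0 :=
    (V.certify G).effect_eq _ _
  rw [h, Fintype.sum_sigma]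
  have h2 : kron2 (V.effect vk true) (G.effect (some sk) b) =
      ∑ c, if V.out vk c = true then
        kron2 ((V.op vk c)ᴴ * V.op vk c) (G.effect (some sk) b) else 0 := by
    rw [effect, ← kron2_sum_left]
    refine Finset.sum_congr rfl fun c _ => ?_
    split_ifs
    · rfl
    · ext u v
      simp [kron2]
  rw [h2]
  refine Finset.sum_congr rfl fun c _ => ?_
  by_cases hc : V.out vk c = true
  · refine Eq.trans ?_ (if_pos hc).symm
    -- The type of branches of `G` depends on the verifier's result, so the input of `G` is
    -- generalised before it is replaced by `some sk`.
    have key : ∀ o : Option SK, o = some sk →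
        (∑ y : G.κ o, if (if V.out vk c = true then some (G.out o y) else none) = some b then
          (kron2 (V.op vk c) (G.op o y))ᴴ * kron2 (V.op vk c) (G.op o y) else 0) =
        kron2 ((V.op vk c)ᴴ * V.op vk c) (G.effect (some sk) b) := by
      rintro _ rfl
      rw [effect, ← kron2_sum_right]
      refine Finset.sum_congr rfl fun y _ => ?_
      rw [if_pos hc]
      by_cases hy : G.out (some sk) y = b
      · rw [if_pos (congrArg some hy), if_pos hy, kron2_complete]
      · rw [if_neg (by simpa using hy), if_neg hy]
        ext u v
        simp [kron2]
    exact key _ (if_pos hc)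
  · refine Eq.trans ?_ (if_neg hc).symm
    refine Finset.sum_eq_zero fun y _ => ?_
    simp [hc]

/-- Verify all certificates of a family. -/
def verifyAll {VK D : Type} [Fintype D] [DecidableEq D] (J : Type) [Fintype J] [DecidableEq J]
    (V : QAlg VK Bool D Empty) : QAlg (J → VK) Bool (J × D) Empty :=
  ((V.parallel J).reindex (Equiv.refl _) (Equiv.equivOfIsEmpty _ _)).wrap
    (fun vk => vk) (fun _ y => decide (∀ j, y j = true))

theorem effect_verifyAll {VK D : Type} [Fintype D] [DecidableEq D] (J : Type) [Fintype J]
    [DecidableEq J] (V : QAlg VK Bool D Empty) (vk : J → VK) :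
    (verifyAll J V).effect vk true = kronPi fun j => V.effect (vk j) true := by
  rw [verifyAll, effect_wrap _ _ _ _ _ (fun _ => true) (fun z => by simp [funext_iff]),
    effect_reindex, effect_parallel]
  rfl

/-- Measure the register `M` in the computational basis and run an algorithm that depends on the
result. -/
def controlled {X Y M I O : Type} [Fintype M] [DecidableEq M] [Fintype I] [DecidableEq I]
    [Fintype O] [DecidableEq O] (A : (M → Bool) → QAlg X Y I O) : QAlg X Y (M ⊕ I) O where
  κ x := Σ μ, (A μ).κ x
  op x c := Matrix.of fun o v =>
    if (fun i => v (Sum.inl i)) = c.1 then (A c.1).op x c.2 o fun i => v (Sum.inr i) else 0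
  out x c := (A c.1).out x c.2
  complete x := by
    ext v v'
    rw [Fintype.sum_sigma, Matrix.sum_apply]
    rw [Finset.sum_eq_single (fun i => v (Sum.inl i))]
    · have h := congrFun (congrFun ((A (fun i => v (Sum.inl i))).complete x) fun i => v (Sum.inr i))
        fun i => v' (Sum.inr i)
      simp only [Matrix.sum_apply, Matrix.mul_apply, Matrix.conjTranspose_apply, Matrix.of_apply,
        if_true] at h ⊢
      by_cases hv : (fun i => v' (Sum.inl i)) = fun i => v (Sum.inl i)
      · simp only [hv, if_true]
        rw [h, Matrix.one_apply, Matrix.one_apply]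
        refine if_congr ⟨fun h' => ?_, ?_⟩ rfl rfl
        · ext (i | i)
          · exact (congrFun hv i).symm
          · exact congrFun h' i
        · rintro rfl
          rfl
      · simp only [hv, if_false, mul_zero, Finset.sum_const_zero]
        rw [Matrix.one_apply, if_neg]
        rintro rfl
        exact hv rfl
    · intro μ _ hμ
      simp [Matrix.sum_apply, Matrix.mul_apply, hμ.symm]
    · simp

/-- Only the blocks that are diagonal in `M` are needed, because the register that will be measured
holds a classical plaintext. -/
theorem effect_controlled {X Y M I O : Type} [Fintype M] [DecidableEq M] [Fintype I]
    [DecidableEq I] [Fintype O] [DecidableEq O] (A : (M → Bool) → QAlg X Y I O) (x : X) (y : Y)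
    (μ : M → Bool) (v v' : I → Bool) :
    (controlled A).effect x y (Sum.elim μ v) (Sum.elim μ v') = (A μ).effect x y v v' := by
  classical
  have h : (controlled A).effect x y = ∑ c : Σ μ, (A μ).κ x, if (A c.1).out x c.2 = y then
      (Matrix.of fun o v => if (fun i => v (Sum.inl i)) = c.1 then
        (A c.1).op x c.2 o fun i => v (Sum.inr i) else 0 : QOp O (M ⊕ I))ᴴ *
      (Matrix.of fun o v => if (fun i => v (Sum.inl i)) = c.1 then
        (A c.1).op x c.2 o fun i => v (Sum.inr i) else 0 : QOp O (M ⊕ I)) else 0 :=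
    (controlled A).effect_eq _ _
  rw [h, Fintype.sum_sigma, Matrix.sum_apply, Finset.sum_eq_single μ _ (by simp)]
  · rw [effect, Matrix.sum_apply, Matrix.sum_apply]
    refine Finset.sum_congr rfl fun c _ => ?_
    simp only
    split_ifs
    · simp [Matrix.mul_apply]
    · rfl
  · intro μ' _ hμ'
    rw [Matrix.sum_apply]
    refine Finset.sum_eq_zero fun c _ => ?_
    split_ifs
    · simp [Matrix.mul_apply, hμ'.symm]
    · rfl

/-- The output states of an algorithm without quantum input form an ensemble of pure states. -/
theorem exists_ensemble {X Y O : Type} [Fintype O] [DecidableEq O] (A : QAlg X Y Empty O) (x : X) :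
    ∃ (w : A.κ x → ℝ) (ψ : A.κ x → (O → Bool) → ℂ), (∀ c, 0 ≤ w c) ∧ ∑ c, w c = 1 ∧
      (∀ c, ∑ v, ‖ψ c v‖ ^ 2 = 1) ∧
      ∀ c, A.op x c * (1 : QOp Empty Empty) * (A.op x c)ᴴ = (w c : ℂ) • pureState (ψ c) := by
  classical
  let e : Empty → Bool := Empty.elim
  let w : A.κ x → ℝ := fun c => ∑ v, ‖A.op x c v e‖ ^ 2
  have hw : ∀ c, 0 ≤ w c := fun c => Finset.sum_nonneg fun v _ => by positivity
  have hψ : ∀ c, ∃ ψ : (O → Bool) → ℂ, ∑ v, ‖ψ v‖ ^ 2 = 1 ∧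
      A.op x c * (1 : QOp Empty Empty) * (A.op x c)ᴴ = (w c : ℂ) • pureState ψ := by
    intro c
    -- The empty register has a single basis state, so a Kraus operator is a single column and the
    -- state of a branch has rank at most one.
    have hop : ∀ u v, (A.op x c * (1 : QOp Empty Empty) * (A.op x c)ᴴ) u v = A.op x c u e * star (A.op x c v e) := by
      intro u v
      rw [Matrix.mul_one, Matrix.mul_apply, Fintype.sum_eq_single e]
      · rfl
      · intro e' he'
        exact absurd (Subsingleton.elim _ _) he'
    -- In a branch of weight zero the column vanishes and cannot be normalised; any unit vector will
    -- do.
    by_cases h0 : w c = 0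
    · refine ⟨fun v => if v = fun _ => false then 1 else 0, ?_, ?_⟩
      · rw [Finset.sum_eq_single (fun _ => false)] <;> simp
      · have : ∀ v, A.op x c v e = 0 := by
          intro v
          have := (Finset.sum_eq_zero_iff_of_nonneg (fun v _ => by positivity)).1 h0 v
            (Finset.mem_univ v)
          simpa using this
        ext u v
        rw [hop, this, h0]
        simp
    · have hpos : 0 < w c := lt_of_le_of_ne (hw c) (Ne.symm h0)
      have hs : (0 : ℝ) < Real.sqrt (w c) := Real.sqrt_pos.2 hpos
      refine ⟨fun v => ((Real.sqrt (w c))⁻¹ : ℝ) * A.op x c v e, ?_, ?_⟩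
      · simp only [norm_mul, mul_pow, ← Finset.mul_sum, Complex.norm_real, norm_inv,
          Real.norm_eq_abs, abs_of_pos hs, inv_pow, Real.sq_sqrt (hw c)]
        exact inv_mul_cancel₀ h0
      · ext u v
        rw [hop]
        simp only [pureState, Matrix.smul_apply, Matrix.of_apply, smul_eq_mul, star_mul',
          RCLike.star_def, Complex.conj_ofReal]
        have : (w c : ℂ) * (((Real.sqrt (w c))⁻¹ : ℝ) * ((Real.sqrt (w c))⁻¹ : ℝ) : ℂ) = 1 := by
          rw [← Complex.ofReal_mul, ← Complex.ofReal_mul, ← mul_inv, Real.mul_self_sqrt (hw c),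
            mul_inv_cancel₀ h0, Complex.ofReal_one]
        linear_combination (-(A.op x c u e * (starRingEnd ℂ) (A.op x c v e))) * this
  choose ψ hψ1 hψ2 using hψ
  refine ⟨w, ψ, hw, ?_, hψ1, hψ2⟩
  have h := congrFun (congrFun (A.complete x) e) e
  simp only [Matrix.sum_apply, Matrix.mul_apply, Matrix.conjTranspose_apply, Matrix.one_apply,
    if_true, RCLike.star_def, Complex.conj_mul'] at h
  exact_mod_cast h

end QAlg

/-! ## Adversaries for one security parameter -/

theorem bitEnc_bits_surjective (m : ℕ) :
    Function.Surjective (BitEnc.enc : Bits m → BitEnc.Lbl (Bits m) → Bool) :=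
  fun f => ⟨fun i => f (i, ()), rfl⟩

theorem bitEnc_pair_surjective (m m' : ℕ) :
    Function.Surjective (BitEnc.enc : Bits m × Bits m' → BitEnc.Lbl (Bits m × Bits m') → Bool) := by
  intro f
  refine ⟨(fun i => f (Sum.inl (i, ())), fun i => f (Sum.inr (i, ()))), ?_⟩
  ext (i | i) <;> rfl

theorem bitEnc_unit_surjective :
    Function.Surjective (BitEnc.enc : Unit → BitEnc.Lbl Unit → Bool) :=
  fun _ => ⟨(), funext fun e => (e : Empty).elim⟩

/-- The circuit that discards its input and outputs zeros. -/
def Circuit.zero (I O : Type) [Fintype I] [DecidableEq I] [Fintype O] [DecidableEq O] :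
    Circuit I O where
  W := I ⊕ O
  inp := Function.Embedding.inl
  out := Function.Embedding.inr
  gates := []

theorem Circuit.zero_size (I O : Type) [Fintype I] [DecidableEq I] [Fintype O] [DecidableEq O] :
    (Circuit.zero I O).size = Fintype.card I + Fintype.card O :=
  Fintype.card_sum

/-- An adversary in the certified everlasting IND-CPA experiment for one value of the security
parameter, whose first part is given by circuits. -/
structure LocalAdversary (pkLen skLen ctLen certLen : ℕ) where
  Advice : Type
  St : Type
  St' : Type
  [fintypeAdvice : Fintype Advice]
  [decEqAdvice : DecidableEq Advice]
  [fintypeSt : Fintype St]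
  [decEqSt : DecidableEq St]
  [fintypeSt' : Fintype St']
  [decEqSt' : DecidableEq St']
  advice : (Advice → Bool) → ℂ
  advice_norm : ∑ v, ‖advice v‖ ^ 2 = 1
  chooseCircuit : Circuit (BitEnc.Lbl (Bits pkLen) ⊕ Advice) (BitEnc.Lbl (Bits 1 × Bits 1) ⊕ St)
  deleteCircuit : Circuit (BitEnc.Lbl Unit ⊕ (St ⊕ Fin ctLen))
    (BitEnc.Lbl Unit ⊕ (Fin certLen ⊕ St'))
  guess : QAlg (Option (Bits skLen)) Bool St' Empty

attribute [instance] LocalAdversary.fintypeAdvice LocalAdversary.decEqAdvice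
  LocalAdversary.fintypeSt LocalAdversary.decEqSt LocalAdversary.fintypeSt' LocalAdversary.decEqSt'

namespace LocalAdversary

variable {pkLen skLen ctLen certLen vkLen : ℕ}

/-- The algorithm that chooses the plaintexts. -/
def choose (a : LocalAdversary pkLen skLen ctLen certLen) :
    QAlg (Bits pkLen) (Bits 1 × Bits 1) a.Advice a.St :=
  a.chooseCircuit.toQAlg (bitEnc_pair_surjective 1 1)

/-- The algorithm that produces the certificate. -/
def delete (a : LocalAdversary pkLen skLen ctLen certLen) :
    QAlg Unit Unit (a.St ⊕ Fin ctLen) (Fin certLen ⊕ a.St') :=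
  a.deleteCircuit.toQAlg bitEnc_unit_surjective

/-- The probability of success in the certified everlasting IND-CPA experiment. -/
def value (a : LocalAdversary pkLen skLen ctLen certLen)
    (K : QAlg Unit (Bits pkLen × Bits skLen) Empty Empty)
    (E : QAlg (Bits pkLen × Bits 1) (Bits vkLen) Empty (Fin ctLen))
    (V : QAlg (Bits vkLen) Bool (Fin certLen) Empty) (b : Bool) : ℝ :=
  ∑ pk, ∑ sk, ∑ m₀, ∑ m₁, ∑ vk,
    K.prob () (pk, sk) 1 * (V.certify a.guess).prob (vk, sk) (some true)
      (a.delete.apply () () (kron2 (a.choose.apply pk (m₀, m₁) (pureState a.advice))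
        (E.apply (pk, if b then m₁ else m₀) vk 1)))

/-- The adversary that does nothing. -/
def trivial (pkLen skLen ctLen certLen : ℕ) : LocalAdversary pkLen skLen ctLen certLen where
  Advice := Empty
  St := Empty
  St' := Empty
  advice _ := 1
  advice_norm := by simp
  chooseCircuit := Circuit.zero _ _
  deleteCircuit := Circuit.zero _ _
  guess := (QAlg.ret fun _ => false)

end LocalAdversary

/-- Input and output registers are embedded in the wires of a circuit, so the sizes of the circuits
for encryption and verification bound these lengths. -/
theorem PKE.IsQPT.exists_poly {m : ℕ → ℕ} {P : PKE m} (hP : P.IsQPT) :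
    ∃ p : Polynomial ℕ, ∀ k, P.pkLen k ≤ p.eval k ∧ P.ctLen k ≤ p.eval k ∧
      P.certLen k ≤ p.eval k := by
  obtain ⟨-, ⟨p, hp⟩, -, -, ⟨q, hq⟩⟩ := hP
  refine ⟨p + q, fun k => ?_⟩
  obtain ⟨C, hC, -⟩ := hp k
  obtain ⟨D, hD, -⟩ := hq k
  have h1 : Fintype.card (Fin (P.pkLen k) × Unit) ≤ C.size :=
    (Fintype.card_le_of_embedding (⟨fun i => C.inp (Sum.inl (Sum.inl i)), fun i j h =>
      Sum.inl_injective (Sum.inl_injective (C.inp.injective h))⟩ : Fin (P.pkLen k) × Unit ↪ C.W)).trans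
        (Nat.le_add_right _ _)
  have h2 : Fintype.card (Fin (P.ctLen k)) ≤ C.size :=
    (Fintype.card_le_of_embedding (⟨fun i => C.out (Sum.inr i), fun i j h => by
      simpa using h⟩ : Fin (P.ctLen k) ↪ C.W)).trans (Nat.le_add_right _ _)
  have h3 : Fintype.card (Fin (P.certLen k)) ≤ D.size :=
    (Fintype.card_le_of_embedding (⟨fun i => D.inp (Sum.inr i), fun i j h => by
      simpa using h⟩ : Fin (P.certLen k) ↪ D.W)).trans (Nat.le_add_right _ _)
  simp only [Fintype.card_prod, Fintype.card_fin, Fintype.card_unit, mul_one] at h1 h2 h3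
  simp only [Polynomial.eval_add]
  omega

/-- Certified everlasting IND-CPA security bounds the advantage of all adversaries of polynomial
size uniformly. -/
theorem PKE.CertEverINDCPA.uniform {P : PKE fun _ => 1} (hsec : P.CertEverINDCPA) (hP : P.IsQPT)
    (q : Polynomial ℕ) (c : ℕ) :
    ∃ k₀ : ℕ, ∀ k > k₀,
      ∀ a : LocalAdversary (P.pkLen k) (P.skLen k) (P.ctLen k) (P.certLen k),
        a.chooseCircuit.size ≤ q.eval k → a.deleteCircuit.size ≤ q.eval k →
          |a.value (P.keyGen k) (P.enc k) (P.vrfy k) false -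
            a.value (P.keyGen k) (P.enc k) (P.vrfy k) true| < ((k : ℝ) ^ c)⁻¹ := by
  classical
  obtain ⟨p, hp⟩ := hP.exists_poly
  let Bad (k : ℕ) (a : LocalAdversary (P.pkLen k) (P.skLen k) (P.ctLen k) (P.certLen k)) : Prop :=
    a.chooseCircuit.size ≤ q.eval k ∧ a.deleteCircuit.size ≤ q.eval k ∧
      ¬ |a.value (P.keyGen k) (P.enc k) (P.vrfy k) false -
        a.value (P.keyGen k) (P.enc k) (P.vrfy k) true| < ((k : ℝ) ^ c)⁻¹
  -- A non-uniform family may use an unrelated adversary for each `k`, so the counterexamples can be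
  -- collected into one adversary without any compatibility between them.
  let a (k : ℕ) : LocalAdversary (P.pkLen k) (P.skLen k) (P.ctLen k) (P.certLen k) :=
    if h : ∃ a, Bad k a then h.choose else LocalAdversary.trivial _ _ _ _
  -- The summand `q` covers the counterexamples. The rest covers the trivial adversary, whose
  -- circuits have `pkLen + 2` and `ctLen + certLen` wires and no gates.
  have hsize : ∀ k, (a k).chooseCircuit.size ≤ (q + p + p + 2).eval k ∧
      (a k).deleteCircuit.size ≤ (q + p + p + 2).eval k := by
    intro k
    simp only [Polynomial.eval_add, Polynomial.eval_ofNat]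
    by_cases h : ∃ a, Bad k a
    · have ha : a k = h.choose := dif_pos h
      have := h.choose_spec
      rw [ha]
      exact ⟨by have := this.1; omega, by have := this.2.1; omega⟩
    · have ha : a k = LocalAdversary.trivial _ _ _ _ := dif_neg h
      rw [ha]
      obtain ⟨h1, h2, h3⟩ := hp k
      refine ⟨(Circuit.zero_size _ _).trans_le ?_, (Circuit.zero_size _ _).trans_le ?_⟩
      · have e1 : Fintype.card (BitEnc.Lbl (Bits (P.pkLen k)) ⊕ Empty) = P.pkLen k := by
          refine (Fintype.card_sum (α := Fin (P.pkLen k) × Unit) (β := Empty)).trans ?_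
          simp
        have e2 : Fintype.card (BitEnc.Lbl (Bits 1 × Bits 1) ⊕ Empty) = 2 := by
          refine (Fintype.card_sum (α := (Fin 1 × Unit) ⊕ (Fin 1 × Unit)) (β := Empty)).trans ?_
          simp
        refine (add_le_add e1.le e2.le).trans ?_
        omega
      · have e1 : Fintype.card (BitEnc.Lbl Unit ⊕ (Empty ⊕ Fin (P.ctLen k))) = P.ctLen k := by
          refine (Fintype.card_sum (α := Empty) (β := Empty ⊕ Fin (P.ctLen k))).trans ?_
          simp
        have e2 : Fintype.card (BitEnc.Lbl Unit ⊕ (Fin (P.certLen k) ⊕ Empty)) = P.certLen k := by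
          refine (Fintype.card_sum (α := Empty) (β := Fin (P.certLen k) ⊕ Empty)).trans ?_
          simp
        refine (add_le_add e1.le e2.le).trans ?_
        omega
  let A : P.Adversary :=
    { Advice := fun k => (a k).Advice
      St := fun k => (a k).St
      St' := fun k => (a k).St'
      advice := fun k => (a k).advice
      advice_norm := fun k => (a k).advice_norm
      choose := fun k => (a k).choose
      delete := fun k => (a k).delete
      guess := fun k => (a k).guess }
  have hA : A.IsQPT :=
    ⟨⟨q + p + p + 2, fun k => ⟨(a k).chooseCircuit, (hsize k).1,
        Circuit.computes_toQAlg _ (bitEnc_pair_surjective 1 1)⟩⟩,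
      ⟨q + p + p + 2, fun k => ⟨(a k).deleteCircuit, (hsize k).2,
        Circuit.computes_toQAlg _ bitEnc_unit_surjective⟩⟩⟩
  obtain ⟨k₀, hk₀⟩ := hsec A hA c
  refine ⟨k₀, fun k hk a' h1 h2 => ?_⟩
  by_contra hbad
  have h : ∃ a, Bad k a := ⟨a', h1, h2, hbad⟩
  have ha : a k = h.choose := dif_pos h
  refine h.choose_spec.2.2 ?_
  rw [← ha]
  exact hk₀ k hk

/-! ## The circuits of the reduction on product states -/

/-- The family with value `a` at `s₀` and values `f` elsewhere. -/
def insertAt {S α : Type} [DecidableEq S] (s₀ : S) (a : α) (f : {s // s ≠ s₀} → α) : S → α :=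
  fun s => if h : s = s₀ then a else f ⟨s, h⟩

section insertAt

variable {S α : Type} [DecidableEq S] (s₀ : S) (a : α) (f : {s // s ≠ s₀} → α)

theorem insertAt_self : insertAt s₀ a f s₀ = a := dif_pos rfl

theorem insertAt_coe (s : {s // s ≠ s₀}) : insertAt s₀ a f s = f s := dif_neg s.2

theorem insertAt_of_ne {s : S} (h : s ≠ s₀) : insertAt s₀ a f s = f ⟨s, h⟩ := dif_neg h

end insertAt

/-- Families split into their value at `s₀` and the other values. -/
def insertAtEquiv {S : Type} [DecidableEq S] (s₀ : S) (α : Type) : α × ({s // s ≠ s₀} → α) ≃ (S → α) where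
  toFun p := insertAt s₀ p.1 p.2
  invFun f := (f s₀, fun s => f s)
  left_inv p := Prod.ext (insertAt_self _ _ _) (funext fun s => insertAt_coe _ _ _ s)
  right_inv f := by
    ext s
    by_cases h : s = s₀
    · subst h; exact insertAt_self _ _ _
    · exact insertAt_of_ne _ _ _ h

theorem sum_insertAt {S α : Type} [DecidableEq S] (s₀ : S) [Fintype S] [Fintype α] {M : Type} [AddCommMonoid M] (F : (S → α) → M) :
    ∑ g, F g = ∑ a, ∑ f, F (insertAt s₀ a f) := by
  rw [← Fintype.sum_prod_type', ← (insertAtEquiv s₀ α).sum_comp]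
  rfl

theorem exists_sum_elim {A B γ : Type} (f : A ⊕ B → γ) : ∃ a b, f = Sum.elim a b :=
  ⟨f ∘ Sum.inl, f ∘ Sum.inr, (Sum.elim_comp_inl_inr f).symm⟩

theorem sum_sum_elim {A B : Type} [Fintype A] [DecidableEq A] [Fintype B] [DecidableEq B] {M : Type}
    [AddCommMonoid M] (F : (A ⊕ B → Bool) → M) : ∑ v, F v = ∑ a, ∑ b, F (Sum.elim a b) := by
  rw [← Fintype.sum_prod_type', ← (Equiv.sumArrowEquivProdArrow A B Bool).symm.sum_comp]
  refine Finset.sum_congr rfl fun p _ => congrArg F ?_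
  ext (a | b) <;> rfl

theorem kron2_elim {O₁ I₁ O₂ I₂ : Type} (A : QOp O₁ I₁) (B : QOp O₂ I₂) (a : O₁ → Bool)
    (b : O₂ → Bool) (a' : I₁ → Bool) (b' : I₂ → Bool) :
    kron2 A B (Sum.elim a b) (Sum.elim a' b') = A a a' * B b b' := rfl

/-- First stage of the reduction: the challenge key is completed by hardwired keys, the given
circuit is run, and the bit `m s₀.1` and its negation are submitted. The plaintext is kept as a
basis state because later stages select ciphertexts and verification keys by it. The register `X`
carries the prepared ciphertexts past this stage. -/
theorem exists_choose_reduction {N pkLen : ℕ} {A B X : Type} [Fintype A] [DecidableEq A] [Fintype B]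
    [DecidableEq B] [Fintype X] [DecidableEq X]
    (Ch : QAlg (Fin N × Bool → Bits pkLen) (Bits N) A B)
    (C : Circuit (BitEnc.Lbl (Fin N × Bool → Bits pkLen) ⊕ A) (BitEnc.Lbl (Bits N) ⊕ B))
    (hC : C.Computes Ch) (s₀ : Fin N × Bool) (pks : {s // s ≠ s₀} → Bits pkLen) :
    ∃ C' : Circuit (BitEnc.Lbl (Bits pkLen) ⊕ (A ⊕ X))
        (BitEnc.Lbl (Bits 1 × Bits 1) ⊕ ((BitEnc.Lbl (Bits N) ⊕ B) ⊕ X)),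
      C'.size ≤ 2 * C.size + 2 * Fintype.card X + 3 * N + 3 ∧
      ∀ (pk : Bits pkLen) (m₀ m₁ : Bits 1) (ρ : QOp A A) (σ : QOp X X),
        (C'.toQAlg (bitEnc_pair_surjective 1 1)).apply pk (m₀, m₁) (kron2 ρ σ) =
          ∑ m : Bits N, if m₀ = (fun _ => m s₀.1) ∧ m₁ = (fun _ => !m s₀.1) then
            kron2 (kron2 (basisState (BitEnc.enc m)) (Ch.apply (insertAt s₀ pk pks) m ρ)) σ
          else 0 := by
  classical
  obtain ⟨C', hsize, hker⟩ := C.exists_hardwired_circuit (X := X) (M := BitEnc.Lbl (Bits N))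
    (L₀ := BitEnc.Lbl (Bits pkLen))
    (⟨fun l => (s₀, l), fun l l' h => (Prod.mk.inj h).2⟩ :
      BitEnc.Lbl (Bits pkLen) ↪ (Fin N × Bool) × BitEnc.Lbl (Bits pkLen))
    (BitEnc.enc (insertAt s₀ (fun _ => false) pks)) (s₀.1, ())
  have hM : Fintype.card (BitEnc.Lbl (Bits N)) = N := by
    refine (Fintype.card_prod (Fin N) Unit).trans ?_
    simp
  rw [hM] at hsize
  refine ⟨C', hsize, fun pk m₀ m₁ ρ σ => ?_⟩
  ext o o'
  obtain ⟨y, z, rfl⟩ := exists_sum_elim o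
  obtain ⟨y', z', rfl⟩ := exists_sum_elim o'
  obtain ⟨μ, b, rfl⟩ := exists_sum_elim y
  obtain ⟨μ', b', rfl⟩ := exists_sum_elim y'
  rw [Circuit.toQAlg_apply, Circuit.run_basis, Matrix.sum_apply]
  obtain ⟨m, rfl⟩ := bitEnc_bits_surjective N μ
  have hk : ∀ a ξ a' ξ', C'.kernel (Sum.elim (BitEnc.enc pk) (Sum.elim a ξ))
      (Sum.elim (BitEnc.enc pk) (Sum.elim a' ξ'))
      (Sum.elim (BitEnc.enc (m₀, m₁)) (Sum.elim (Sum.elim (BitEnc.enc m) b) z))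
      (Sum.elim (BitEnc.enc (m₀, m₁)) (Sum.elim (Sum.elim μ' b') z')) =
      if ξ = z ∧ ξ' = z' ∧ (∀ i, Sum.elim (BitEnc.enc m) b (Sum.inl i) =
            Sum.elim μ' b' (Sum.inl i)) ∧
            (BitEnc.enc m₀ = fun _ => Sum.elim (BitEnc.enc m) b (Sum.inl (s₀.1, ()))) ∧
              BitEnc.enc m₁ = fun _ => !Sum.elim (BitEnc.enc m) b (Sum.inl (s₀.1, ())) then
        C.kernel (Sum.elim (BitEnc.enc (insertAt s₀ pk pks)) a)
          (Sum.elim (BitEnc.enc (insertAt s₀ pk pks)) a')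
          (Sum.elim (BitEnc.enc m) b) (Sum.elim μ' b') else 0 := by
    intro a ξ a' ξ'
    refine hker (BitEnc.enc (insertAt s₀ pk pks)) (BitEnc.enc pk) ?_ ?_ a a' ξ ξ' _ _ _ _ z z' _
      Iff.rfl
    · intro l
      change BitEnc.enc (insertAt s₀ pk pks s₀) l = _
      rw [insertAt_self]
    · rintro ⟨s, l⟩ hl
      have hs : s ≠ s₀ := by
        rintro rfl
        exact hl ⟨l, rfl⟩
      change BitEnc.enc (insertAt s₀ pk pks s) l = BitEnc.enc (insertAt s₀ (fun _ => false) pks s) l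
      rw [insertAt_of_ne _ _ _ hs, insertAt_of_ne _ _ _ hs]
  rw [sum_sum_elim]
  simp only [sum_sum_elim (M := ℂ), hk, kron2_elim]
  have hm : ∀ m' : Bits 1, ∀ β : Bool, (BitEnc.enc m' = fun _ => β) ↔ m' = fun _ => β := by
    intro m' β
    exact ⟨fun h => funext fun i => congrFun h (i, ()), fun h => by rw [h]; rfl⟩
  rw [Finset.sum_eq_single m]
  · have hb : ∀ x, basisState (BitEnc.enc m) (BitEnc.enc m) x = if x = BitEnc.enc m then 1 else 0 := by
      intro x
      rw [Circuit.basisState_apply]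
      simp
    by_cases hμ : μ' = BitEnc.enc m
    · subst hμ
      by_cases hQ : m₀ = (fun _ => m s₀.1) ∧ m₁ = (fun _ => !m s₀.1)
      · rw [if_pos hQ, kron2_elim, kron2_elim, hb, if_pos rfl, one_mul, hC, Matrix.of_apply,
          Circuit.run_basis]
        have e : ∀ ξ ξ', (ξ = z ∧ ξ' = z' ∧ (∀ i, Sum.elim (BitEnc.enc m) b (Sum.inl i) =
            Sum.elim (BitEnc.enc m) b' (Sum.inl i)) ∧
            (BitEnc.enc m₀ = fun _ => Sum.elim (BitEnc.enc m) b (Sum.inl (s₀.1, ()))) ∧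
              BitEnc.enc m₁ = fun _ => !Sum.elim (BitEnc.enc m) b (Sum.inl (s₀.1, ()))) ↔
              ξ = z ∧ ξ' = z' := by
          intro ξ ξ'
          refine and_congr_right fun _ => and_iff_left ⟨fun i => rfl, ?_, ?_⟩
          · exact (hm _ _).2 hQ.1
          · exact (hm _ _).2 hQ.2
        simp only [e, ite_and]
        rw [Finset.sum_mul]
        refine Finset.sum_congr rfl fun a _ => ?_
        rw [Finset.sum_eq_single z _ (by simp)]
        · rw [Finset.sum_mul]
          refine Finset.sum_congr rfl fun a' _ => ?_
          rw [Finset.sum_eq_single z' _ (by simp)]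
          · simp only [if_true]
            ring
          · intro ξ' _ hξ'
            simp [hξ']
        · intro ξ _ hξ
          simp [hξ]
      · rw [if_neg hQ]
        refine Finset.sum_eq_zero fun a _ => Finset.sum_eq_zero fun ξ _ =>
          Finset.sum_eq_zero fun a' _ => Finset.sum_eq_zero fun ξ' _ => ?_
        rw [if_neg, mul_zero]
        rintro ⟨-, -, -, h1, h2⟩
        exact hQ ⟨(hm _ _).1 h1, (hm _ _).1 h2⟩
    · trans 0
      · refine Finset.sum_eq_zero fun a _ => Finset.sum_eq_zero fun ξ _ =>
          Finset.sum_eq_zero fun a' _ => Finset.sum_eq_zero fun ξ' _ => ?_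
        rw [if_neg, mul_zero]
        rintro ⟨-, -, h, -⟩
        exact hμ (funext fun i => (h i).symm)
      · split_ifs
        · rw [kron2_elim, kron2_elim, hb, if_neg hμ]
          simp
        · rfl
  · intro m' _ hm'
    split_ifs
    · rw [kron2_elim, kron2_elim, Circuit.basisState_apply, if_neg]
      · simp
      · rintro ⟨h, -⟩
        exact hm' (BitEnc.enc_injective h).symm
    · rfl
  · simp

/-- The product of the amplitudes of a family of pairs of pure states. -/
def pairAmp {J T : Type} [Fintype J] (ψ : J → Bool → (T → Bool) → ℂ) (ξ : J × Bool × T → Bool) : ℂ :=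
  ∏ s, ∏ b, ψ s b fun t => ξ (s, b, t)

/-- A choice function splits two families into the selected and the other one. -/
def selectEquiv {J : Type} (T : Type) (c : J → Bool) :
    (J × T → Bool) × (J × T → Bool) ≃ (J × Bool × T → Bool) where
  toFun p x := if x.2.1 = c x.1 then p.1 (x.1, x.2.2) else p.2 (x.1, x.2.2)
  invFun ξ := (fun x => ξ (x.1, c x.1, x.2), fun x => ξ (x.1, !c x.1, x.2))
  left_inv p := by simp
  right_inv ξ := by
    ext ⟨s, b, t⟩
    by_cases h : b = c s
    · simp [h]
    · simp only [h, if_false]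
      congr 3
      cases b <;> cases h' : c s <;> simp_all

theorem pairAmp_select {J T : Type} [Fintype J] (ψ : J → Bool → (T → Bool) → ℂ) (c : J → Bool)
    (η ζ : J × T → Bool) :
    pairAmp ψ (selectEquiv T c (η, ζ)) =
      (∏ s, ψ s (c s) fun t => η (s, t)) * ∏ s, ψ s (!c s) fun t => ζ (s, t) := by
  rw [pairAmp, ← Finset.prod_mul_distrib]
  refine Finset.prod_congr rfl fun s _ => ?_
  rw [Fintype.prod_bool]
  simp only [selectEquiv, Equiv.coe_fn_mk]
  cases c s <;> simp [mul_comm]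

/-- A product of unit vectors is a unit vector. This is the factor contributed by the prepared
ciphertexts that are not selected, once they are traced out. -/
theorem sum_prod_normSq {J T : Type} [Fintype J] [DecidableEq J] [Fintype T] [DecidableEq T]
    (ψ : J → (T → Bool) → ℂ) (hψ : ∀ s, ∑ v, ‖ψ s v‖ ^ 2 = 1) :
    ∑ ζ : J × T → Bool, (∏ s, ψ s fun t => ζ (s, t)) * star (∏ s, ψ s fun t => ζ (s, t)) = 1 := by
  have h : ∀ s, ∑ v, ψ s v * star (ψ s v) = 1 := by
    intro s
    simp only [RCLike.star_def, Complex.mul_conj']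
    exact_mod_cast hψ s
  have h2 : (∏ s, ∑ v, ψ s v * star (ψ s v)) = 1 := Finset.prod_eq_one fun s _ => h s
  rw [← h2, Finset.prod_univ_sum]
  refine Finset.sum_equiv (Equiv.curry J T Bool) (by simp) fun w _ => ?_
  rw [star_prod, ← Finset.prod_mul_distrib]
  rfl

theorem pairAmp_norm {J T : Type} [Fintype J] [DecidableEq J] [Fintype T] [DecidableEq T]
    (ψ : J → Bool → (T → Bool) → ℂ) (hψ : ∀ s b, ∑ v, ‖ψ s b v‖ ^ 2 = 1) :
    ∑ ξ : J × Bool × T → Bool, pairAmp ψ ξ * star (pairAmp ψ ξ) = 1 := by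
  have h := fun c : J → Bool => sum_prod_normSq (fun s => ψ s (c s)) fun s => hψ s (c s)
  rw [← (selectEquiv T fun _ : J => true).sum_comp, Fintype.sum_prod_type]
  simp only [pairAmp_select, star_mul']
  have e : ∀ a b c d : ℂ, a * b * (c * d) = (a * c) * (b * d) := fun a b c d => by ring
  simp only [e]
  rw [← Finset.sum_mul_sum, h fun _ => true, h fun _ => !true, one_mul]

set_option synthInstance.maxSize 2000 in
-- Second stage of the reduction: the prepared ciphertexts form a product state and `m` is a basis
-- state, so after the selection the rejected candidates are in a product state with everything
-- else. Tracing them out leaves the input of `De` exactly as in the experiment, with the challenge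
-- `τ` in slot `s₀`.
theorem exists_delete_reduction {N skLen : ℕ} {A B T D : Type} [Fintype A] [DecidableEq A]
    [Fintype B] [DecidableEq B] [Fintype T] [DecidableEq T] [Fintype D] [DecidableEq D]
    (De : QAlg (Bits N × (Fin N → Bits skLen)) Unit (A ⊕ ((Fin N × Bool) × T))
      (((Fin N × Bool) × D) ⊕ B))
    (C : Circuit (BitEnc.Lbl (Bits N × (Fin N → Bits skLen)) ⊕ (A ⊕ ((Fin N × Bool) × T)))
      (BitEnc.Lbl Unit ⊕ (((Fin N × Bool) × D) ⊕ B)))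
    (hC : C.Computes De) (s₀ : Fin N × Bool) (y : Bits N × (Fin N → Bits skLen)) :
    ∃ C' : Circuit (BitEnc.Lbl Unit ⊕
          (((BitEnc.Lbl (Bits N) ⊕ A) ⊕ ({s // s ≠ s₀} × Bool × T)) ⊕ T))
        (BitEnc.Lbl Unit ⊕ (D ⊕ (BitEnc.Lbl (Bits N) ⊕ (({s // s ≠ s₀} × D) ⊕ B)))),
      C'.size ≤ 2 * C.size + 2 * N + 23 * (N * 2 * Fintype.card T) ∧
      ∀ (m : Bits N) (ρ : QOp A A) (τ : QOp T T) (ψ : {s // s ≠ s₀} → Bool → (T → Bool) → ℂ),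
        (∀ s b, ∑ v, ‖ψ s b v‖ ^ 2 = 1) → ∀ (d d' : D → Bool) (ν ν' : BitEnc.Lbl (Bits N) → Bool)
          (δ δ' : {s // s ≠ s₀} × D → Bool) (b b' : B → Bool),
        (C'.toQAlg bitEnc_unit_surjective).apply () ()
            (kron2 (kron2 (kron2 (basisState (BitEnc.enc m)) ρ) (pureState (pairAmp ψ))) τ)
            (Sum.elim d (Sum.elim ν (Sum.elim δ b))) (Sum.elim d' (Sum.elim ν' (Sum.elim δ' b'))) =
          if ν = BitEnc.enc m ∧ ν' = BitEnc.enc m then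
            De.apply y () (kron2 ρ (kronPi (insertAt s₀ τ fun s => pureState (ψ s (m s.1.1)))))
              (Sum.elim (fun p => insertAt s₀ d (fun s t => δ (s, t)) p.1 p.2) b)
              (Sum.elim (fun p => insertAt s₀ d' (fun s t => δ' (s, t)) p.1 p.2) b')
          else 0 := by
  classical
  obtain ⟨C', hsize, hker⟩ := Circuit.exists_select_circuit (M := BitEnc.Lbl (Bits N)) C
    (BitEnc.enc y) s₀ (fun s => (s.1, ()))
  have hM : Fintype.card (BitEnc.Lbl (Bits N)) = N := by
    refine (Fintype.card_prod (Fin N) Unit).trans ?_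
    simp
  rw [hM, Fintype.card_prod, Fintype.card_fin, Fintype.card_bool] at hsize
  refine ⟨C', hsize, fun m ρ τ ψ hψ d d' ν ν' δ δ' b b' => ?_⟩
  rw [Circuit.toQAlg_apply, Circuit.run_basis]
  let q (χ : T → Bool) (η : {s // s ≠ s₀} × T → Bool) : (Fin N × Bool) × T → Bool :=
    fun p => insertAt s₀ χ (fun s t => η (s, t)) p.1 p.2
  let r (d : D → Bool) (δ : {s // s ≠ s₀} × D → Bool) : (Fin N × Bool) × D → Bool :=
    fun p => insertAt s₀ d (fun s t => δ (s, t)) p.1 p.2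
  let c : {s // s ≠ s₀} → Bool := fun s => m s.1.1
  let K (p p' : (A → Bool) × (T → Bool) × ({s // s ≠ s₀} × T → Bool)) : ℂ :=
    C.kernel (Sum.elim (BitEnc.enc y) (Sum.elim p.1 (q p.2.1 p.2.2)))
      (Sum.elim (BitEnc.enc y) (Sum.elim p'.1 (q p'.2.1 p'.2.2)))
      (Sum.elim (BitEnc.enc ()) (Sum.elim (r d δ) b))
      (Sum.elim (BitEnc.enc ()) (Sum.elim (r d' δ') b'))
  -- Input basis states with plaintext `m` are parametrised by what reaches `C`, namely `p`, and by
  -- the content `ζ` of the rejected candidates. In these coordinates the kernel forces `ζ = ζ'`.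
  let v (p : (A → Bool) × (T → Bool) × ({s // s ≠ s₀} × T → Bool))
      (ζ : {s // s ≠ s₀} × T → Bool) :
      ((BitEnc.Lbl (Bits N) ⊕ A) ⊕ ({s // s ≠ s₀} × Bool × T)) ⊕ T → Bool :=
    Sum.elim (Sum.elim (Sum.elim (BitEnc.enc m) p.1) (selectEquiv T c (p.2.2, ζ))) p.2.1
  have hk : ∀ p ζ p' ζ', C'.kernel (Sum.elim (BitEnc.enc ()) (v p ζ))
      (Sum.elim (BitEnc.enc ()) (v p' ζ'))
      (Sum.elim (BitEnc.enc ()) (Sum.elim d (Sum.elim ν (Sum.elim δ b))))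
      (Sum.elim (BitEnc.enc ()) (Sum.elim d' (Sum.elim ν' (Sum.elim δ' b')))) =
      if (ν = BitEnc.enc m ∧ ν' = BitEnc.enc m) ∧ ζ = ζ' then K p p' else 0 := by
    intro p ζ p' ζ'
    refine hker _ _ _ _ _ _ _ _ _ _ _ _ _ _ _ _ _ _ (q p.2.1 p.2.2) (q p'.2.1 p'.2.2) (r d δ)
      (r d' δ') _ ?_ ?_ ?_ ?_ ?_ ?_ ?_ ?_ ?_
    · intro t
      exact congrFun (insertAt_self s₀ _ _) t
    · intro t
      exact congrFun (insertAt_self s₀ _ _) t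
    · intro s t
      refine (congrFun (insertAt_coe s₀ _ _ s) t).trans ?_
      exact (if_pos rfl).symm
    · intro s t
      refine (congrFun (insertAt_coe s₀ _ _ s) t).trans ?_
      exact (if_pos rfl).symm
    · intro t
      exact congrFun (insertAt_self s₀ _ _) t
    · intro t
      exact congrFun (insertAt_self s₀ _ _) t
    · intro s t
      exact congrFun (insertAt_coe s₀ _ _ s) t
    · intro s t
      exact congrFun (insertAt_coe s₀ _ _ s) t
    · have e : ∀ (η ζ : {s // s ≠ s₀} × T → Bool) s t,
          selectEquiv T c (η, ζ) (s, !c s, t) = ζ (s, t) := by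
        intro η ζ s t
        simp [selectEquiv]
      constructor
      · rintro ⟨⟨rfl, rfl⟩, rfl⟩
        refine ⟨rfl, rfl, fun s t => ?_⟩
        exact (e p.2.2 ζ s t).trans (e p'.2.2 ζ s t).symm
      · rintro ⟨rfl, rfl, h⟩
        refine ⟨⟨rfl, rfl⟩, ?_⟩
        ext ⟨s, t⟩
        exact (e p.2.2 ζ s t).symm.trans ((h s t).trans (e p'.2.2 ζ' s t))
  have hsum : ∀ F : (((BitEnc.Lbl (Bits N) ⊕ A) ⊕ ({s // s ≠ s₀} × Bool × T)) ⊕ T → Bool) → ℂ,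
      (∀ μ a ξ χ, μ ≠ BitEnc.enc m → F (Sum.elim (Sum.elim (Sum.elim μ a) ξ) χ) = 0) →
      ∑ w, F w = ∑ p, ∑ ζ, F (v p ζ) := by
    intro F hF
    rw [sum_sum_elim, sum_sum_elim, sum_sum_elim, Finset.sum_eq_single (BitEnc.enc m)]
    · rw [Fintype.sum_prod_type]
      refine Finset.sum_congr rfl fun a _ => ?_
      rw [Fintype.sum_prod_type, Finset.sum_comm]
      refine Finset.sum_congr rfl fun χ _ => ?_
      rw [← (selectEquiv T c).sum_comp, Fintype.sum_prod_type]
    · intro μ _ hμ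
      exact Finset.sum_eq_zero fun a _ => Finset.sum_eq_zero fun ξ _ =>
        Finset.sum_eq_zero fun χ _ => hF μ a ξ χ hμ
    · simp
  have hb : ∀ x y, basisState (BitEnc.enc m) x y =
      if x = BitEnc.enc m ∧ y = BitEnc.enc m then 1 else 0 := fun x y =>
    Circuit.basisState_apply _ _ _
  rw [hsum]
  swap
  · intro μ a ξ χ hμ
    refine Finset.sum_eq_zero fun w' _ => ?_
    obtain ⟨w, χ', rfl⟩ := exists_sum_elim w'
    obtain ⟨w, ξ', rfl⟩ := exists_sum_elim w
    obtain ⟨μ', a', rfl⟩ := exists_sum_elim w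
    rw [kron2_elim, kron2_elim, kron2_elim, hb, if_neg fun h => hμ h.1]
    simp
  have h1 : ∀ p ζ, (∑ w', kron2 (kron2 (kron2 (basisState (BitEnc.enc m)) ρ)
        (pureState (pairAmp ψ))) τ (v p ζ) w' *
      C'.kernel (Sum.elim (BitEnc.enc ()) (v p ζ)) (Sum.elim (BitEnc.enc ()) w')
        (Sum.elim (BitEnc.enc ()) (Sum.elim d (Sum.elim ν (Sum.elim δ b))))
        (Sum.elim (BitEnc.enc ()) (Sum.elim d' (Sum.elim ν' (Sum.elim δ' b'))))) =
      ∑ p', ∑ ζ', kron2 (kron2 (kron2 (basisState (BitEnc.enc m)) ρ)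
        (pureState (pairAmp ψ))) τ (v p ζ) (v p' ζ') *
        (if (ν = BitEnc.enc m ∧ ν' = BitEnc.enc m) ∧ ζ = ζ' then K p p' else 0) := by
    intro p ζ
    rw [hsum]
    · simp only [hk]
    · intro μ a ξ χ hμ
      rw [kron2_elim, kron2_elim, kron2_elim, hb, if_neg fun h => hμ h.2]
      simp
  simp only [h1]
  have h2 : ∀ p ζ p' ζ', kron2 (kron2 (kron2 (basisState (BitEnc.enc m)) ρ)
        (pureState (pairAmp ψ))) τ (v p ζ) (v p' ζ') =
      (ρ p.1 p'.1 * τ p.2.1 p'.2.1 *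
        ∏ s, pureState (ψ s (c s)) (fun t => p.2.2 (s, t)) (fun t => p'.2.2 (s, t))) *
      ((∏ s, ψ s (!c s) fun t => ζ (s, t)) * star (∏ s, ψ s (!c s) fun t => ζ' (s, t))) := by
    intro p ζ p' ζ'
    rw [kron2_elim, kron2_elim, kron2_elim, hb, if_pos ⟨rfl, rfl⟩]
    simp only [pureState, Matrix.of_apply, pairAmp_select, star_mul', star_prod,
      Finset.prod_mul_distrib]
    ring
  by_cases hν : ν = BitEnc.enc m ∧ ν' = BitEnc.enc m
  · rw [if_pos hν]
    simp only [hν, true_and, and_self, h2]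
    rw [hC, Matrix.of_apply, Circuit.run_basis]
    have hsum' : ∀ F : (A ⊕ ((Fin N × Bool) × T) → Bool) → ℂ,
        ∑ w, F w = ∑ p : (A → Bool) × (T → Bool) × ({s // s ≠ s₀} × T → Bool),
          F (Sum.elim p.1 (q p.2.1 p.2.2)) := by
      intro F
      rw [sum_sum_elim, Fintype.sum_prod_type]
      refine Finset.sum_congr rfl fun a _ => ?_
      rw [← (Equiv.curry (Fin N × Bool) T Bool).symm.sum_comp, sum_insertAt s₀,
        Fintype.sum_prod_type]
      refine Finset.sum_congr rfl fun χ _ => ?_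
      rw [← (Equiv.curry {s // s ≠ s₀} T Bool).sum_comp]
      rfl
    simp only [hsum']
    refine Finset.sum_congr rfl fun p _ => ?_
    rw [Finset.sum_comm]
    refine Finset.sum_congr rfl fun p' _ => ?_
    have e : kron2 ρ (kronPi (insertAt s₀ τ fun s => pureState (ψ s (m s.1.1))))
        (Sum.elim p.1 (q p.2.1 p.2.2)) (Sum.elim p'.1 (q p'.2.1 p'.2.2)) =
        ρ p.1 p'.1 * τ p.2.1 p'.2.1 *
        ∏ s, pureState (ψ s (c s)) (fun t => p.2.2 (s, t)) (fun t => p'.2.2 (s, t)) := by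
      rw [kron2_elim, kronPi, Matrix.of_apply, Fintype.prod_eq_mul_prod_subtype_ne _ s₀]
      simp only [q, insertAt_self, insertAt_coe, c]
      ring
    rw [e]
    trans (∑ ζ : {s // s ≠ s₀} × T → Bool, (ρ p.1 p'.1 * τ p.2.1 p'.2.1 *
        ∏ s, pureState (ψ s (c s)) (fun t => p.2.2 (s, t)) (fun t => p'.2.2 (s, t))) * K p p' *
      ((∏ s, ψ s (!c s) fun t => ζ (s, t)) * star (∏ s, ψ s (!c s) fun t => ζ (s, t))))
    · refine Finset.sum_congr rfl fun ζ _ => ?_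
      rw [Finset.sum_eq_single ζ _ (by simp)]
      · simp only [if_true]
        ring
      · intro ζ' _ hζ'
        rw [if_neg (Ne.symm hζ'), mul_zero]
    -- The rejected candidates are unit vectors, so their sum over `ζ` is `1`.
    · rw [← Finset.mul_sum, sum_prod_normSq _ fun s => hψ s (!c s), mul_one]
  · rw [if_neg hν]
    refine Finset.sum_eq_zero fun p _ => Finset.sum_eq_zero fun ζ _ =>
      Finset.sum_eq_zero fun p' _ => Finset.sum_eq_zero fun ζ' _ => ?_
    rw [if_neg fun h => hν h.1, mul_zero]

/-! ## The reduction -/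

theorem pureState_elim {A B : Type} (φ : (A → Bool) → ℂ) (χ : (B → Bool) → ℂ) :
    pureState (fun v : A ⊕ B → Bool => φ (fun i => v (Sum.inl i)) * χ (fun i => v (Sum.inr i))) =
      kron2 (pureState φ) (pureState χ) := by
  ext u v
  simp only [pureState, kron2, Matrix.of_apply, star_mul']
  ring

/-- The probability that all certificates are accepted and the second adversary outputs `1`, if
the first adversary holds the state `ρ`, gets a secret key for `x` and, in slot `s`, the
ciphertext `τ s`. -/
def slotProb {N skLen vkLen : ℕ} {B B' T D : Type} [Fintype B] [DecidableEq B] [Fintype B']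
    [DecidableEq B'] [Fintype T] [DecidableEq T] [Fintype D] [DecidableEq D]
    (V : QAlg (Bits vkLen) Bool D Empty)
    (De : QAlg (Bits N × (Fin N → Bits skLen)) Unit (B ⊕ ((Fin N × Bool) × T))
      (((Fin N × Bool) × D) ⊕ B'))
    (Gu : QAlg (Option (Fin N × Bool → Bits skLen)) Bool B' Empty)
    (x : Bits N) (vk : Fin N × Bool → Bits vkLen) (msk : Fin N × Bool → Bits skLen)
    (ρ : QOp B B) (τ : Fin N × Bool → QOp T T) : ℝ :=
  ((QAlg.verifyAll (Fin N × Bool) V).certify Gu).prob (vk, msk) (some true)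
    (De.apply (x, fun i => msk (i, x i)) () (kron2 ρ (kronPi τ)))

set_option synthInstance.maxSize 2000 in
/-- The second adversary of the reduction: it verifies the certificates of the slots other than
`s₀`, and if they are accepted it runs `Gu` on the completed master secret key. -/
def reductionGuess {N skLen vkLen : ℕ} {B' D : Type} [Fintype B']
    [DecidableEq B'] [Fintype D] [DecidableEq D]
    (V : QAlg (Bits vkLen) Bool D Empty)
    (Gu : QAlg (Option (Fin N × Bool → Bits skLen)) Bool B' Empty)
    (s₀ : Fin N × Bool) (sks : {s // s ≠ s₀} → Bits skLen)
    (vks : {s // s ≠ s₀} → Bool → Bits vkLen) :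
    QAlg (Option (Bits skLen)) Bool (BitEnc.Lbl (Bits N) ⊕ (({s // s ≠ s₀} × D) ⊕ B')) Empty :=
  QAlg.controlled fun μ : BitEnc.Lbl (Bits N) → Bool =>
    (((QAlg.verifyAll {s // s ≠ s₀} V).certify Gu).reindex (Equiv.refl _)
      (Equiv.equivOfIsEmpty _ _)).wrap
      -- The default key on input `⊥` is irrelevant: the outcome of the IND-CPA experiment is then
      -- `⊥` whatever bit is returned. Rejection in another slot is reported as `false` and so does
      -- not count as success either.
      (fun o => (fun s => vks s (μ (s.1.1, ())), insertAt s₀ (o.getD fun _ => false) sks))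
      (fun _ o => decide (o = some true))

set_option synthInstance.maxSize 2000 in
theorem effect_reductionGuess {N skLen vkLen : ℕ} {B' D : Type} [Fintype B']
    [DecidableEq B'] [Fintype D] [DecidableEq D]
    (V : QAlg (Bits vkLen) Bool D Empty)
    (Gu : QAlg (Option (Fin N × Bool → Bits skLen)) Bool B' Empty)
    (s₀ : Fin N × Bool) (sks : {s // s ≠ s₀} → Bits skLen)
    (vks : {s // s ≠ s₀} → Bool → Bits vkLen) (sk : Bits skLen) (m : Bits N)
    (δ δ' : {s // s ≠ s₀} × D → Bool) (β β' : B' → Bool) :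
    (reductionGuess V Gu s₀ sks vks).effect (some sk) true
        (Sum.elim (BitEnc.enc m) (Sum.elim δ β)) (Sum.elim (BitEnc.enc m) (Sum.elim δ' β')) =
      (∏ s, (V.effect (vks s (m s.1.1)) true) (fun t => δ (s, t)) (fun t => δ' (s, t))) *
        Gu.effect (some (insertAt s₀ sk sks)) true β β' := by
  rw [reductionGuess, QAlg.effect_controlled,
    QAlg.effect_wrap _ _ _ _ _ (some true) (fun z => by simp), QAlg.effect_reindex,
    QAlg.effect_certify, QAlg.effect_verifyAll]
  rfl

set_option synthInstance.maxSize 2000 in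
-- The success operator of the receiver non-committing experiment is a tensor product over all
-- slots, times that of `Gu`. The reduction merely distributes the factors: slot `s₀` is checked by
-- its challenger, the others by `reductionGuess`. The hypothesis `hs₀` says that the first
-- adversary gets no secret key of slot `s₀`.
theorem prob_reduction {N skLen vkLen : ℕ} {B B' T D : Type} [Fintype B] [DecidableEq B]
    [Fintype B'] [DecidableEq B'] [Fintype T] [DecidableEq T] [Fintype D] [DecidableEq D]
    (V : QAlg (Bits vkLen) Bool D Empty)
    (De : QAlg (Bits N × (Fin N → Bits skLen)) Unit (B ⊕ ((Fin N × Bool) × T))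
      (((Fin N × Bool) × D) ⊕ B'))
    (Gu : QAlg (Option (Fin N × Bool → Bits skLen)) Bool B' Empty)
    (x : Bits N) (s₀ : Fin N × Bool) (hs₀ : ∀ i, (i, x i) ≠ s₀)
    (sks : {s // s ≠ s₀} → Bits skLen) (vks : {s // s ≠ s₀} → Bool → Bits vkLen)
    (vk : Bits vkLen) (sk : Bits skLen) (m : Bits N) (ρ : QOp B B)
    (τ : Fin N × Bool → QOp T T)
    (M : QOp (D ⊕ (BitEnc.Lbl (Bits N) ⊕ (({s // s ≠ s₀} × D) ⊕ B')))
      (D ⊕ (BitEnc.Lbl (Bits N) ⊕ (({s // s ≠ s₀} × D) ⊕ B'))))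
    (hM : ∀ d d' ν ν' δ δ' b b',
      M (Sum.elim d (Sum.elim ν (Sum.elim δ b))) (Sum.elim d' (Sum.elim ν' (Sum.elim δ' b'))) =
        if ν = BitEnc.enc m ∧ ν' = BitEnc.enc m then
          De.apply (x, fun i => insertAt s₀ (fun _ => false) sks (i, x i)) () (kron2 ρ (kronPi τ))
            (Sum.elim (fun p => insertAt s₀ d (fun s t => δ (s, t)) p.1 p.2) b)
            (Sum.elim (fun p => insertAt s₀ d' (fun s t => δ' (s, t)) p.1 p.2) b')
        else 0) :
    (V.certify (reductionGuess V Gu s₀ sks vks)).prob (vk, sk) (some true) M =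
      slotProb V De Gu x (insertAt s₀ vk fun s => vks s (m s.1.1)) (insertAt s₀ sk sks) ρ τ := by
  classical
  have hy : (fun i => insertAt s₀ sk sks (i, x i)) =
      fun i => insertAt s₀ (fun _ => false) sks (i, x i) := by
    funext i
    rw [insertAt_of_ne _ _ _ (hs₀ i), insertAt_of_ne _ _ _ (hs₀ i)]
  rw [slotProb, QAlg.prob_eq, QAlg.prob_eq, QAlg.effect_certify, QAlg.effect_certify,
    QAlg.effect_verifyAll, hy]
  congr 1
  set R := De.apply (x, fun i => insertAt s₀ (fun _ => false) sks (i, x i)) ()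
    (kron2 ρ (kronPi τ)) with hR
  clear_value R
  let r (d : D → Bool) (δ : {s // s ≠ s₀} × D → Bool) : (Fin N × Bool) × D → Bool :=
    fun p => insertAt s₀ d (fun s t => δ (s, t)) p.1 p.2
  have hsum : ∀ F : (((Fin N × Bool) × D) ⊕ B' → Bool) → ℂ,
      ∑ w, F w = ∑ d, ∑ δ, ∑ β, F (Sum.elim (r d δ) β) := by
    intro F
    rw [sum_sum_elim, ← (Equiv.curry (Fin N × Bool) D Bool).symm.sum_comp, sum_insertAt s₀]
    refine Finset.sum_congr rfl fun d _ => ?_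
    rw [← (Equiv.curry {s // s ≠ s₀} D Bool).sum_comp]
    rfl
  have hsum' : ∀ F : (D ⊕ (BitEnc.Lbl (Bits N) ⊕ (({s // s ≠ s₀} × D) ⊕ B')) → Bool) → ℂ,
      (∀ d ν δ β, ν ≠ BitEnc.enc m → F (Sum.elim d (Sum.elim ν (Sum.elim δ β))) = 0) →
      ∑ w, F w = ∑ d, ∑ δ, ∑ β, F (Sum.elim d (Sum.elim (BitEnc.enc m) (Sum.elim δ β))) := by
    intro F hF
    rw [sum_sum_elim]
    refine Finset.sum_congr rfl fun d _ => ?_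
    rw [sum_sum_elim, Finset.sum_eq_single (BitEnc.enc m), sum_sum_elim]
    · intro ν _ hν
      rw [sum_sum_elim]
      exact Finset.sum_eq_zero fun δ _ => Finset.sum_eq_zero fun β _ => hF d ν δ β hν
    · simp
  simp only [Matrix.trace, Matrix.diag_apply, Matrix.mul_apply]
  rw [hsum, hsum']
  swap
  · intro d ν δ β hν
    refine Finset.sum_eq_zero fun w _ => ?_
    obtain ⟨d', w, rfl⟩ := exists_sum_elim w
    obtain ⟨ν', w, rfl⟩ := exists_sum_elim w
    obtain ⟨δ', β', rfl⟩ := exists_sum_elim w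
    rw [hM, if_neg fun h => hν h.2, mul_zero]
  refine Finset.sum_congr rfl fun d _ => Finset.sum_congr rfl fun δ _ =>
    Finset.sum_congr rfl fun β _ => ?_
  rw [hsum, hsum']
  swap
  · intro d' ν' δ' β' hν
    rw [hM, if_neg fun h => hν h.1, mul_zero]
  refine Finset.sum_congr rfl fun d' _ => Finset.sum_congr rfl fun δ' _ =>
    Finset.sum_congr rfl fun β' _ => ?_
  rw [hM, if_pos ⟨rfl, rfl⟩, kron2_elim, kron2_elim, effect_reductionGuess, kronPi, Matrix.of_apply,
    Fintype.prod_eq_mul_prod_subtype_ne _ s₀]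
  simp only [r, insertAt_self, insertAt_coe]
  ring

set_option synthInstance.maxSize 2000 in
-- Everything outside `s₀` is fixed here, for both possible plaintext bits of each slot. The success
-- probability is that of the experiment conditioned on these choices; the challenge bit enters only
-- through the plaintext in slot `s₀`.
theorem exists_localAdversary {N pkLen skLen vkLen ctLen certLen : ℕ} {A B B' : Type}
    [Fintype A] [DecidableEq A] [Fintype B] [DecidableEq B] [Fintype B'] [DecidableEq B']
    (K : QAlg Unit (Bits pkLen × Bits skLen) Empty Empty)
    (E : QAlg (Bits pkLen × Bits 1) (Bits vkLen) Empty (Fin ctLen))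
    (V : QAlg (Bits vkLen) Bool (Fin certLen) Empty)
    (adv : (A → Bool) → ℂ) (hadv : ∑ v, ‖adv v‖ ^ 2 = 1)
    (Ch : QAlg (Fin N × Bool → Bits pkLen) (Bits N) A B)
    (C₁ : Circuit (BitEnc.Lbl (Fin N × Bool → Bits pkLen) ⊕ A) (BitEnc.Lbl (Bits N) ⊕ B))
    (hC₁ : C₁.Computes Ch)
    (De : QAlg (Bits N × (Fin N → Bits skLen)) Unit (B ⊕ ((Fin N × Bool) × Fin ctLen))
      (((Fin N × Bool) × Fin certLen) ⊕ B'))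
    (C₂ : Circuit (BitEnc.Lbl (Bits N × (Fin N → Bits skLen)) ⊕
        (B ⊕ ((Fin N × Bool) × Fin ctLen)))
      (BitEnc.Lbl Unit ⊕ (((Fin N × Bool) × Fin certLen) ⊕ B')))
    (hC₂ : C₂.Computes De)
    (Gu : QAlg (Option (Fin N × Bool → Bits skLen)) Bool B' Empty)
    (x : Bits N) (s₀ : Fin N × Bool) (hs₀ : ∀ i, (i, x i) ≠ s₀)
    (pks : {s // s ≠ s₀} → Bits pkLen) (sks : {s // s ≠ s₀} → Bits skLen)
    (vks : {s // s ≠ s₀} → Bool → Bits vkLen)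
    (ψ : {s // s ≠ s₀} → Bool → (Fin ctLen → Bool) → ℂ)
    (hψ : ∀ s b, ∑ v, ‖ψ s b v‖ ^ 2 = 1) :
    ∃ a : LocalAdversary pkLen skLen ctLen certLen,
      a.chooseCircuit.size ≤ 2 * C₁.size + 2 * (N * 2 * (2 * ctLen)) + 3 * N + 3 ∧
      a.deleteCircuit.size ≤ 2 * C₂.size + 2 * N + 23 * (N * 2 * ctLen) ∧
      ∀ b, a.value K E V b = ∑ pk, ∑ sk, ∑ vk, ∑ m, K.prob () (pk, sk) 1 *
        slotProb V De Gu x (insertAt s₀ vk fun s => vks s (m s.1.1)) (insertAt s₀ sk sks)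
          (Ch.apply (insertAt s₀ pk pks) m (pureState adv))
          (insertAt s₀ (E.apply (pk, fun _ => xor b (m s₀.1)) vk 1)
            fun s => pureState (ψ s (m s.1.1))) := by
  classical
  obtain ⟨C₁', h₁, hc₁⟩ := exists_choose_reduction (X := {s // s ≠ s₀} × Bool × Fin ctLen)
    Ch C₁ hC₁ s₀ pks
  obtain ⟨C₂', h₂, hc₂⟩ := exists_delete_reduction De C₂ hC₂ s₀
    (x, fun i => insertAt s₀ (fun _ => false) sks (i, x i))
  let a : LocalAdversary pkLen skLen ctLen certLen :=
    { Advice := A ⊕ ({s // s ≠ s₀} × Bool × Fin ctLen)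
      St := (BitEnc.Lbl (Bits N) ⊕ B) ⊕ ({s // s ≠ s₀} × Bool × Fin ctLen)
      St' := BitEnc.Lbl (Bits N) ⊕ (({s // s ≠ s₀} × Fin certLen) ⊕ B')
      -- The advice of the given adversary is accompanied by both ciphertext candidates of every
      -- other slot.
      advice := fun v => adv (fun i => v (Sum.inl i)) * pairAmp ψ (fun i => v (Sum.inr i))
      advice_norm := by
        have e : ∑ ξ, ‖pairAmp ψ ξ‖ ^ 2 = 1 := by
          have := pairAmp_norm ψ hψ
          simp only [RCLike.star_def, Complex.mul_conj'] at this
          exact_mod_cast this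
        rw [sum_sum_elim]
        simp only [Sum.elim_inl, Sum.elim_inr, norm_mul, mul_pow]
        rw [← Finset.sum_mul_sum]
        exact (congrArg₂ (· * ·) hadv e).trans (one_mul 1)
      chooseCircuit := C₁'
      deleteCircuit := C₂'
      guess := reductionGuess V Gu s₀ sks vks }
  refine ⟨a, ?_, ?_, fun b => ?_⟩
  · refine h₁.trans ?_
    have : Fintype.card ({s // s ≠ s₀} × Bool × Fin ctLen) ≤ N * 2 * (2 * ctLen) := by
      rw [Fintype.card_prod, Fintype.card_prod, Fintype.card_bool, Fintype.card_fin]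
      refine Nat.mul_le_mul_right _ ((Fintype.card_subtype_le _).trans ?_)
      simp
    omega
  · refine h₂.trans ?_
    simp
  · have key : ∀ pk sk m₀ m₁ vk, (V.certify a.guess).prob (vk, sk) (some true)
        (a.delete.apply () () (kron2 (a.choose.apply pk (m₀, m₁) (pureState a.advice))
          (E.apply (pk, if b then m₁ else m₀) vk 1))) =
        ∑ m : Bits N, if m₀ = (fun _ => m s₀.1) ∧ m₁ = (fun _ => !m s₀.1) then
          slotProb V De Gu x (insertAt s₀ vk fun s => vks s (m s.1.1)) (insertAt s₀ sk sks)
            (Ch.apply (insertAt s₀ pk pks) m (pureState adv))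
            (insertAt s₀ (E.apply (pk, fun _ => xor b (m s₀.1)) vk 1)
              fun s => pureState (ψ s (m s.1.1))) else 0 := by
      intro pk sk m₀ m₁ vk
      have e1 : a.choose.apply pk (m₀, m₁) (pureState a.advice) = _ :=
        (congrArg _ (pureState_elim adv (pairAmp ψ))).trans
          (hc₁ pk m₀ m₁ (pureState adv) (pureState (pairAmp ψ)))
      rw [e1, ← kron2_sum_left]
      have e2 := map_sum (((V.certify a.guess).probₗ (vk, sk) (some true)).comp
        ((a.delete.applyₗ () ()).restrictScalars ℝ))
        (fun m : Bits N => kron2 (if m₀ = (fun _ => m s₀.1) ∧ m₁ = (fun _ => !m s₀.1) then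
            kron2 (kron2 (basisState (BitEnc.enc m)) (Ch.apply (insertAt s₀ pk pks) m
              (pureState adv))) (pureState (pairAmp ψ)) else 0)
          (E.apply (pk, if b then m₁ else m₀) vk 1)) Finset.univ
      refine e2.trans (Finset.sum_congr rfl fun m _ => ?_)
      by_cases hm : m₀ = (fun _ => m s₀.1) ∧ m₁ = (fun _ => !m s₀.1)
      · rw [if_pos hm, if_pos hm]
        -- The submitted plaintexts are the bit of `m` and its negation, so the challenge bit acts
        -- as an exclusive or on the plaintext.
        have hb : (if b then m₁ else m₀) = fun _ => xor b (m s₀.1) := by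
          cases b
          · simp [hm.1]
          · simp [hm.2]
        rw [hb]
        exact prob_reduction V De Gu x s₀ hs₀ sks vks vk sk m _ _ _
          fun d d' ν ν' δ δ' β β' => hc₂ m _ _ ψ hψ d d' ν ν' δ δ' β β'
      · rw [if_neg hm, if_neg hm]
        have : kron2 (0 : QOp ((BitEnc.Lbl (Bits N) ⊕ B) ⊕ ({s // s ≠ s₀} × Bool × Fin ctLen))
            ((BitEnc.Lbl (Bits N) ⊕ B) ⊕ ({s // s ≠ s₀} × Bool × Fin ctLen)))
            (E.apply (pk, if b then m₁ else m₀) vk 1) = 0 := by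
          ext u v
          simp [kron2]
        rw [this]
        exact map_zero (((V.certify a.guess).probₗ (vk, sk) (some true)).comp
          ((a.delete.applyₗ () ()).restrictScalars ℝ))
    unfold LocalAdversary.value
    simp only [key]
    refine Finset.sum_congr rfl fun pk _ => Finset.sum_congr rfl fun sk _ => ?_
    have comm : ∀ F : Bits 1 → Bits 1 → Bits vkLen → Bits N → ℝ,
        (∑ m₀, ∑ m₁, ∑ vk, K.prob () (pk, sk) 1 *
          ∑ m : Bits N, if m₀ = (fun _ => m s₀.1) ∧ m₁ = (fun _ => !m s₀.1) then F m₀ m₁ vk m else 0) =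
        ∑ vk, ∑ m : Bits N, K.prob () (pk, sk) 1 *
          F (fun _ => m s₀.1) (fun _ => !m s₀.1) vk m := by
      intro F
      simp only [Finset.mul_sum, mul_ite, mul_zero]
      rw [Finset.sum_congr rfl fun m₀ _ => Finset.sum_comm, Finset.sum_comm]
      refine Finset.sum_congr rfl fun vk _ => ?_
      rw [Finset.sum_congr rfl fun m₀ _ => Finset.sum_comm, Finset.sum_comm]
      refine Finset.sum_congr rfl fun m _ => ?_
      simp only [ite_and]
      simp
    exact comm _

/-! ## The hybrid argument -/

theorem abs_sum_sub_sum_le {ι : Type} [Fintype ι] (p u v : ι → ℝ) {ε : ℝ} (hp : ∀ i, 0 ≤ p i)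
    (hp1 : ∑ i, p i = 1) (h : ∀ i, |u i - v i| ≤ ε) :
    |∑ i, p i * u i - ∑ i, p i * v i| ≤ ε := by
  rw [← Finset.sum_sub_distrib]
  refine (Finset.abs_sum_le_sum_abs _ _).trans ?_
  calc ∑ i, |p i * u i - p i * v i| ≤ ∑ i, p i * ε := by
        refine Finset.sum_le_sum fun i _ => ?_
        rw [← mul_sub, abs_mul, abs_of_nonneg (hp i)]
        exact mul_le_mul_of_nonneg_left (h i) (hp i)
    _ = ε := by rw [← Finset.sum_mul, hp1, one_mul]

/-- Pairs as dependent functions on `Bool`. -/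
def piBoolEquiv (κ : Bool → Type) : κ false × κ true ≃ (∀ b, κ b) where
  toFun p b := match b with
    | false => p.1
    | true => p.2
  invFun c := (c false, c true)
  left_inv _ := rfl
  right_inv c := by
    funext b
    cases b <;> rfl

theorem sum_pi_bool_ite {κ : Bool → Type} [∀ b, Fintype (κ b)] [∀ b, DecidableEq (κ b)]
    (w : ∀ b, κ b → ℝ) (hw : ∀ b, ∑ c, w b c = 1) (β : Bool) (u : κ β) :
    (∑ c : ∀ b, κ b, if c β = u then ∏ b, w b (c b) else 0) = w β u := by
  rw [← (piBoolEquiv κ).sum_comp, Fintype.sum_prod_type]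
  simp only [Fintype.prod_bool]
  cases β
  · simp only [piBoolEquiv, Equiv.coe_fn_mk]
    rw [Finset.sum_eq_single u]
    · simp only [if_true]
      rw [← Finset.sum_mul, hw, one_mul]
    · intro c _ hc
      simp [hc]
    · simp
  · simp only [piBoolEquiv, Equiv.coe_fn_mk]
    refine (Finset.sum_congr rfl fun c _ => Finset.sum_eq_single u ?_ (by simp)).trans ?_
    · intro c' _ hc
      simp [hc]
    · simp only [if_true]
      rw [← Finset.mul_sum, hw, mul_one]

/-- The selected members of independent families of pairs are independent. -/
theorem sum_pi_select {J : Type} [Fintype J] [DecidableEq J] {κ : J → Bool → Type}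
    [∀ s b, Fintype (κ s b)] (w : ∀ s b, κ s b → ℝ) (hw : ∀ s b, ∑ c, w s b c = 1)
    (μ : J → Bool) (f : (∀ s, κ s (μ s)) → ℝ) :
    ∑ c : ∀ s b, κ s b, (∏ s, ∏ b, w s b (c s b)) * f (fun s => c s (μ s)) =
      ∑ u : ∀ s, κ s (μ s), (∏ s, w s (μ s) (u s)) * f u := by
  classical
  have h : ∀ u : ∀ s, κ s (μ s), ∏ s, w s (μ s) (u s) =
      ∑ c : ∀ s b, κ s b, if (fun s => c s (μ s)) = u then ∏ s, ∏ b, w s b (c s b) else 0 := by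
    intro u
    rw [Finset.prod_congr rfl fun s _ => (sum_pi_bool_ite (w s) (hw s) (μ s) (u s)).symm,
      Finset.prod_univ_sum, Fintype.piFinset_univ]
    refine Finset.sum_congr rfl fun c _ => ?_
    rw [Finset.prod_ite_zero]
    by_cases hc : (fun s => c s (μ s)) = u
    · rw [if_pos hc, if_pos fun s _ => congrFun hc s]
    · rw [if_neg hc, if_neg fun h => hc (funext fun s => h s (Finset.mem_univ s))]
  simp only [h, Finset.sum_mul, ite_mul, zero_mul]
  rw [Finset.sum_comm]
  simp

theorem kronPi_insertAt_apply {S O I : Type} [Fintype S] [DecidableEq S] (s₀ : S) (τ : QOp O I)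
    (σ : {s // s ≠ s₀} → QOp O I) (u : S × O → Bool) (v : S × I → Bool) :
    kronPi (insertAt s₀ τ σ) u v = τ (fun i => u (s₀, i)) (fun i => v (s₀, i)) *
      ∏ s : {s // s ≠ s₀}, σ s (fun i => u (s, i)) (fun i => v (s, i)) := by
  rw [kronPi, Matrix.of_apply, Fintype.prod_eq_mul_prod_subtype_ne _ s₀]
  simp only [insertAt_self, insertAt_coe]

theorem kronPi_insertAt_sum {S O I : Type} [Fintype S] [DecidableEq S] (s₀ : S) (τ : QOp O I)
    {κ : {s // s ≠ s₀} → Type} [∀ s, Fintype (κ s)] (σ : ∀ s, κ s → QOp O I) :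
    kronPi (insertAt s₀ τ fun s => ∑ c, σ s c) =
      ∑ c : ∀ s, κ s, kronPi (insertAt s₀ τ fun s => σ s (c s)) := by
  ext u v
  simp only [Matrix.sum_apply, kronPi_insertAt_apply]
  rw [Finset.prod_univ_sum, Fintype.piFinset_univ, Finset.mul_sum]

theorem kronPi_insertAt_ite {S O I : Type} [Fintype S] [DecidableEq S] (s₀ : S) (τ : QOp O I)
    (w : {s // s ≠ s₀} → ℝ) (σ : {s // s ≠ s₀} → QOp O I) (p : {s // s ≠ s₀} → Prop)
    [DecidablePred p] [Decidable (∀ s, p s)] :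
    kronPi (insertAt s₀ τ fun s => if p s then (w s : ℂ) • σ s else 0) =
      if ∀ s, p s then (∏ s, w s) • kronPi (insertAt s₀ τ σ) else 0 := by
  ext u v
  have e : ∀ s (a : O → Bool) (b : I → Bool), (if p s then (w s : ℂ) • σ s else 0) a b =
      if p s then (w s : ℂ) * σ s a b else 0 := by
    intro s a b
    split_ifs <;> rfl
  rw [kronPi_insertAt_apply]
  simp only [e]
  rw [Finset.prod_ite_zero]
  by_cases h : ∀ s, p s
  · rw [if_pos fun s _ => h s, if_pos h, Matrix.smul_apply, kronPi_insertAt_apply,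
      Finset.prod_mul_distrib, Complex.real_smul, Complex.ofReal_prod]
    ring
  · rw [if_neg fun h' => h fun s => h' s (Finset.mem_univ s), if_neg h, mul_zero]
    rfl

namespace QAlg

/-- The output state is Hermitian, so its trace is real and `prob` loses nothing by taking the real
part. This makes probabilities multiplicative along with traces. -/
theorem trace_apply_one {X Y O : Type} [Fintype O] [DecidableEq O] (A : QAlg X Y Empty O) (x : X)
    (y : Y) : (A.apply x y 1).trace = (A.prob x y 1 : ℂ) := by
  classical
  have h : (A.apply x y 1)ᴴ = A.apply x y 1 := by
    rw [apply, Matrix.conjTranspose_sum]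
    refine Finset.sum_congr rfl fun c _ => ?_
    split_ifs
    · simp
    · simp
  refine (Complex.conj_eq_iff_re.1 ?_).symm
  rw [starRingEnd_apply, ← Matrix.trace_conjTranspose, h]

theorem sum_prob_one {X Y : Type} [Fintype Y] (A : QAlg X Y Empty Empty) (x : X) :
    ∑ y, A.prob x y 1 = 1 := by
  simp only [prob_eq, Matrix.mul_one]
  rw [← Complex.re_sum, ← Matrix.trace_sum, sum_effect]
  simp

end QAlg

/-! ### Hybrid probabilities as averages over fixed choices in all slots but one. -/

section slot

variable {N pkLen skLen vkLen : ℕ} {B B' T D : Type} [Fintype B] [DecidableEq B] [Fintype B']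
    [DecidableEq B'] [Fintype T] [DecidableEq T] [Fintype D] [DecidableEq D]

/-- The Kronecker product with a fixed operator on the left, as a linear map. -/
def kron2ₗ {O₁ I₁ : Type} (O₂ I₂ : Type) (A : QOp O₁ I₁) :
    QOp O₂ I₂ →ₗ[ℂ] QOp (O₁ ⊕ O₂) (I₁ ⊕ I₂) where
  toFun := kron2 A
  map_add' x y := by
    ext u v
    simp [kron2, mul_add]
  map_smul' c x := by
    ext u v
    simp only [kron2, Matrix.smul_apply, Matrix.of_apply, smul_eq_mul, RingHom.id_apply]
    ring

/-- The probability of success as a function of the joint state of the ciphertexts. -/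
def slotProbₗ (V : QAlg (Bits vkLen) Bool D Empty)
    (De : QAlg (Bits N × (Fin N → Bits skLen)) Unit (B ⊕ ((Fin N × Bool) × T))
      (((Fin N × Bool) × D) ⊕ B'))
    (Gu : QAlg (Option (Fin N × Bool → Bits skLen)) Bool B' Empty)
    (sk : Bits N × (Fin N → Bits skLen)) (vk : Fin N × Bool → Bits vkLen)
    (msk : Fin N × Bool → Bits skLen) (ρ : QOp B B) :
    QOp ((Fin N × Bool) × T) ((Fin N × Bool) × T) →ₗ[ℝ] ℝ :=
  (((QAlg.verifyAll (Fin N × Bool) V).certify Gu).probₗ (vk, msk) (some true)).comp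
    (((De.applyₗ sk ()).comp (kron2ₗ _ _ ρ)).restrictScalars ℝ)

variable (V : QAlg (Bits vkLen) Bool D Empty)
    (De : QAlg (Bits N × (Fin N → Bits skLen)) Unit (B ⊕ ((Fin N × Bool) × T))
      (((Fin N × Bool) × D) ⊕ B'))
    (Gu : QAlg (Option (Fin N × Bool → Bits skLen)) Bool B' Empty)

theorem slotProb_eq (x : Bits N) (vk : Fin N × Bool → Bits vkLen)
    (msk : Fin N × Bool → Bits skLen) (ρ : QOp B B) (τ : Fin N × Bool → QOp T T) :
    slotProb V De Gu x vk msk ρ τ =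
      slotProbₗ V De Gu (x, fun i => msk (i, x i)) vk msk ρ (kronPi τ) := rfl

/-- Random ciphertexts as mixtures of pure states. -/
theorem sum_slotProb_insertAt (E : QAlg (Bits pkLen × Bits 1) (Bits vkLen) Empty T)
    (w : ∀ p, E.κ p → ℝ) (ψ : ∀ p, E.κ p → (T → Bool) → ℂ)
    (hE : ∀ p c, E.op p c * (1 : QOp Empty Empty) * (E.op p c)ᴴ = (w p c : ℂ) • pureState (ψ p c))
    (x : Bits N) (s₀ : Fin N × Bool) (vk : Bits vkLen) (msk : Fin N × Bool → Bits skLen)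
    (ρ : QOp B B) (τ : QOp T T) (p : {s // s ≠ s₀} → Bits pkLen × Bits 1) :
    ∑ vks, slotProb V De Gu x (insertAt s₀ vk vks) msk ρ
        (insertAt s₀ τ fun s => E.apply (p s) (vks s) 1) =
      ∑ c : ∀ s, E.κ (p s), (∏ s, w (p s) (c s)) *
        slotProb V De Gu x (insertAt s₀ vk fun s => E.out (p s) (c s)) msk ρ
          (insertAt s₀ τ fun s => pureState (ψ (p s) (c s))) := by
  classical
  have h : ∀ vks : {s // s ≠ s₀} → Bits vkLen,
      kronPi (insertAt s₀ τ fun s => E.apply (p s) (vks s) 1) =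
        ∑ c : ∀ s, E.κ (p s), if (fun s => E.out (p s) (c s)) = vks then (∏ s, w (p s) (c s)) •
          kronPi (insertAt s₀ τ fun s => pureState (ψ (p s) (c s))) else 0 := by
    intro vks
    simp only [E.apply_eq, hE]
    rw [kronPi_insertAt_sum]
    refine Finset.sum_congr rfl fun c _ => ?_
    rw [kronPi_insertAt_ite]
    exact if_congr (by simp [funext_iff]) rfl rfl
  simp only [slotProb_eq, h, map_sum]
  rw [Finset.sum_comm]
  refine Finset.sum_congr rfl fun c _ => ?_
  rw [Finset.sum_eq_single fun s => E.out (p s) (c s)]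
  · rw [if_pos rfl, map_smul, smul_eq_mul]
  · intro vks _ hne
    rw [if_neg hne.symm, map_zero]
  · simp

/-- The success probability with a secret key for `x` if slot `s` is an encryption of
`r s (m i)`, where `m i` is the bit of the plaintext that belongs to `s`. -/
def hybridProb {A : Type} [Fintype A] [DecidableEq A]
    (K : QAlg Unit (Bits pkLen × Bits skLen) Empty Empty)
    (E : QAlg (Bits pkLen × Bits 1) (Bits vkLen) Empty T)
    (Ch : QAlg (Fin N × Bool → Bits pkLen) (Bits N) A B) (ρ : QOp A A)
    (x : Bits N) (r : Fin N × Bool → Bool → Bool) : ℝ :=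
  ∑ pk, ∑ msk, ∑ m, ∑ vk, (∏ s, K.prob () (pk s, msk s) 1) *
    slotProb V De Gu x vk msk (Ch.apply pk m ρ)
      (fun s => E.apply (pk s, fun _ => r s (m s.1)) (vk s) 1)

end slot

/-- The encryptions in the other slots depend on `m`, hence on the adversary, and cannot be fixed as
they stand. Drawing one branch `c s b` for each possible bit `b` removes this dependence: the
branches are independent of `m`, and those not selected by `m` sum out. The average over `F` and `c`
is thereby outermost, and the inner sum is the value from `exists_localAdversary`. -/
theorem hybridProb_insertAt {N pkLen skLen vkLen ctLen certLen : ℕ} {A B B' : Type}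
    [Fintype A] [DecidableEq A] [Fintype B] [DecidableEq B] [Fintype B'] [DecidableEq B']
    (K : QAlg Unit (Bits pkLen × Bits skLen) Empty Empty)
    (E : QAlg (Bits pkLen × Bits 1) (Bits vkLen) Empty (Fin ctLen))
    (V : QAlg (Bits vkLen) Bool (Fin certLen) Empty)
    (Ch : QAlg (Fin N × Bool → Bits pkLen) (Bits N) A B) (ρ : QOp A A)
    (De : QAlg (Bits N × (Fin N → Bits skLen)) Unit (B ⊕ ((Fin N × Bool) × Fin ctLen))
      (((Fin N × Bool) × Fin certLen) ⊕ B'))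
    (Gu : QAlg (Option (Fin N × Bool → Bits skLen)) Bool B' Empty)
    (w : ∀ p, E.κ p → ℝ) (ψ : ∀ p, E.κ p → (Fin ctLen → Bool) → ℂ)
    (hw : ∀ p, ∑ c, w p c = 1)
    (hE : ∀ p c, E.op p c * (1 : QOp Empty Empty) * (E.op p c)ᴴ = (w p c : ℂ) • pureState (ψ p c))
    (x : Bits N) (s₀ : Fin N × Bool) (r₀ : Bool → Bool) (r : {s // s ≠ s₀} → Bool → Bool) :
    hybridProb V De Gu K E Ch ρ x (insertAt s₀ r₀ r) =
      ∑ F : {s // s ≠ s₀} → Bits pkLen × Bits skLen, (∏ s, K.prob () (F s) 1) *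
        ∑ c : ∀ s b, E.κ ((F s).1, fun _ => r s b), (∏ s, ∏ b, w _ (c s b)) *
          ∑ pk, ∑ sk, ∑ vk, ∑ m, K.prob () (pk, sk) 1 *
            slotProb V De Gu x
              (insertAt s₀ vk fun s => E.out ((F s).1, fun _ => r s (m s.1.1)) (c s (m s.1.1)))
              (insertAt s₀ sk fun s => (F s).2)
              (Ch.apply (insertAt s₀ pk fun s => (F s).1) m ρ)
              (insertAt s₀ (E.apply (pk, fun _ => r₀ (m s₀.1)) vk 1)
                fun s => pureState (ψ _ (c s (m s.1.1)))) := by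
  classical
  have hF : ∀ F : {s // s ≠ s₀} → Bits pkLen × Bits skLen,
      (∑ c : ∀ s b, E.κ ((F s).1, fun _ => r s b), (∏ s, ∏ b, w _ (c s b)) *
          ∑ pk, ∑ sk, ∑ vk, ∑ m, K.prob () (pk, sk) 1 *
            slotProb V De Gu x
              (insertAt s₀ vk fun s => E.out ((F s).1, fun _ => r s (m s.1.1)) (c s (m s.1.1)))
              (insertAt s₀ sk fun s => (F s).2)
              (Ch.apply (insertAt s₀ pk fun s => (F s).1) m ρ)
              (insertAt s₀ (E.apply (pk, fun _ => r₀ (m s₀.1)) vk 1)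
                fun s => pureState (ψ _ (c s (m s.1.1))))) =
      ∑ pk, ∑ sk, ∑ m, ∑ vk, ∑ vks, K.prob () (pk, sk) 1 *
        slotProb V De Gu x (insertAt s₀ vk vks) (insertAt s₀ sk fun s => (F s).2)
          (Ch.apply (insertAt s₀ pk fun s => (F s).1) m ρ)
          (insertAt s₀ (E.apply (pk, fun _ => r₀ (m s₀.1)) vk 1)
            fun s => E.apply ((F s).1, fun _ => r s (m s.1.1)) (vks s) 1) := by
    intro F
    simp only [Finset.mul_sum]
    rw [Finset.sum_comm]
    refine Finset.sum_congr rfl fun pk _ => ?_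
    rw [Finset.sum_comm]
    refine Finset.sum_congr rfl fun sk _ => ?_
    rw [Finset.sum_comm, Finset.sum_comm (γ := Bits N)]
    refine Finset.sum_congr rfl fun vk _ => ?_
    rw [Finset.sum_comm]
    refine Finset.sum_congr rfl fun m _ => ?_
    rw [← Finset.mul_sum, sum_slotProb_insertAt V De Gu E w ψ hE,
      ← sum_pi_select (fun s b => w ((F s).1, fun _ => r s b)) (fun s b => hw _)
        (fun s => m s.1.1) (fun u => slotProb V De Gu x
              (insertAt s₀ vk fun s => E.out ((F s).1, fun _ => r s (m s.1.1)) (u s))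
              (insertAt s₀ sk fun s => (F s).2)
              (Ch.apply (insertAt s₀ pk fun s => (F s).1) m ρ)
              (insertAt s₀ (E.apply (pk, fun _ => r₀ (m s₀.1)) vk 1)
                fun s => pureState (ψ _ (u s)))), Finset.mul_sum]
    exact Finset.sum_congr rfl fun c _ => by ring
  simp only [hF]
  rw [hybridProb, sum_insertAt s₀]
  have e : ∀ G : ({s // s ≠ s₀} → Bits pkLen × Bits skLen) → ℝ,
      ∑ F, G F = ∑ pks : {s // s ≠ s₀} → Bits pkLen, ∑ sks : {s // s ≠ s₀} → Bits skLen,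
        G fun s => (pks s, sks s) := by
    intro G
    rw [← (Equiv.arrowProdEquivProdArrow {s // s ≠ s₀} (fun _ => Bits pkLen)
      (fun _ => Bits skLen)).symm.sum_comp, Fintype.sum_prod_type]
    rfl
  rw [e, Finset.sum_comm]
  refine Finset.sum_congr rfl fun pks _ => ?_
  simp only [sum_insertAt s₀, Finset.mul_sum]
  rw [Finset.sum_congr rfl fun pk _ => Finset.sum_comm, Finset.sum_comm]
  refine Finset.sum_congr rfl fun sks _ => Finset.sum_congr rfl fun pk _ =>
    Finset.sum_congr rfl fun sk _ => Finset.sum_congr rfl fun m _ =>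
    Finset.sum_congr rfl fun vk _ => Finset.sum_congr rfl fun vks _ => ?_
  rw [Fintype.prod_eq_mul_prod_subtype_ne _ s₀]
  have e2 : (fun s => E.apply (insertAt s₀ pk pks s, fun _ => insertAt s₀ r₀ r s (m s.1))
      (insertAt s₀ vk vks s) 1) = insertAt s₀ (E.apply (pk, fun _ => r₀ (m s₀.1)) vk 1)
        fun s => E.apply (pks s, fun _ => r s (m s.1.1)) (vks s) 1 := by
    funext s
    by_cases hs : s = s₀
    · subst hs
      simp only [insertAt_self]
    · simp only [insertAt_of_ne _ _ _ hs]
  rw [e2]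
  simp only [insertAt_self, insertAt_coe]
  ring

/-- The weights of `F` and `c` are the same in both hybrids. It therefore suffices to bound the
difference for fixed choices, where it is the advantage of one local adversary. -/
theorem abs_hybridProb_insertAt_sub_le {N pkLen skLen vkLen ctLen certLen : ℕ} {A B B' : Type}
    [Fintype A] [DecidableEq A] [Fintype B] [DecidableEq B] [Fintype B'] [DecidableEq B']
    (K : QAlg Unit (Bits pkLen × Bits skLen) Empty Empty)
    (E : QAlg (Bits pkLen × Bits 1) (Bits vkLen) Empty (Fin ctLen))
    (V : QAlg (Bits vkLen) Bool (Fin certLen) Empty)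
    (adv : (A → Bool) → ℂ) (hadv : ∑ v, ‖adv v‖ ^ 2 = 1)
    (Ch : QAlg (Fin N × Bool → Bits pkLen) (Bits N) A B)
    (C₁ : Circuit (BitEnc.Lbl (Fin N × Bool → Bits pkLen) ⊕ A) (BitEnc.Lbl (Bits N) ⊕ B))
    (hC₁ : C₁.Computes Ch)
    (De : QAlg (Bits N × (Fin N → Bits skLen)) Unit (B ⊕ ((Fin N × Bool) × Fin ctLen))
      (((Fin N × Bool) × Fin certLen) ⊕ B'))
    (C₂ : Circuit (BitEnc.Lbl (Bits N × (Fin N → Bits skLen)) ⊕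
        (B ⊕ ((Fin N × Bool) × Fin ctLen)))
      (BitEnc.Lbl Unit ⊕ (((Fin N × Bool) × Fin certLen) ⊕ B')))
    (hC₂ : C₂.Computes De)
    (Gu : QAlg (Option (Fin N × Bool → Bits skLen)) Bool B' Empty) {ε : ℝ}
    (hε : ∀ a : LocalAdversary pkLen skLen ctLen certLen,
      a.chooseCircuit.size ≤ 2 * C₁.size + 2 * (N * 2 * (2 * ctLen)) + 3 * N + 3 →
      a.deleteCircuit.size ≤ 2 * C₂.size + 2 * N + 23 * (N * 2 * ctLen) →
      |a.value K E V false - a.value K E V true| ≤ ε)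
    (x : Bits N) (s₀ : Fin N × Bool) (hs₀ : ∀ i, (i, x i) ≠ s₀)
    (r : {s // s ≠ s₀} → Bool → Bool) :
    |hybridProb V De Gu K E Ch (pureState adv) x (insertAt s₀ (xor false) r) -
      hybridProb V De Gu K E Ch (pureState adv) x (insertAt s₀ (xor true) r)| ≤ ε := by
  choose w ψ hw0 hw1 hψ hE using E.exists_ensemble
  rw [hybridProb_insertAt K E V Ch _ De Gu w ψ hw1 hE, hybridProb_insertAt K E V Ch _ De Gu w ψ hw1 hE]
  refine abs_sum_sub_sum_le _ _ _ (fun F => Finset.prod_nonneg fun s _ => K.prob_nonneg _ _) ?_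
    fun F => ?_
  · have := Finset.prod_univ_sum (fun _ : {s // s ≠ s₀} => Finset.univ)
      fun _ y => K.prob () y 1
    rw [Fintype.piFinset_univ] at this
    rw [← this]
    exact Finset.prod_eq_one fun s _ => K.sum_prob_one ()
  refine abs_sum_sub_sum_le _ _ _ (fun c => Finset.prod_nonneg fun s _ =>
    Finset.prod_nonneg fun b _ => hw0 _ _) ?_ fun c => ?_
  -- That the weights of the pairs of branches sum to `1` is the case of the constant function `1`;
  -- the selection `false` is arbitrary.
  · have := sum_pi_select (fun (s : {s // s ≠ s₀}) b => w ((F s).1, fun _ => r s b))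
      (fun s b => hw1 _) (fun _ => false) fun _ => 1
    simp only [mul_one] at this
    rw [this]
    have := Finset.prod_univ_sum (fun s : {s // s ≠ s₀} =>
      (Finset.univ : Finset (E.κ ((F s).1, fun _ => r s false)))) fun s c => w _ c
    rw [Fintype.piFinset_univ] at this
    rw [← this]
    exact Finset.prod_eq_one fun s _ => hw1 _
  obtain ⟨a, h₁, h₂, ha⟩ := exists_localAdversary K E V adv hadv Ch C₁ hC₁ De C₂ hC₂ Gu x s₀ hs₀
    (fun s => (F s).1) (fun s => (F s).2) (fun s b => E.out _ (c s b)) (fun s b => ψ _ (c s b))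
    fun s b => hψ _ _
  have := hε a h₁ h₂
  rw [ha, ha] at this
  exact this

/-! ### The chain of hybrids. -/

/-- Slots `(i, α)` with `α ≠ x i` hold the negated bit for the first `j` indices `i`. -/
def hybridMask {N : ℕ} (x : Bits N) (j : ℕ) (s : Fin N × Bool) (b : Bool) : Bool :=
  xor (decide (s.1.val < j ∧ s.2 ≠ x s.1)) b

/-- Both `j` and `j + 1` are covered by the bit `β`: it is exactly the value with which slot `(j, ¬x
j)` is masked, so the two hybrids correspond to the two challenge bits of the reduction. -/
theorem hybridMask_insertAt {N : ℕ} (x : Bits N) (j : Fin N) (β : Bool) :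
    hybridMask x (j + β.toNat) = insertAt (j, !x j) (xor β) fun s => hybridMask x j s := by
  funext s b
  by_cases hs : s = (j, !x j)
  · subst hs
    rw [insertAt_self]
    cases β <;> simp [hybridMask]
  · rw [insertAt_of_ne _ _ _ hs]
    unfold hybridMask
    congr 2
    obtain ⟨i, α⟩ := s
    rw [eq_iff_iff]
    refine and_congr_left fun hα => ?_
    -- For `i = j` the condition `α ≠ x i` would make this the slot `(j, ¬x j)`. For `i ≠ j` the
    -- bounds `i < j` and `i < j + 1` are equivalent.
    have hij : i.val ≠ j.val := by
      intro h
      have : i = j := Fin.ext h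
      subst this
      refine hs (Prod.ext rfl ?_)
      cases α <;> cases h : x i <;> simp_all
    cases β
    · simp
    · simp
      omega

theorem abs_sub_le_mul_of_step (f : ℕ → ℝ) (N : ℕ) {ε : ℝ}
    (h : ∀ j < N, |f j - f (j + 1)| ≤ ε) : |f 0 - f N| ≤ N * ε := by
  induction N with
  | zero => simp
  | succ N ih =>
    have h1 := ih fun j hj => h j (Nat.lt_succ_of_lt hj)
    have h2 := h N (Nat.lt_succ_self N)
    have h3 := abs_sub_le (f 0) (f N) (f (N + 1))
    push_cast
    linarith

theorem one_submatrix_empty {J : Type} [Fintype J] [DecidableEq J] (e : Empty ≃ J × Empty) :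
    (1 : QOp Empty Empty).submatrix (fun v : J × Empty → Bool => v ∘ e)
      (fun v : J × Empty → Bool => v ∘ e) = kronPi fun _ : J => (1 : QOp Empty Empty) := by
  rw [kronPi_one]
  ext u v
  rw [Subsingleton.elim u v]
  simp

namespace QAlg

theorem apply_parallel_one {X Y X' Y' J O : Type} [Fintype J] [DecidableEq J] [Fintype O]
    [DecidableEq O] (A : QAlg X Y Empty O) (f : X' → J → X) (g : X' → (J → Y) → Y') (x : X')
    (y : J → Y) (y' : Y') (h : ∀ z, g x z = y' ↔ z = y) :
    (((A.parallel J).reindex (Equiv.equivOfIsEmpty (J × Empty) Empty) (Equiv.refl _)).wrap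
      f g).apply x y' 1 = kronPi fun j => A.apply (f x j) (y j) 1 := by
  rw [apply_wrap _ _ _ _ _ y h, apply_reindex]
  rw [one_submatrix_empty, apply_parallel]
  rfl

theorem prob_parallel_one {X Y X' Y' J : Type} [Fintype J] [DecidableEq J]
    (A : QAlg X Y Empty Empty) (f : X' → J → X) (g : X' → (J → Y) → Y') (x : X')
    (y : J → Y) (y' : Y') (h : ∀ z, g x z = y' ↔ z = y) :
    (((A.parallel J).reindex (Equiv.equivOfIsEmpty (J × Empty) Empty)
      (Equiv.equivOfIsEmpty (J × Empty) Empty)).wrap f g).prob x y' 1 =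
        ∏ j, A.prob (f x j) (y j) 1 := by
  rw [prob, apply_wrap _ _ _ _ _ y h, apply_reindex]
  rw [one_submatrix_empty, apply_parallel]
  have e : ∀ M : QOp (J × Empty) (J × Empty), (M.submatrix
      (fun v : Empty → Bool => v ∘ (Equiv.equivOfIsEmpty (J × Empty) Empty))
      (fun v : Empty → Bool => v ∘ (Equiv.equivOfIsEmpty (J × Empty) Empty))).trace = M.trace := by
    intro M
    exact Fintype.sum_equiv
      ((Equiv.equivOfIsEmpty (J × Empty) Empty).arrowCongr (Equiv.refl Bool)).symm _ _ fun v => rfl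
  rw [e, trace_kronPi]
  simp only [trace_apply_one]
  rw [← Complex.ofReal_prod, Complex.ofReal_re]

end QAlg

/-! ### The real and the fake experiment as the end points of the chain. -/

section experiment

variable {N pkLen skLen vkLen : ℕ} {T : Type} [Fintype T] [DecidableEq T]

/-- Generate a key pair for every slot. -/
def slotSetup (N : ℕ) (K : QAlg Unit (Bits pkLen × Bits skLen) Empty Empty) :
    QAlg Unit ((Fin N × Bool → Bits pkLen) × (Fin N × Bool → Bits skLen)) Empty Empty :=
  ((K.parallel (Fin N × Bool)).reindex (Equiv.equivOfIsEmpty _ _) (Equiv.equivOfIsEmpty _ _)).wrap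
    (fun _ _ => ()) (fun _ y => (fun j => (y j).1, fun j => (y j).2))

/-- Draw the string `x` and select the secret keys. -/
def slotKeyGen (N skLen : ℕ) :
    QAlg (Fin N × Bool → Bits skLen) (Bits N × (Fin N → Bits skLen)) Empty Empty :=
  QAlg.sampled (S := Bits N) (QAlg.ret fun p => (p.2, fun i => p.1 (i, p.2 i)))

/-- Encrypt every bit in both of its slots. -/
def slotEnc (N : ℕ) (E : QAlg (Bits pkLen × Bits 1) (Bits vkLen) Empty T) :
    QAlg ((Fin N × Bool → Bits pkLen) × Bits N) (Fin N × Bool → Bits vkLen) Empty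
      ((Fin N × Bool) × T) :=
  ((E.parallel (Fin N × Bool)).reindex (Equiv.equivOfIsEmpty _ _) (Equiv.refl _)).wrap
    (fun p j => (p.1 j, fun _ => p.2 j.1)) (fun _ vk => vk)

/-- Encrypt both bits for every index, in the order given by a random string. -/
def slotFake (N : ℕ) (E : QAlg (Bits pkLen × Bits 1) (Bits vkLen) Empty T) :
    QAlg (Fin N × Bool → Bits pkLen) ((Fin N × Bool → Bits vkLen) × Bits N) Empty
      ((Fin N × Bool) × T) :=
  QAlg.sampled (S := Bits N)
    (((E.parallel (Fin N × Bool)).reindex (Equiv.equivOfIsEmpty _ _) (Equiv.refl _)).wrap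
      (fun p j => (p.1 j, fun _ => xor j.2 (p.2 j.1))) (fun p vk => (vk, p.2)))

/-- Select the secret keys that open a fake ciphertext. -/
def slotReveal (N pkLen skLen : ℕ) :
    QAlg ((Fin N × Bool → Bits pkLen) × (Fin N × Bool → Bits skLen) × Bits N × Bits N)
      (Bits N × (Fin N → Bits skLen)) Empty Empty :=
  QAlg.ret fun p =>
    (fun i => xor (p.2.2.1 i) (p.2.2.2 i), fun i => p.2.1 (i, xor (p.2.2.1 i) (p.2.2.2 i)))

theorem slotSetup_prob (K : QAlg Unit (Bits pkLen × Bits skLen) Empty Empty)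
    (pk : Fin N × Bool → Bits pkLen) (msk : Fin N × Bool → Bits skLen) :
    (slotSetup N K).prob () (pk, msk) 1 = ∏ s, K.prob () (pk s, msk s) 1 := by
  refine QAlg.prob_parallel_one K (fun _ _ => ())
    (fun _ y => (fun j => (y j).1, fun j => (y j).2)) () (fun s => (pk s, msk s)) _ fun z => ?_
  constructor
  · intro h
    obtain ⟨h1, h2⟩ := Prod.mk.inj h
    exact funext fun s => Prod.ext (congrFun h1 s) (congrFun h2 s)
  · rintro rfl
    rfl

variable (E : QAlg (Bits pkLen × Bits 1) (Bits vkLen) Empty T)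

theorem slotEnc_apply (pk : Fin N × Bool → Bits pkLen) (m : Bits N)
    (vk : Fin N × Bool → Bits vkLen) :
    (slotEnc N E).apply (pk, m) vk 1 =
      kronPi fun s => E.apply (pk s, fun _ => m s.1) (vk s) 1 :=
  QAlg.apply_parallel_one E (fun p : (Fin N × Bool → Bits pkLen) × Bits N =>
    fun j => (p.1 j, fun _ => p.2 j.1)) (fun _ vk => vk) (pk, m) vk vk fun _ => Iff.rfl

/-- The string drawn is part of the output, so only the draw equal to `aux` contributes, and its
probability remains as a scalar. -/
theorem slotFake_apply (pk : Fin N × Bool → Bits pkLen) (aux : Bits N)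
    (vk : Fin N × Bool → Bits vkLen) :
    (slotFake N E).apply pk (vk, aux) 1 = (((Fintype.card (Bits N) : ℝ)⁻¹ : ℝ) : ℂ) •
      kronPi fun s => E.apply (pk s, fun _ => xor s.2 (aux s.1)) (vk s) 1 := by
  rw [slotFake, QAlg.apply_sampled]
  congr 1
  rw [Finset.sum_eq_single aux]
  · exact QAlg.apply_parallel_one E (fun p : (Fin N × Bool → Bits pkLen) × Bits N =>
      fun j => (p.1 j, fun _ => xor j.2 (p.2 j.1))) (fun p vk => (vk, p.2)) (pk, aux) vk (vk, aux)
        fun z => ⟨fun h => (Prod.mk.inj h).1, fun h => by rw [h]⟩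
  · intro aux' _ hne
    refine QAlg.wrap_apply_eq_zero _ _ _ (pk, aux') _ (fun z h => ?_) _
    exact hne (Prod.mk.inj h).2
  · simp

open Classical in
theorem slotKeyGen_prob (msk : Fin N × Bool → Bits skLen) (sk : Bits N × (Fin N → Bits skLen)) :
    (slotKeyGen N skLen).prob msk sk 1 = (Fintype.card (Bits N) : ℝ)⁻¹ *
      ∑ x : Bits N, if (x, fun i => msk (i, x i)) = sk then 1 else 0 := by
  rw [QAlg.prob, slotKeyGen, QAlg.apply_sampled, Matrix.trace_smul, Matrix.trace_sum]
  simp only [QAlg.apply_ret]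
  have h2 : ∀ x : Bits N, (if (x, fun i => msk (i, x i)) = sk then (1 : QOp Empty Empty)
      else 0).trace = (((if (x, fun i => msk (i, x i)) = sk then 1 else 0 : ℝ)) : ℂ) := by
    intro x
    split_ifs <;> simp
  rw [Finset.sum_congr rfl fun x _ => h2 x, ← Complex.ofReal_sum, smul_eq_mul,
    ← Complex.ofReal_mul, Complex.ofReal_re]

open Classical in
theorem slotReveal_prob (pk : Fin N × Bool → Bits pkLen) (msk : Fin N × Bool → Bits skLen)
    (aux m : Bits N) (sk : Bits N × (Fin N → Bits skLen)) :
    (slotReveal N pkLen skLen).prob (pk, msk, aux, m) sk 1 =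
      if ((fun i => xor (aux i) (m i) : Bits N), fun i => msk (i, xor (aux i) (m i))) = sk
        then 1 else 0 := by
  rw [QAlg.prob, slotReveal, QAlg.apply_ret]
  split_ifs <;> simp

/-- The challenger's answer in the receiver non-committing experiment. -/
def slotChallenge (b : Bool) (pk : Fin N × Bool → Bits pkLen) (msk : Fin N × Bool → Bits skLen)
    (m : Bits N) (vk : Fin N × Bool → Bits vkLen) (sk : Bits N × (Fin N → Bits skLen)) :
    QOp ((Fin N × Bool) × T) ((Fin N × Bool) × T) :=
  match b with
  | false => ((slotKeyGen N skLen).prob msk sk 1 : ℂ) • (slotEnc N E).apply (pk, m) vk 1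
  | true => ∑ aux, ((slotReveal N pkLen skLen).prob (pk, msk, aux, m) sk 1 : ℂ) •
      (slotFake N E).apply pk (vk, aux) 1

/-- The challenger's answer is a mixture over the string `x` of the secret key. -/
theorem sum_slotChallenge (b : Bool) (pk : Fin N × Bool → Bits pkLen)
    (msk : Fin N × Bool → Bits skLen) (m : Bits N) (vk : Fin N × Bool → Bits vkLen)
    (L : Bits N × (Fin N → Bits skLen) →
      QOp ((Fin N × Bool) × T) ((Fin N × Bool) × T) →ₗ[ℝ] ℝ) :
    ∑ sk, L sk (slotChallenge E b pk msk m vk sk) =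
      (Fintype.card (Bits N) : ℝ)⁻¹ * ∑ x : Bits N, L (x, fun i => msk (i, x i))
        (kronPi fun s => E.apply
          (pk s, fun _ => hybridMask x (if b then N else 0) s (m s.1)) (vk s) 1) := by
  classical
  have hsmul : ∀ (c : ℝ) sk (ρ : QOp ((Fin N × Bool) × T) ((Fin N × Bool) × T)),
      L sk ((c : ℂ) • ρ) = c * L sk ρ := by
    intro c sk ρ
    rw [← smul_eq_mul, ← map_smul]
    rfl
  cases b
  · have h : ∀ sk, L sk (slotChallenge E false pk msk m vk sk) =
        (Fintype.card (Bits N) : ℝ)⁻¹ * ∑ x : Bits N,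
          if (x, fun i => msk (i, x i)) = sk then L sk
            (kronPi fun s => E.apply (pk s, fun _ => m s.1) (vk s) 1) else 0 := by
      intro sk
      rw [slotChallenge, slotEnc_apply, hsmul, slotKeyGen_prob, mul_assoc, Finset.sum_mul]
      simp only [ite_mul, one_mul, zero_mul]
    rw [Finset.sum_congr rfl fun sk _ => h sk, ← Finset.mul_sum, Finset.sum_comm]
    congr 1
    refine Finset.sum_congr rfl fun x _ => ?_
    rw [Finset.sum_ite_eq, if_pos (Finset.mem_univ _)]
    simp [hybridMask]
  · have h : ∀ sk, L sk (slotChallenge E true pk msk m vk sk) =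
        (Fintype.card (Bits N) : ℝ)⁻¹ * ∑ aux : Bits N,
          if ((fun i => xor (aux i) (m i) : Bits N), fun i => msk (i, xor (aux i) (m i))) = sk
            then L sk (kronPi fun s => E.apply
              (pk s, fun _ => xor s.2 (aux s.1)) (vk s) 1) else 0 := by
      intro sk
      rw [slotChallenge, map_sum, Finset.mul_sum]
      refine Finset.sum_congr rfl fun aux _ => ?_
      rw [hsmul, slotFake_apply, hsmul, slotReveal_prob]
      split_ifs <;> ring
    rw [Finset.sum_congr rfl fun sk _ => h sk, ← Finset.mul_sum, Finset.sum_comm]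
    congr 1
    -- Exclusive or with `m` is a bijection, which allows the sum over `x*` to be written as a sum
    -- over `x = x* ⊕ m`.
    have hinv : Function.Involutive fun (x : Bits N) i => xor (x i) (m i) := by
      intro x
      funext i
      simp
    let σ : Equiv.Perm (Bits N) := hinv.toPerm _
    have hσ : ∀ x i, σ x i = xor (x i) (m i) := fun _ _ => rfl
    refine (Fintype.sum_equiv σ _ _ fun x => ?_).symm
    rw [Finset.sum_ite_eq, if_pos (Finset.mem_univ _)]
    have e1 : ∀ i, xor (σ x i) (m i) = x i := fun i => by simp [hσ]
    -- Slot `(i, α)` holds `α ⊕ x*[i] = (α ⊕ x[i]) ⊕ m[i]`, that is `m[i]` negated exactly if `α ≠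
    -- x[i]`.
    have e2 : ∀ s : Fin N × Bool, xor s.2 (σ x s.1) = hybridMask x N s (m s.1) := by
      intro s
      simp only [hσ, hybridMask, Fin.is_lt, true_and]
      cases s.2 <;> cases x s.1 <;> cases m s.1 <;> rfl
    simp only [e1, e2, if_true]

variable {A B B' D : Type} [Fintype A] [DecidableEq A] [Fintype B] [DecidableEq B] [Fintype B']
    [DecidableEq B'] [Fintype D] [DecidableEq D]

/-- Success depends linearly on the ciphertext state, and the distribution of `x` does not depend on
the keys or on `m`. The average over `x` can therefore be taken last, and each `x` is treated
separately. -/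
theorem sum_slotChallenge_eq_hybridProb (K : QAlg Unit (Bits pkLen × Bits skLen) Empty Empty)
    (V : QAlg (Bits vkLen) Bool D Empty)
    (Ch : QAlg (Fin N × Bool → Bits pkLen) (Bits N) A B) (ρ : QOp A A)
    (De : QAlg (Bits N × (Fin N → Bits skLen)) Unit (B ⊕ ((Fin N × Bool) × T))
      (((Fin N × Bool) × D) ⊕ B'))
    (Gu : QAlg (Option (Fin N × Bool → Bits skLen)) Bool B' Empty) (b : Bool) :
    ∑ pk, ∑ msk, ∑ m, ∑ vk, ∑ sk, (slotSetup N K).prob () (pk, msk) 1 *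
        ((QAlg.verifyAll (Fin N × Bool) V).certify Gu).prob (vk, msk) (some true)
          (De.apply sk () (kron2 (Ch.apply pk m ρ) (slotChallenge E b pk msk m vk sk))) =
      ∑ x : Bits N, (Fintype.card (Bits N) : ℝ)⁻¹ *
        hybridProb V De Gu K E Ch ρ x (hybridMask x (if b then N else 0)) := by
  have h : ∀ pk msk m vk, (∑ sk, (slotSetup N K).prob () (pk, msk) 1 *
        ((QAlg.verifyAll (Fin N × Bool) V).certify Gu).prob (vk, msk) (some true)
          (De.apply sk () (kron2 (Ch.apply pk m ρ) (slotChallenge E b pk msk m vk sk)))) =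
      ∑ x : Bits N, (Fintype.card (Bits N) : ℝ)⁻¹ * ((∏ s, K.prob () (pk s, msk s) 1) *
          slotProb V De Gu x vk msk (Ch.apply pk m ρ) (fun s => E.apply
              (pk s, fun _ => hybridMask x (if b then N else 0) s (m s.1)) (vk s) 1)) := by
    intro pk msk m vk
    rw [← Finset.mul_sum, slotSetup_prob]
    refine (congrArg _ (sum_slotChallenge E b pk msk m vk fun sk => slotProbₗ V De Gu sk vk msk
      (Ch.apply pk m ρ))).trans ?_
    rw [mul_left_comm, Finset.mul_sum, Finset.mul_sum]
    rfl
  simp only [h, hybridProb, Finset.mul_sum]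
  symm
  rw [Finset.sum_comm]
  refine Finset.sum_congr rfl fun pk _ => ?_
  rw [Finset.sum_comm]
  refine Finset.sum_congr rfl fun msk _ => ?_
  rw [Finset.sum_comm]
  refine Finset.sum_congr rfl fun m _ => ?_
  rw [Finset.sum_comm]

end experiment

theorem PKE.toRNCE_certEverExp (P : PKE fun _ => 1) (n : ℕ → ℕ) (k : ℕ)
    (A : (P.toRNCE n).Adversary) (b : Bool) :
    (P.toRNCE n).certEverExp A k b (some true) =
      ∑ x : Bits (n k), (Fintype.card (Bits (n k)) : ℝ)⁻¹ *
        hybridProb (P.vrfy k) (A.delete k) (A.guess k) (P.keyGen k) (P.enc k)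
          (A.choose k) (pureState (A.advice k)) x (hybridMask x (if b then n k else 0)) := by
  refine Eq.trans ?_ (sum_slotChallenge_eq_hybridProb (P.enc k) (P.keyGen k) (P.vrfy k)
    (A.choose k) (pureState (A.advice k)) (A.delete k) (A.guess k) b)
  -- The algorithms of the construction unfold to the slot algorithms; the case distinction lets the
  -- two definitions of the challenge reduce.
  cases b <;> rfl

/-! ### Polynomial bounds and the conclusion. -/

theorem Polynomial.exists_eval_le_pow (p : Polynomial ℕ) :
    ∃ d k₀ : ℕ, ∀ k > k₀, p.eval k ≤ k ^ d := by
  induction p using Polynomial.induction_on' with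
  | add p q hp hq =>
    obtain ⟨d, k₀, h⟩ := hp
    obtain ⟨d', k₁, h'⟩ := hq
    -- The additional degree absorbs the factor two of the sum, since `k ≥ 2`.
    refine ⟨max d d' + 1, max (max k₀ k₁) 2, fun k hk => ?_⟩
    have hk2 : 2 ≤ k := by omega
    have h1 := (h k (by omega)).trans (Nat.pow_le_pow_right (by omega) (le_max_left d d'))
    have h2 := (h' k (by omega)).trans (Nat.pow_le_pow_right (by omega) (le_max_right d d'))
    rw [Polynomial.eval_add, pow_succ]
    nlinarith
  | monomial d a =>
    refine ⟨d + 1, a, fun k hk => ?_⟩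
    rw [Polynomial.eval_monomial, pow_succ, mul_comm]
    exact Nat.mul_le_mul_left _ hk.le

/-- If a public key encryption scheme for single bits with certified everlasting deletion is
certified everlasting IND-CPA secure, then the receiver non-committing encryption scheme built
from it, for plaintexts of polynomially many bits, is certified everlasting RNC secure. -/
theorem mainTheorem9 (P : PKE fun _ => 1) (hP : P.IsQPT) (n : ℕ → ℕ)
    (hn : ∃ p : Polynomial ℕ, ∀ k, n k ≤ p.eval k) (hsec : P.CertEverINDCPA) :
    (P.toRNCE n).CertEverRNC := by
  rintro A ⟨⟨p₁, hp₁⟩, ⟨p₂, hp₂⟩⟩ c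
  obtain ⟨pn, hpn⟩ := hn
  obtain ⟨p, hp⟩ := hP.exists_poly
  obtain ⟨d, k₁, hd⟩ := pn.exists_eval_le_pow
  -- The polynomial dominates the sizes of both circuits of the reduction; `46 = 23 * 2` comes from
  -- the controlled swaps on the `2n` slots. In the exponent, `d` pays for the `n ≤ k ^ d` steps of
  -- the chain and `1` makes the final inequality strict.
  obtain ⟨k₀, hk₀⟩ := hsec.uniform hP
    (2 * p₁ + 2 * p₂ + 46 * pn * p + 3 * pn + 3) (d + c + 1)
  -- The bound `k > 1` is needed for `k ^ c < k ^ (c + 1)`.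
  refine ⟨max (max k₀ k₁) 1, fun k hk => ?_⟩
  obtain ⟨C₁, hs₁, hC₁⟩ := hp₁ k
  obtain ⟨C₂, hs₂, hC₂⟩ := hp₂ k
  have hk' : (1 : ℝ) < k := by
    have : 1 < k := by omega
    exact_mod_cast this
  have hmul : n k * P.ctLen k ≤ pn.eval k * p.eval k := Nat.mul_le_mul (hpn k) (hp k).2.1
  have hnk := hpn k
  have hq₁ : ∀ l ≤ p₁.eval k, 2 * l + 2 * (n k * 2 * (2 * P.ctLen k)) + 3 * n k + 3 ≤
      (2 * p₁ + 2 * p₂ + 46 * pn * p + 3 * pn + 3).eval k := by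
    intro l hl
    simp only [Polynomial.eval_add, Polynomial.eval_mul, Polynomial.eval_ofNat]
    nlinarith
  have hq₂ : ∀ l ≤ p₂.eval k, 2 * l + 2 * n k + 23 * (n k * 2 * P.ctLen k) ≤
      (2 * p₁ + 2 * p₂ + 46 * pn * p + 3 * pn + 3).eval k := by
    intro l hl
    simp only [Polynomial.eval_add, Polynomial.eval_mul, Polynomial.eval_ofNat]
    nlinarith
  set ε : ℝ := ((k : ℝ) ^ (d + c + 1))⁻¹ with hε
  have step : ∀ (x : Bits (n k)),
      |hybridProb (P.vrfy k) (A.delete k) (A.guess k) (P.keyGen k) (P.enc k)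
        (A.choose k) (pureState (A.advice k)) x (hybridMask x 0) -
      hybridProb (P.vrfy k) (A.delete k) (A.guess k) (P.keyGen k) (P.enc k)
        (A.choose k) (pureState (A.advice k)) x (hybridMask x (n k))| ≤ n k * ε := by
    intro x
    refine abs_sub_le_mul_of_step (fun j => hybridProb (P.vrfy k) (A.delete k) (A.guess k)
      (P.keyGen k) (P.enc k) (A.choose k) (pureState (A.advice k)) x (hybridMask x j)) (n k)
      fun j hj => ?_
    have h0 := hybridMask_insertAt x ⟨j, hj⟩ false
    have h1 := hybridMask_insertAt x ⟨j, hj⟩ true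
    simp only [Bool.toNat_false, Bool.toNat_true, add_zero] at h0 h1
    rw [h0, h1]
    refine abs_hybridProb_insertAt_sub_le (P.keyGen k) (P.enc k) (P.vrfy k) (A.advice k)
      (A.advice_norm k) (A.choose k) C₁ hC₁ (A.delete k) C₂ hC₂ (A.guess k) ?_ x _ ?_ _
    · intro a ha₁ ha₂
      exact (hk₀ k (by omega) a (ha₁.trans (hq₁ _ hs₁)) (ha₂.trans (hq₂ _ hs₂))).le
    -- The slot of the challenge is `(j, ¬x j)`, and the secret key for `x` contains only keys of
    -- slots `(i, x i)`.
    · intro i h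
      obtain ⟨h1, h2⟩ := Prod.mk.inj h
      subst h1
      simp at h2
  have hlt : (n k : ℝ) * ε < ((k : ℝ) ^ c)⁻¹ := by
    have h1 : (n k : ℝ) ≤ (k : ℝ) ^ d := by
      exact_mod_cast hnk.trans (hd k (by omega))
    have h2 : 0 < ε := by positivity
    calc (n k : ℝ) * ε ≤ (k : ℝ) ^ d * ε := mul_le_mul_of_nonneg_right h1 h2.le
      _ = ((k : ℝ) ^ (c + 1))⁻¹ := by
        rw [hε, add_assoc, pow_add _ d, mul_inv, ← mul_assoc, mul_inv_cancel₀ (by positivity),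
          one_mul]
      _ < ((k : ℝ) ^ c)⁻¹ :=
        inv_strictAnti₀ (by positivity) (pow_lt_pow_right₀ hk' (Nat.lt_succ_self c))
  refine lt_of_le_of_lt ?_ hlt
  change |(P.toRNCE n).certEverExp A k false (some true) -
    (P.toRNCE n).certEverExp A k true (some true)| ≤ _
  rw [P.toRNCE_certEverExp, P.toRNCE_certEverExp]
  refine abs_sum_sub_sum_le (fun _ => (Fintype.card (Bits (n k)) : ℝ)⁻¹) _ _
    (fun _ => by positivity) ?_ fun x => ?_
  · rw [Finset.sum_const, Finset.card_univ, nsmul_eq_mul, mul_inv_cancel₀]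
    exact_mod_cast Fintype.card_ne_zero
  · simpa using step x

end
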